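/- Let $M_1,\dots,M_m$ be germs at $0$ of real analytic totally real $n$-dimensional submanifolds of $\mathbb C^n$ passing through the origin. Let $\rho_i$ be the germ of antiholomorphic involution of $(\mathbb C^n,0)$ whose fixed point set is $M_i$, and write $\rho_i(z)=B_i\bar z+R_i(\bar z)$ with $B_i$ a matrix and $R_i$ a germ of holomorphic map with $R_i(0)=0$, $DR_i(0)=0$. Assume that the tangent spaces $\{z : B_i\bar z=z\}$ at the origin are pairwise distinct. Put $F_{i,j}=\rho_i\circ\rho_j$ and $D_{i,j}=B_i\bar B_j=DF_{i,j}(0)$. Assume that the group $G$ generated by the germs $F_{i,j}$ is abelian and that all the $D_{i,j}$ are diagonal, $D_{i,j}=\mathrm{diag}(\mu_{i,j,1},\dots,\mu_{i,j,n})$; write $\mu_{i,j}^Q=\prod_k\mu_{i,j,k}^{q_k}$ and $|Q|=\sum_k q_k$ for $Q=(q_1,\dots,q_n)\in\mathbb N^n$. Let $\mathcal I\neq\mathcal O_n$ be a proper ideal of the ring $\mathcal O_n$ of germs at $0$ of holomorphic functions on $\mathbb C^n$, generated by monomials and left invariant by the involutions $z\mapsto B_i\bar z$: for $f\in\mathcal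 I$, the germ $z\mapsto\overline{f(B_i\bar z)}$ is in $\mathcal I$. Let $\hat{\mathcal I}$ be the ideal generated by $\mathcal I$ in the ring of formal power series. For $A\subseteq\mathbb N^n$ and $k\ge1$ let $$\omega_k(A)=\inf\Big\{\max_{i,j}|\mu_{i,j}^Q-\mu_{i,j,l}|\neq0 \;:\; Q\in A,\ 2\le|Q|\le2^k,\ 1\le l\le n\Big\}$$ (terms with an empty set of divisors are disregarded below). Assume: 1. either $-\sum_{k\ge1}2^{-k}\ln\omega_k(\mathbb N^n)<+\infty$; or $\mathcal I$ is properly embedded, i.e. has a set of monomial generators that does not involve all the variables, and $-\sum_{k\ge1}2^{-k}\ln\omega_k(\{Q : x^Q\notin\mathcal I\})<+\infty$; 2. the family is non-resonant on $\mathcal I$: for every $Q$ with $|Q|\ge2$ and $x^Q\notin\mathcal I$, and for all $1\le i\le m$, $1\le k\le n$, there is $j$ with $\bar\mu_{i,j}^Q\neq\mu_{i,j,k}^{-1}$; 3. the family $\{F_{i,j}\}$ is formally linearizable on $\hat{\mathcal I}$: there is a formal diffeomorphism $\hat\Phi$ of $(\mathbb C^n,0)$, tangent to the identity and such that the coefficient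 of $x^Q$ in $\hat\Phi_k$ vanishes whenever $|Q|\ge2$ and $\mu_{i,j}^Q=\mu_{i,j,k}$ for all $i,j$, such that all components of $\hat\Phi\circ F_{i,j}\circ\hat\Phi^{-1}-D_{i,j}x$ lie in $\hat{\mathcal I}$, for all $i,j$. Then there are a germ $\mathcal S$ at $0$ of complex analytic subset of $\mathbb C^n$, which contains the origin and thus meets each $M_k$ there, and a germ of holomorphic diffeomorphism $\Phi$ of $(\mathbb C^n,0)$ tangent to the identity such that, in the coordinates $w$ defined by $z=\Phi(w)$ and near the origin: - $\mathcal S$ is the zero locus $V(\mathcal I)$, and $V(\mathcal I)$ is a finite intersection of finite unions of coordinate hyperplanes, $V(\mathcal I)=\bigcap_i\bigcup_j\{w_{i_j}=0\}$; - for every $k$, $M_k\cap\mathcal S=\{w\in V(\mathcal I) : B_k\bar w=w\}$. -/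

import Mathlib

open Filter Topology Matrix

noncomputable section

/-! ### Germs of holomorphic functions and monomial ideals

`Fin n → ℂ` is `ℂⁿ`, `star z` is the complex conjugate vector `z̄`. Germs at the origin are handled
through representatives, up to equality on a neighbourhood of the origin. -/

/-- The ring `𝒪ₙ` of germs at the origin of holomorphic functions on `ℂⁿ`. -/
def HolGerm (n : ℕ) : Subring (Germ (𝓝 (0 : Fin n → ℂ)) ℂ) where
  carrier := {g | ∃ f : (Fin n → ℂ) → ℂ, AnalyticAt ℂ f 0 ∧ g = Germ.ofFun f}
  mul_mem' := by
    rintro _ _ ⟨f, hf, rfl⟩ ⟨g, hg, rfl⟩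
    exact ⟨f * g, hf.mul hg, rfl⟩
  one_mem' := ⟨1, analyticAt_const, rfl⟩
  add_mem' := by
    rintro _ _ ⟨f, hf, rfl⟩ ⟨g, hg, rfl⟩
    exact ⟨f + g, hf.add hg, rfl⟩
  zero_mem' := ⟨0, analyticAt_const, rfl⟩
  neg_mem' := by
    rintro _ ⟨f, hf, rfl⟩
    exact ⟨-f, hf.neg, rfl⟩

/-- The monomial `z^Q`. -/
def monom {n : ℕ} (Q : Fin n →₀ ℕ) (z : Fin n → ℂ) : ℂ := ∏ k, z k ^ Q k

theorem analyticAt_monom {n : ℕ} (Q : Fin n →₀ ℕ) : AnalyticAt ℂ (monom Q) 0 := by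
  unfold monom
  exact Finset.analyticAt_fun_prod _ fun k _ =>
    ((ContinuousLinearMap.proj (R := ℂ) (φ := fun _ : Fin n => ℂ) k).analyticAt 0).pow (Q k)

/-- The monomial `x^Q` as an element of `𝒪ₙ`. -/
def monomGerm {n : ℕ} (Q : Fin n →₀ ℕ) : HolGerm n :=
  ⟨Germ.ofFun (monom Q), monom Q, analyticAt_monom Q, rfl⟩

/-- The degree `|Q|` of a multi-index. -/
def multiDeg {n : ℕ} (Q : Fin n →₀ ℕ) : ℕ := ∑ k, Q k

/-- `I` is generated by monomials. -/
def IsMonomialIdeal {n : ℕ} (I : Ideal (HolGerm n)) : Prop :=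
  ∃ R : Set (Fin n →₀ ℕ), I = Ideal.span (monomGerm '' R)

/-- `I` is properly embedded: it has a set of monomial generators not involving all variables. -/
def IsProperlyEmbedded {n : ℕ} (I : Ideal (HolGerm n)) : Prop :=
  ∃ R : Set (Fin n →₀ ℕ), I = Ideal.span (monomGerm '' R) ∧ ∃ s : Fin n, ∀ Q ∈ R, Q s = 0

/-- The germ at the origin of the function `f` belongs to `I`. -/
def GermMem {n : ℕ} (I : Ideal (HolGerm n)) (f : (Fin n → ℂ) → ℂ) : Prop :=
  ∃ g ∈ I, (g : Germ (𝓝 (0 : Fin n → ℂ)) ℂ) = Germ.ofFun f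

/-- `I` is left invariant by the antilinear map `z ↦ B z̄`: for `f ∈ I`, the antiholomorphic germ
`f (B z̄)` lies in the conjugate ideal `Ī`, that is, its complex conjugate lies in `I`. -/
def InvariantUnderAntilinear {n : ℕ} (I : Ideal (HolGerm n)) (B : Matrix (Fin n) (Fin n) ℂ) :
    Prop :=
  ∀ f : (Fin n → ℂ) → ℂ, GermMem I f → GermMem I (fun z => star (f (B *ᵥ star z)))

/-- The zero locus `V(I)` of a monomial ideal `I`: the common zeros of the monomials in `I`. -/
def zeroLocus {n : ℕ} (I : Ideal (HolGerm n)) : Set (Fin n → ℂ) :=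
  {z | ∀ Q, monomGerm Q ∈ I → monom Q z = 0}

/-- The germ of `S` at the origin is a germ of complex analytic subset of `ℂⁿ`. -/
def IsComplexAnalyticGerm {n : ℕ} (S : Set (Fin n → ℂ)) : Prop :=
  ∃ (p : ℕ) (f : Fin p → (Fin n → ℂ) → ℂ), (∀ i, AnalyticAt ℂ (f i) 0) ∧
    ∀ᶠ z in 𝓝 (0 : Fin n → ℂ), z ∈ S ↔ ∀ i, f i z = 0

/-- `Φ` is (a representative of) a germ of holomorphic diffeomorphism of `(ℂⁿ, 0)` tangent to the
identity at the origin, i.e. a holomorphic change of coordinates `z = Φ w`. -/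
structure IsHolomorphicCoordinateChange {n : ℕ} (Φ : (Fin n → ℂ) → (Fin n → ℂ)) : Prop where
  analyticAt : AnalyticAt ℂ Φ 0
  map_zero : Φ 0 = 0
  fderiv_eq : fderiv ℂ Φ 0 = ContinuousLinearMap.id ℂ (Fin n → ℂ)

/-! ### Totally real submanifolds and antiholomorphic involutions -/

/-- Near the origin, `M` is a real analytic totally real `n`-dimensional submanifold of `ℂⁿ` through
the origin: it has a real analytic local parametrization `γ` which is an immersion, whose tangent
space `T` at the origin satisfies `T ∩ iT = 0`, and which maps the small neighbourhoods of `0` in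
`ℝⁿ` onto the small neighbourhoods of `0` in `M`. -/
def IsTotallyRealGerm {n : ℕ} (M : Set (Fin n → ℂ)) : Prop :=
  ∃ γ : (Fin n → ℝ) → (Fin n → ℂ), AnalyticAt ℝ γ 0 ∧ γ 0 = 0 ∧
    Function.Injective (fderiv ℝ γ 0) ∧
    (∀ u v, fderiv ℝ γ 0 u = Complex.I • fderiv ℝ γ 0 v → fderiv ℝ γ 0 u = 0) ∧
    Filter.map γ (𝓝 0) = 𝓝[M] 0

/-- `ρ` is (a representative of) a germ of antiholomorphic involution of `(ℂⁿ, 0)`. -/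
structure IsAntiholomorphicInvolution {n : ℕ} (ρ : (Fin n → ℂ) → (Fin n → ℂ)) : Prop where
  map_zero : ρ 0 = 0
  antiholomorphic : AnalyticAt ℂ (fun w => ρ (star w)) 0
  involutive : ∀ᶠ z in 𝓝 (0 : Fin n → ℂ), ρ (ρ z) = z

/-- The matrix `B` such that `ρ z = B z̄ + R z̄` with `R` holomorphic of order at least two. -/
def antilinearPart {n : ℕ} (ρ : (Fin n → ℂ) → (Fin n → ℂ)) : Matrix (Fin n) (Fin n) ℂ :=
  LinearMap.toMatrix' (fderiv ℂ (fun w => ρ (star w)) 0 : (Fin n → ℂ) →ₗ[ℂ] (Fin n → ℂ))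

/-- The linear part `D = B B̄'` at the origin of `ρ ∘ ρ'`. -/
def compLinearPart {n : ℕ} (ρ ρ' : (Fin n → ℂ) → (Fin n → ℂ)) : Matrix (Fin n) (Fin n) ℂ :=
  antilinearPart ρ * (antilinearPart ρ').map star

/-- The group generated by the germs `F i j = ρ i ∘ ρ j` is abelian, i.e. its generators commute. -/
def IsCommutativeFamily {n m : ℕ} (ρ : Fin m → (Fin n → ℂ) → (Fin n → ℂ)) : Prop :=
  ∀ i j k l, ((ρ i ∘ ρ j) ∘ (ρ k ∘ ρ l)) =ᶠ[𝓝 0] ((ρ k ∘ ρ l) ∘ (ρ i ∘ ρ j))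

/-- The diagonal entries `μ i j k` of `D i j`. -/
def mu {n m : ℕ} (ρ : Fin m → (Fin n → ℂ) → (Fin n → ℂ)) (i j : Fin m) : Fin n → ℂ :=
  fun k => compLinearPart (ρ i) (ρ j) k k

/-! ### Small divisors and resonances -/

/-- `ω_k`: the infimum of the nonzero numbers `max_p |μ_p^Q - μ_{p,j}|` over `1 ≤ j ≤ n` and the
multi-indices `Q ∈ A` with `2 ≤ |Q| ≤ 2^k`. (If there are no such numbers, the value is `0`, and
its logarithm is `0` in Lean.) -/
def smallDivisor {n : ℕ} {ι : Type} (μ : ι → Fin n → ℂ) (A : Set (Fin n →₀ ℕ)) (k : ℕ) : ℝ :=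
  sInf {t | t ≠ 0 ∧ ∃ Q ∈ A, ∃ j : Fin n, 2 ≤ multiDeg Q ∧ multiDeg Q ≤ 2 ^ k ∧
    t = ⨆ p : ι, ‖monom Q (μ p) - μ p j‖}

/-- `-∑_{k ≥ 1} ln ω_k / 2^k < +∞`. The sequence `ω_k` is nonincreasing once its defining set is
nonempty, so that this means convergence of the series. -/
def IsDiophantineOn {n : ℕ} {ι : Type} (μ : ι → Fin n → ℂ) (A : Set (Fin n →₀ ℕ)) : Prop :=
  Summable fun k : ℕ => Real.log (smallDivisor μ A (k + 1)) / 2 ^ (k + 1)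

/-- The family of manifolds is non-resonant on `I`. -/
def IsNonResonantOn {n m : ℕ} (ρ : Fin m → (Fin n → ℂ) → (Fin n → ℂ)) (I : Ideal (HolGerm n)) :
    Prop :=
  ∀ Q : Fin n →₀ ℕ, 2 ≤ multiDeg Q → monomGerm Q ∉ I → ∀ (i : Fin m) (k : Fin n),
    ∃ j : Fin m, monom Q (star (mu ρ i j)) ≠ (mu ρ i j k)⁻¹

/-! ### Formal linearization -/

/-- `p` is the Taylor series of `f` at the origin, and it converges to `f` near the origin. -/
def HasTaylorSeries {n : ℕ} (f : (Fin n → ℂ) → ℂ) (p : MvPowerSeries (Fin n) ℂ) : Prop :=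
  ∀ᶠ z in 𝓝 (0 : Fin n → ℂ), HasSum (fun Q => MvPowerSeries.coeff Q p * monom Q z) (f z)

/-- The ideal `Î` of the ring of formal power series generated by a monomial ideal `I`. -/
def formalIdeal {n : ℕ} (I : Ideal (HolGerm n)) : Ideal (MvPowerSeries (Fin n) ℂ) :=
  Ideal.span {p | ∃ Q, monomGerm Q ∈ I ∧ p = MvPowerSeries.monomial Q 1}

/-- The family of germs `F p`, with diagonal linear parts `diag (μ p)`, is formally linearizable on
`Î`: there is a formal diffeomorphism `Φ`, with formal inverse `Ψ`, tangent to the identity and with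
zero projection on the non-linear centralizer of the family of linear parts (the vector fields
`x^Q e_k` with `|Q| ≥ 2` and `μ_p^Q = μ_{p,k}` for all `p`), such that each component of
`Φ ∘ F p ∘ Ψ - diag (μ p) x` is in `Î`. -/
def IsFormallyLinearizableOn {n : ℕ} {ι : Type} (F : ι → (Fin n → ℂ) → (Fin n → ℂ))
    (μ : ι → Fin n → ℂ) (I : Ideal (HolGerm n)) : Prop :=
  ∃ Φ Ψ : Fin n → MvPowerSeries (Fin n) ℂ,
    (∀ k, MvPowerSeries.constantCoeff (Φ k) = 0) ∧
    (∀ k, MvPowerSeries.constantCoeff (Ψ k) = 0) ∧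
    (∀ k, MvPowerSeries.subst Ψ (Φ k) = MvPowerSeries.X k) ∧
    (∀ k, MvPowerSeries.subst Φ (Ψ k) = MvPowerSeries.X k) ∧
    (∀ k l, MvPowerSeries.coeff (Finsupp.single l 1) (Φ k) = if l = k then 1 else 0) ∧
    (∀ Q k, 2 ≤ multiDeg Q → (∀ p, monom Q (μ p) = μ p k) → MvPowerSeries.coeff Q (Φ k) = 0) ∧
    ∀ p, ∃ T : Fin n → MvPowerSeries (Fin n) ℂ, (∀ k, HasTaylorSeries (fun z => F p z k) (T k)) ∧
      ∀ k, MvPowerSeries.subst Ψ (MvPowerSeries.subst T (Φ k)) -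
        MvPowerSeries.monomial (Finsupp.single k 1) (μ p k) ∈ formalIdeal I

end

/-!
The theorem follows from a convergent linearization, modulo the ideal `I`, of all the compositions
`F i j = ρ i ∘ ρ j`, in coordinates in which the involutions `ρ i` themselves turn out to be
antilinear modulo `I`.

*Formal side.* As `I` is generated by monomials, the multi-indices of the monomials outside `I` form
a lower set `outside I`, and a formal series lies in the completion of `I` as soon as its
coefficients on this set vanish (`vanishIdeal`). Truncating a formal linearization to `outside I`
gives a formal map `a`, tangent to the identity, with `F p ∘ a = a ∘ D p` modulo the ideal
(`exists_normalized_conjugacy`). Its coefficients solve the homological equations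
`(μ_p^Q - μ_{p,k}) a_{k,Q} = (terms of lower degree)` for every `p` and every `Q` in `outside I`
(`coeff_conjugacy`). Non-resonance is stated for the conjugates `μ̄^Q`; since `B_i` intertwines
`conj (D i j)` and `D j i`, and `I` is invariant under `z ↦ B_i z̄`, it excludes the resonances
`μ_p^Q = μ_{p,k}` for all `p` on `outside I` (`exists_monom_mu_ne`). So for each `Q` and `k` some
`p` gives a nonzero divisor, and `divisor` is the largest one.

*Convergence.* The argument is Brjuno's. The product of the small divisors met when the homological
equations are unfolded runs over the nodes of a tree, and small nodes are rare
(`IsTreeNodes.countP_small`), because two comparable indices `Q' < Q` with small divisors differ by a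
large degree: otherwise `x^P x_s`, with `P = Q - Q'` and `x_s` a variable dividing `x^{Q'}`, would
have a small divisor in small degree (`multiDeg_add_le_of_divisor_lt`). This index again belongs to
`outside I`, a lower set, which is why the Diophantine condition is only needed there. Hence the
divisors are absorbed by weights of exponential growth (`exists_weight`), and the majorant method
applies to the weighted coefficients (`summable_of_recursive_bound`,
`majNorm_ne_top_of_homological`).

*Involutions.* From `ρ i ∘ F i j = ρ j = F j i ∘ ρ i`, the germs `ρ i ∘ Φ` and `Φ ∘ (B_i z̄)` both
conjugate `F j i` to the conjugate of `D i j`, modulo `I` and up to a complex conjugation of the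
variable. They have the same linear part, and non-resonance forbids a term of lowest degree in their
difference (`sub_mem_of_conjugacy`, `subst_sub_subst_linear_mem`). Therefore
`ρ i (Φ w) = Φ (B_i w̄)` for `w` in the zero locus of `I`, and as `Φ` is injective near the origin,
`Φ w` is fixed by `ρ i` if and only if `B_i w̄ = w`. The analytic set is, near the origin, the
image under `Φ` of the zero locus.
-/

noncomputable section

/-! ### Multi-indices -/

theorem multiDeg_add {n : ℕ} (P Q : Fin n →₀ ℕ) : multiDeg (P + Q) = multiDeg P + multiDeg Q := by
  simp [multiDeg, Finset.sum_add_distrib]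

theorem multiDeg_single {n : ℕ} (l : Fin n) (a : ℕ) : multiDeg (Finsupp.single l a) = a := by
  simp [multiDeg, Finsupp.single_apply]

@[simp] theorem multiDeg_zero {n : ℕ} : multiDeg (0 : Fin n →₀ ℕ) = 0 := by
  simp [multiDeg]

theorem multiDeg_eq_zero {n : ℕ} {Q : Fin n →₀ ℕ} : multiDeg Q = 0 ↔ Q = 0 := by
  simp [multiDeg, Finsupp.ext_iff]

theorem multiDeg_pos {n : ℕ} {Q : Fin n →₀ ℕ} (hQ : Q ≠ 0) : 0 < multiDeg Q :=
  Nat.pos_of_ne_zero fun h => hQ (multiDeg_eq_zero.1 h)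

theorem multiDeg_mono {n : ℕ} {P Q : Fin n →₀ ℕ} (h : P ≤ Q) : multiDeg P ≤ multiDeg Q :=
  Finset.sum_le_sum fun k _ => h k

theorem exists_single_le {n : ℕ} {Q : Fin n →₀ ℕ} (hQ : Q ≠ 0) :
    ∃ l, Finsupp.single l 1 ≤ Q := by
  obtain ⟨l, hl⟩ := Finsupp.ne_iff.1 hQ
  exact ⟨l, by simpa [Finsupp.single_le_iff, Nat.one_le_iff_ne_zero] using hl⟩

/-! ### Counting small divisors along a tree -/

/-- `IsTreeNodes Q s`: there is a binary tree whose leaves are coordinates `l`, with index the unit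
vector `e_l`, whose inner nodes carry the sum of the indices of their two children, whose root has
index `Q`, and `s` is the multiset of the indices of its inner nodes. -/
inductive IsTreeNodes {n : ℕ} : (Fin n →₀ ℕ) → Multiset (Fin n →₀ ℕ) → Prop
  | leaf (l : Fin n) : IsTreeNodes (Finsupp.single l 1) 0
  | node {Q₁ Q₂ : Fin n →₀ ℕ} {s₁ s₂ : Multiset (Fin n →₀ ℕ)} :
      IsTreeNodes Q₁ s₁ → IsTreeNodes Q₂ s₂ → IsTreeNodes (Q₁ + Q₂) ((Q₁ + Q₂) ::ₘ (s₁ + s₂))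

namespace IsTreeNodes

variable {n : ℕ} {Q : Fin n →₀ ℕ} {s : Multiset (Fin n →₀ ℕ)}

theorem ne_zero (h : IsTreeNodes Q s) : Q ≠ 0 := by
  induction h with
  | leaf l => simp
  | node _ _ h₁ _ => exact fun h => h₁ (add_eq_zero.1 h).1

theorem card_le (h : IsTreeNodes Q s) : s.card + 1 ≤ multiDeg Q := by
  induction h with
  | leaf l => simp [multiDeg_single]
  | node _ _ h₁ h₂ => simp only [multiDeg_add, Multiset.card_cons, Multiset.card_add]; omega

theorem le_of_mem (h : IsTreeNodes Q s) {P : Fin n →₀ ℕ} (hP : P ∈ s) : P ≤ Q := by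
  induction h with
  | leaf l => simp at hP
  | node _ _ h₁ h₂ =>
    rcases Multiset.mem_cons.1 hP with rfl | hP
    · exact le_rfl
    · rcases Multiset.mem_add.1 hP with hP | hP
      · exact (h₁ hP).trans le_self_add
      · exact (h₂ hP).trans le_add_self

theorem exists_of_ne_zero (hQ : Q ≠ 0) : ∃ s, IsTreeNodes Q s := by
  induction hd : multiDeg Q generalizing Q with
  | zero => exact absurd (multiDeg_eq_zero.1 hd) hQ
  | succ d ih =>
    obtain ⟨l, hl⟩ := exists_single_le hQ
    obtain ⟨P, rfl⟩ := exists_add_of_le hl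
    by_cases hP : P = 0
    · exact ⟨0, by simpa [hP] using leaf l⟩
    · obtain ⟨s, hs⟩ := ih hP (by rw [multiDeg_add, multiDeg_single] at hd; omega)
      exact ⟨_, node (leaf l) hs⟩

/-- Brjuno's counting lemma. If two comparable small indices differ by at least `m` in degree, then
the number `c` of small nodes of a tree with root `Q` is zero or satisfies `(c + 1) m ≤ 2 |Q|`. -/
theorem countP_small (m : ℕ) (small : (Fin n →₀ ℕ) → Prop) [DecidablePred small]
    (hdeg : ∀ Q, small Q → m ≤ multiDeg Q)
    (hsep : ∀ Q Q', small Q → small Q' → Q' < Q → multiDeg Q' + m ≤ multiDeg Q)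
    (h : IsTreeNodes Q s) :
    s.countP small = 0 ∨ (s.countP small + 1) * m ≤ 2 * multiDeg Q := by
  -- The second half treats a tree below a small node `R`: the separation makes its root either not
  -- small, or of degree at most `|R| - m`.
  suffices H : (s.countP small = 0 ∨ (s.countP small + 1) * m ≤ 2 * multiDeg Q) ∧
      ∀ R, small R → Q < R →
        s.countP small = 0 ∨ (s.countP small + 2) * m ≤ 2 * multiDeg R from H.1
  induction h with
  | leaf l => simp
  | @node Q₁ Q₂ s₁ s₂ t₁ t₂ ih₁ ih₂ =>
    obtain ⟨h₁, k₁⟩ := ih₁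
    obtain ⟨h₂, k₂⟩ := ih₂
    have l₁ : Q₁ < Q₁ + Q₂ := lt_add_of_pos_right _ (pos_iff_ne_zero.2 t₂.ne_zero)
    have l₂ : Q₂ < Q₁ + Q₂ := lt_add_of_pos_left _ (pos_iff_ne_zero.2 t₁.ne_zero)
    by_cases hs : small (Q₁ + Q₂)
    · rw [Multiset.countP_cons_of_pos _ hs, Multiset.countP_add]
      have hd := hdeg _ hs
      have main : (s₁.countP small + s₂.countP small + 1 + 1) * m ≤ 2 * multiDeg (Q₁ + Q₂) := by
        have hk₁ := k₁ _ hs l₁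
        have hk₂ := k₂ _ hs l₂
        rw [multiDeg_add] at *
        rcases h₁ with h₁ | h₁
        · rw [h₁]
          rcases hk₂ with hk₂ | hk₂
          · rw [hk₂]; linarith
          · linarith
        · rcases h₂ with h₂ | h₂
          · rw [h₂]
            rcases hk₁ with hk₁ | hk₁
            · rw [hk₁]; linarith
            · linarith
          · linarith
      refine ⟨Or.inr main, fun R hR hlt => Or.inr ?_⟩
      have := hsep R _ hR hs hlt
      linarith
    · rw [Multiset.countP_cons_of_neg _ hs, Multiset.countP_add]
      have hm : ∀ R, Q₁ + Q₂ ≤ R → (s₁.countP small = 0 ∧ s₂.countP small = 0) ∨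
          s₁.countP small = 0 ∨ s₂.countP small = 0 ∨
          (s₁.countP small + s₂.countP small + 2) * m ≤ 2 * multiDeg R := by
        intro R hR
        have := multiDeg_mono hR
        rw [multiDeg_add] at this
        rcases h₁ with h₁ | h₁
        · exact Or.inr (Or.inl h₁)
        rcases h₂ with h₂ | h₂
        · exact Or.inr (Or.inr (Or.inl h₂))
        · refine Or.inr (Or.inr (Or.inr ?_)); linarith
      constructor
      · rcases hm _ le_rfl with ⟨h, h'⟩ | h | h | h
        · left; omega
        · rw [h, zero_add, multiDeg_add]
          exact h₂.imp_right fun h => by linarith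
        · rw [h, add_zero, multiDeg_add]
          exact h₁.imp_right fun h => by linarith
        · right; linarith
      · intro R hR hlt
        rcases hm R hlt.le with ⟨h, h'⟩ | h | h | h
        · left; omega
        · rw [h, zero_add]; exact k₂ R hR (l₂.trans hlt)
        · rw [h, add_zero]; exact k₁ R hR (l₁.trans hlt)
        · exact Or.inr h

end IsTreeNodes

theorem Multiset.sum_map_const_add_indicator {α β : Type*} (s : Multiset α) (I : Finset β)
    (p : β → α → Prop) [∀ i, DecidablePred (p i)] (w : β → ℝ) (c : ℝ) :
    (s.map fun x => c + ∑ i ∈ I, if p i x then w i else 0).sum =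
      s.card * c + ∑ i ∈ I, (s.countP (p i)) * w i := by
  induction s using Multiset.induction with
  | empty => simp
  | cons a s ih =>
    simp only [Multiset.map_cons, Multiset.sum_cons, ih, Multiset.card_cons, Multiset.countP_cons]
    push_cast
    have : ∀ i, ((s.countP (p i) : ℝ) + (if p i a then (1 : ℝ) else 0)) * w i =
        s.countP (p i) * w i + if p i a then w i else 0 := fun i => by
      split_ifs <;> ring
    simp only [this, Finset.sum_add_distrib]
    ring

/-- The total logarithmic cost of a tree grows at most linearly in the degree of its root, if the
small divisors `D Q j` (for `Q ∈ E`) below the thresholds `θ exp (-ℓ k)` are rare in the sense of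
Brjuno's counting lemma and `∑ ℓ k / 2 ^ k` converges. -/
theorem exists_tree_cost_bound {n : ℕ} (E : Set (Fin n →₀ ℕ)) (D : (Fin n →₀ ℕ) → Fin n → ℝ)
    (ℓ : ℕ → ℝ) (hℓ : ∀ k, 0 ≤ ℓ k) (hsum : Summable fun k => ℓ k / 2 ^ k)
    (θ : ℝ) (hθ : 0 < θ) (hθ1 : θ ≤ 1)
    (hdeg : ∀ k j, ∀ Q ∈ E, 2 ≤ multiDeg Q → D Q j < θ * Real.exp (-ℓ k) →
      2 ^ (k + 1) ≤ multiDeg Q)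
    (hsep : ∀ k j, ∀ Q ∈ E, ∀ Q' ∈ E, 2 ≤ multiDeg Q' → D Q j < θ * Real.exp (-ℓ k) →
      D Q' j < θ * Real.exp (-ℓ k) → Q' < Q → multiDeg Q' + 2 ^ (k + 1) ≤ multiDeg Q)
    (L : (Fin n →₀ ℕ) → ℝ)
    (hL : ∀ Q, L Q = 0 ∨ Q ∈ E ∧ 2 ≤ multiDeg Q ∧ ∃ j, D Q j = Real.exp (-L Q)) :
    ∃ κ, 0 ≤ κ ∧ ∀ Q s, IsTreeNodes Q s → (s.map L).sum ≤ κ * multiDeg Q := by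
  classical
  set lam : ℝ := -Real.log θ with hlam
  have hlam0 : 0 ≤ lam := by
    rw [hlam]; linarith [Real.log_nonpos hθ.le hθ1]
  have hθe : θ = Real.exp (-lam) := by rw [hlam, neg_neg, Real.exp_log hθ]
  set small : ℕ × Fin n → (Fin n →₀ ℕ) → Prop := fun i Q =>
    Q ∈ E ∧ 2 ≤ multiDeg Q ∧ D Q i.2 < θ * Real.exp (-ℓ i.1) with hsmall
  have hw : Summable fun k => (lam + ℓ (k + 1)) / 2 ^ (k + 1) := by
    have h1 : Summable fun k : ℕ => lam * (1 / 2 : ℝ) ^ (k + 1) :=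
      ((summable_nat_add_iff 1).2 summable_geometric_two).mul_left lam
    have h2 := (summable_nat_add_iff 1).2 hsum
    refine (h1.add h2).congr fun k => ?_
    simp only [one_div, inv_pow, add_div]
    rw [div_eq_mul_inv lam]
  have hw0 : ∀ k, 0 ≤ lam + ℓ (k + 1) := fun k => add_nonneg hlam0 (hℓ _)
  set S := ∑' k, (lam + ℓ (k + 1)) / 2 ^ (k + 1) with hS
  have hS0 : 0 ≤ S := tsum_nonneg fun k => div_nonneg (hw0 k) (by positivity)
  refine ⟨(lam + ℓ 0) + 2 * n * S, by have := hℓ 0; positivity, fun Q s hs => ?_⟩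
  set N := multiDeg Q with hN
  set I : Finset (ℕ × Fin n) := Finset.range N ×ˢ Finset.univ with hI
  -- A divisor lies above the threshold of large index; compare it with the first such threshold.
  have hpt : ∀ P ∈ s, L P ≤ (lam + ℓ 0) + ∑ i ∈ I, if small i P then lam + ℓ (i.1 + 1) else 0 := by
    intro P hP
    have hnn : ∀ i ∈ I, (0 : ℝ) ≤ if small i P then lam + ℓ (i.1 + 1) else 0 := fun i _ => by
      split_ifs
      · exact hw0 _
      · exact le_rfl
    rcases hL P with h0 | ⟨hPE, hP2, j, hj⟩
    · rw [h0]
      exact add_nonneg (add_nonneg hlam0 (hℓ 0)) (Finset.sum_nonneg hnn)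
    · have hex : ∃ k, ¬ D P j < θ * Real.exp (-ℓ k) := by
        refine ⟨N, fun hlt => ?_⟩
        have h1 := hdeg N j P hPE hP2 hlt
        have h2 := multiDeg_mono (hs.le_of_mem hP)
        have h3 : N < 2 ^ (N + 1) := (Nat.lt_succ_self N).trans Nat.lt_two_pow_self
        omega
      have key : ∀ k, ¬ D P j < θ * Real.exp (-ℓ k) → L P ≤ lam + ℓ k := by
        intro k hk
        rw [not_lt, hj, hθe, ← Real.exp_add, Real.exp_le_exp] at hk
        linarith
      rcases hk0 : Nat.find hex with _ | k
      · have := key 0 (hk0 ▸ Nat.find_spec hex)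
        have := Finset.sum_nonneg hnn
        linarith
      · have h1 := key (k + 1) (hk0 ▸ Nat.find_spec hex)
        have h2 : D P j < θ * Real.exp (-ℓ k) :=
          not_not.1 (Nat.find_min hex (hk0 ▸ Nat.lt_succ_self k))
        have h3 : small (k, j) P := ⟨hPE, hP2, h2⟩
        have h4 : (k, j) ∈ I := by
          have h1 := hdeg k j P hPE hP2 h2
          have h2 := multiDeg_mono (hs.le_of_mem hP)
          have h3 : k < 2 ^ (k + 1) := (Nat.lt_succ_self k).trans Nat.lt_two_pow_self
          simp only [hI, Finset.mem_product, Finset.mem_range, Finset.mem_univ, and_true]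
          omega
        have h5 := Finset.single_le_sum hnn h4
        simp only [if_pos h3] at h5
        linarith [hℓ 0]
  have hcount : ∀ i ∈ I, (s.countP (small i) : ℝ) * (lam + ℓ (i.1 + 1)) ≤
      2 * N * ((lam + ℓ (i.1 + 1)) / 2 ^ (i.1 + 1)) := by
    intro i _
    have h := hs.countP_small (2 ^ (i.1 + 1)) (small i)
      (fun Q hQ => hdeg i.1 i.2 Q hQ.1 hQ.2.1 hQ.2.2)
      (fun Q Q' hQ hQ' hlt => hsep i.1 i.2 Q hQ.1 Q' hQ'.1 hQ'.2.1 hQ.2.2 hQ'.2.2 hlt)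
    have h' : (s.countP (small i)) * 2 ^ (i.1 + 1) ≤ 2 * N := by
      rcases h with h | h
      · simp [h]
      · exact le_trans (Nat.mul_le_mul_right _ (Nat.le_succ _)) h
    have h'' : (s.countP (small i) : ℝ) * 2 ^ (i.1 + 1) ≤ 2 * N := by exact_mod_cast h'
    have h3 : (s.countP (small i) : ℝ) ≤ 2 * N / 2 ^ (i.1 + 1) := by
      rw [le_div_iff₀ (by positivity)]; exact h''
    calc _ ≤ 2 * N / 2 ^ (i.1 + 1) * (lam + ℓ (i.1 + 1)) :=
          mul_le_mul_of_nonneg_right h3 (hw0 _)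
      _ = _ := by ring
  calc (s.map L).sum
      ≤ (s.map fun P => (lam + ℓ 0) +
          ∑ i ∈ I, if small i P then lam + ℓ (i.1 + 1) else 0).sum :=
        Multiset.sum_map_le_sum_map _ _ hpt
    _ = s.card * (lam + ℓ 0) + ∑ i ∈ I, s.countP (small i) * (lam + ℓ (i.1 + 1)) :=
        Multiset.sum_map_const_add_indicator s I small (fun i => lam + ℓ (i.1 + 1)) _
    _ ≤ N * (lam + ℓ 0) + ∑ i ∈ I, 2 * N * ((lam + ℓ (i.1 + 1)) / 2 ^ (i.1 + 1)) := by
        refine add_le_add (mul_le_mul_of_nonneg_right ?_ (add_nonneg hlam0 (hℓ 0)))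
          (Finset.sum_le_sum hcount)
        have := hs.card_le
        exact_mod_cast (by omega : s.card ≤ N)
    _ ≤ N * (lam + ℓ 0) + 2 * N * (n * S) := by
        refine add_le_add le_rfl ?_
        rw [← Finset.mul_sum]
        refine mul_le_mul_of_nonneg_left ?_ (by positivity)
        rw [hI, Finset.sum_product]
        simp only [Finset.sum_const, Finset.card_univ, Fintype.card_fin, nsmul_eq_mul]
        rw [← Finset.mul_sum]
        refine mul_le_mul_of_nonneg_left ?_ (by positivity)
        exact hw.sum_le_tsum _ fun k _ => div_nonneg (hw0 k) (by positivity)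
    _ = _ := by rw [hN]; ring

/-- Weights `W`, of exponential growth, absorbing the divisors `exp (-L Q)`: the supremum over trees
of the product of the reciprocal divisors of the nodes. -/
theorem exists_superadditive_weight {n : ℕ} (L : (Fin n →₀ ℕ) → ℝ) (κ : ℝ)
    (hκ : ∀ Q s, IsTreeNodes Q s → (s.map L).sum ≤ κ * multiDeg Q) :
    ∃ W : (Fin n →₀ ℕ) → ℝ, (∀ Q, 0 < W Q) ∧ (∀ l, 1 ≤ W (Finsupp.single l 1)) ∧
      (∀ Q₁ Q₂, Q₁ ≠ 0 → Q₂ ≠ 0 → W Q₁ * W Q₂ ≤ Real.exp (-L (Q₁ + Q₂)) * W (Q₁ + Q₂)) ∧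
      ∀ Q, W Q ≤ Real.exp κ ^ multiDeg Q := by
  set T : (Fin n →₀ ℕ) → Set ℝ := fun Q => {x | ∃ s, IsTreeNodes Q s ∧ x = (s.map L).sum} with hT
  have hbdd : ∀ Q, BddAbove (T Q) := fun Q => ⟨κ * multiDeg Q, by
    rintro _ ⟨s, hs, rfl⟩; exact hκ Q s hs⟩
  have hne : ∀ Q, Q ≠ 0 → (T Q).Nonempty := fun Q hQ => by
    obtain ⟨s, hs⟩ := IsTreeNodes.exists_of_ne_zero hQ
    exact ⟨_, s, hs, rfl⟩
  refine ⟨fun Q => Real.exp (sSup (T Q)), fun Q => Real.exp_pos _, fun l => ?_, ?_, fun Q => ?_⟩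
  · rw [← Real.exp_zero, Real.exp_le_exp]
    exact le_csSup (hbdd _) ⟨0, .leaf l, by simp⟩
  · intro Q₁ Q₂ h₁ h₂
    rw [← Real.exp_add, ← Real.exp_add, Real.exp_le_exp]
    have h : sSup (T Q₁) ≤ -L (Q₁ + Q₂) + sSup (T (Q₁ + Q₂)) - sSup (T Q₂) := by
      refine csSup_le (hne _ h₁) ?_
      rintro _ ⟨s₁, hs₁, rfl⟩
      have h' : sSup (T Q₂) ≤ -L (Q₁ + Q₂) + sSup (T (Q₁ + Q₂)) - (s₁.map L).sum := by
        refine csSup_le (hne _ h₂) ?_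
        rintro _ ⟨s₂, hs₂, rfl⟩
        have := le_csSup (hbdd (Q₁ + Q₂)) ⟨_, hs₁.node hs₂, rfl⟩
        simp only [Multiset.map_cons, Multiset.map_add, Multiset.sum_cons, Multiset.sum_add] at this
        linarith
      linarith
    linarith
  · rw [← Real.exp_nat_mul, Real.exp_le_exp]
    by_cases hQ : Q = 0
    · have : T Q = ∅ := by
        ext x
        simp only [hT, Set.mem_ofPred_eq, Set.mem_empty_iff_false, iff_false]
        rintro ⟨s, hs, -⟩
        exact hs.ne_zero hQ
      rw [this, hQ]
      simp
    · refine csSup_le (hne _ hQ) ?_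
      rintro _ ⟨s, hs, rfl⟩
      rw [mul_comm]
      exact hκ Q s hs

/-! ### Small divisors -/

theorem finite_multiDeg_le {n : ℕ} (N : ℕ) : {Q : Fin n →₀ ℕ | multiDeg Q ≤ N}.Finite := by
  refine (Set.finite_Iic (Finsupp.equivFunOnFinite.symm fun _ : Fin n => N)).subset ?_
  intro Q hQ k
  exact (Finset.single_le_sum (fun i _ => Nat.zero_le (Q i)) (Finset.mem_univ k)).trans hQ

theorem monom_add {n : ℕ} (P Q : Fin n →₀ ℕ) (z : Fin n → ℂ) :
    monom (P + Q) z = monom P z * monom Q z := by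
  simp [monom, pow_add, Finset.prod_mul_distrib]

theorem monom_single {n : ℕ} (l : Fin n) (z : Fin n → ℂ) :
    monom (Finsupp.single l 1) z = z l := by
  rw [monom, Finset.prod_eq_single l]
  · simp
  · intro k _ hk
    simp [hk.symm]
  · simp

/-- The divisor `max_p |μ_p^Q - μ_{p,j}|` of the vector field `x^Q e_j`. -/
def divisor {n : ℕ} {ι : Type} (μ : ι → Fin n → ℂ) (Q : Fin n →₀ ℕ) (j : Fin n) : ℝ :=
  ⨆ p : ι, ‖monom Q (μ p) - μ p j‖

section Divisor

variable {n : ℕ} {ι : Type} {μ : ι → Fin n → ℂ}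

theorem divisor_nonneg (Q : Fin n →₀ ℕ) (j : Fin n) : 0 ≤ divisor μ Q j :=
  Real.iSup_nonneg fun _ => norm_nonneg _

theorem le_divisor [Finite ι] (Q : Fin n →₀ ℕ) (j : Fin n) (p : ι) :
    ‖monom Q (μ p) - μ p j‖ ≤ divisor μ Q j :=
  le_ciSup (f := fun p => ‖monom Q (μ p) - μ p j‖) (Set.finite_range _).bddAbove p

theorem exists_divisor_eq [Finite ι] {Q : Fin n →₀ ℕ} {j : Fin n} (h : 0 < divisor μ Q j) :
    ∃ p : ι, divisor μ Q j = ‖monom Q (μ p) - μ p j‖ := by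
  rcases isEmpty_or_nonempty ι with hι | hι
  · simp [divisor, Real.iSup_of_isEmpty] at h
  · obtain ⟨p, hp⟩ := exists_eq_ciSup_of_finite (f := fun p => ‖monom Q (μ p) - μ p j‖)
    exact ⟨p, hp.symm⟩

/-- Exponential form of the Diophantine condition. -/
theorem IsDiophantineOn.exists_exp_le {A : Set (Fin n →₀ ℕ)} (h : IsDiophantineOn μ A) :
    ∃ ℓ : ℕ → ℝ, (∀ k, 0 ≤ ℓ k) ∧ (Summable fun k => ℓ k / 2 ^ k) ∧
      ∀ k, ∀ Q ∈ A, 2 ≤ multiDeg Q → multiDeg Q ≤ 2 ^ (k + 1) → ∀ j, divisor μ Q j ≠ 0 →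
        Real.exp (-ℓ k) ≤ divisor μ Q j := by
  refine ⟨fun k => max 0 (-Real.log (smallDivisor μ A (k + 1))), fun k => le_max_left _ _, ?_, ?_⟩
  · refine Summable.of_nonneg_of_le (fun k => div_nonneg (le_max_left _ _) (by positivity))
      (fun k => ?_) (h.abs.mul_left 2)
    have : |Real.log (smallDivisor μ A (k + 1)) / 2 ^ (k + 1)| =
        |Real.log (smallDivisor μ A (k + 1))| / 2 ^ (k + 1) := by
      rw [abs_div, abs_of_pos (by positivity : (0 : ℝ) < 2 ^ (k + 1))]
    rw [this, pow_succ]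
    have h2 : 2 * (|Real.log (smallDivisor μ A (k + 1))| / (2 ^ k * 2)) =
        |Real.log (smallDivisor μ A (k + 1))| / 2 ^ k := by
      field_simp
    rw [h2]
    gcongr
    exact max_le (abs_nonneg _) (neg_le_abs _)
  · intro k Q hQ h2 hk j hne
    set T : Set ℝ := {t | t ≠ 0 ∧ ∃ Q ∈ A, ∃ j : Fin n, 2 ≤ multiDeg Q ∧
      multiDeg Q ≤ 2 ^ (k + 1) ∧ t = ⨆ p : ι, ‖monom Q (μ p) - μ p j‖} with hT
    have hmem : divisor μ Q j ∈ T := ⟨hne, Q, hQ, j, h2, hk, rfl⟩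
    have hfin : T.Finite := by
      refine (((finite_multiDeg_le (n := n) (2 ^ (k + 1))).prod
        (Set.finite_univ (α := Fin n))).image fun x => divisor μ x.1 x.2).subset ?_
      rintro _ ⟨-, Q, -, j, -, hQ, rfl⟩
      exact ⟨(Q, j), ⟨hQ, Set.mem_univ _⟩, rfl⟩
    have hpos : 0 < sInf T := by
      obtain ⟨h0, Q, -, j, -, -, hj⟩ := Set.Nonempty.csInf_mem ⟨_, hmem⟩ hfin
      exact lt_of_le_of_ne (hj ▸ divisor_nonneg Q j) (Ne.symm h0)
    calc _ ≤ Real.exp (Real.log (sInf T)) := by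
          rw [Real.exp_le_exp]
          have := le_max_right 0 (-Real.log (smallDivisor μ A (k + 1)))
          change -max 0 (-Real.log (smallDivisor μ A (k + 1))) ≤
            Real.log (smallDivisor μ A (k + 1))
          linarith
      _ = sInf T := Real.exp_log hpos
      _ ≤ _ := csInf_le hfin.bddBelow hmem

/-- Two comparable indices whose divisors, for the same component `j`, are both small, differ by a
large degree: for `Q = Q' + P` and a coordinate `s` of `Q'`, the divisor of `x^P x_s e_s` is small
as well. As `x^P x_s` divides `x^Q`, its index belongs to `E` if `Q` does. -/
theorem multiDeg_add_le_of_divisor_lt [Finite ι] {E : Set (Fin n →₀ ℕ)} (hE : IsLowerSet E)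
    {θ e : ℝ} (he0 : 0 < e) (he1 : e ≤ 1) (hθ2 : ∀ p j, 2 * θ ≤ ‖μ p j‖)
    (hθ : ∀ p s j, 4 * θ * ‖μ p s‖ ≤ ‖μ p j‖) (hμ : ∀ p j, μ p j ≠ 0) (hθ0 : 0 < θ)
    {N : ℕ} (hN : ∀ Q ∈ E, 2 ≤ multiDeg Q → multiDeg Q ≤ N → ∀ j, e ≤ divisor μ Q j)
    {j : Fin n} {Q Q' : Fin n →₀ ℕ} (hQ : Q ∈ E) (hQ' : 2 ≤ multiDeg Q')
    (hd : divisor μ Q j < θ * e) (hd' : divisor μ Q' j < θ * e) (hlt : Q' < Q) :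
    multiDeg Q' + N ≤ multiDeg Q := by
  obtain ⟨P, rfl⟩ := exists_add_of_le hlt.le
  have hP : P ≠ 0 := by rintro rfl; simp at hlt
  obtain ⟨s, hs⟩ := exists_single_le (Q := Q') (by rintro rfl; simp at hQ')
  have hPs : P + Finsupp.single s 1 ∈ E :=
    hE (by rw [add_comm Q' P]; exact add_le_add le_rfl hs) hQ
  by_contra hcon
  have hdeg : multiDeg (P + Finsupp.single s 1) = multiDeg P + 1 := by
    rw [multiDeg_add, multiDeg_single]
  rw [multiDeg_add] at hcon
  have hge := hN _ hPs (by have := multiDeg_pos hP; omega) (by omega) s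
  obtain ⟨p, hp⟩ := exists_divisor_eq (he0.trans_le hge)
  rw [hp, monom_add, monom_single] at hge
  have h1 := (le_divisor (μ := μ) (Q' + P) j p).trans_lt hd
  have h2 := (le_divisor (μ := μ) Q' j p).trans_lt hd'
  rw [monom_add] at h1
  set a := monom Q' (μ p)
  set b := monom P (μ p)
  have hs0 : 0 < ‖μ p s‖ := norm_pos_iff.2 (hμ p s)
  have hj0 : 0 < ‖μ p j‖ := norm_pos_iff.2 (hμ p j)
  have h3 : ‖b * μ p s - μ p s‖ = ‖b - 1‖ * ‖μ p s‖ := by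
    rw [← norm_mul]; congr 1; ring
  rw [h3] at hge
  have h4 : ‖a‖ * ‖b - 1‖ < 2 * (θ * e) := by
    calc ‖a‖ * ‖b - 1‖ = ‖(a * b - μ p j) - (a - μ p j)‖ := by
          rw [← norm_mul]; congr 1; ring
      _ ≤ ‖a * b - μ p j‖ + ‖a - μ p j‖ := norm_sub_le _ _
      _ < _ := by linarith
  have h5 : ‖μ p j‖ / 2 ≤ ‖a‖ := by
    have h6 : ‖μ p j‖ ≤ ‖a‖ + ‖a - μ p j‖ := by
      calc ‖μ p j‖ = ‖a - (a - μ p j)‖ := by congr 1; ring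
        _ ≤ _ := norm_sub_le _ _
    have h7 := hθ2 p j
    have h8 : θ * e ≤ θ := mul_le_of_le_one_right hθ0.le he1
    linarith
  have h6 : ‖μ p j‖ * ‖b - 1‖ < 4 * (θ * e) := by
    have := mul_le_mul_of_nonneg_right h5 (norm_nonneg (b - 1))
    linarith
  have h7 : ‖μ p j‖ * (‖b - 1‖ * ‖μ p s‖) < ‖μ p j‖ * e := by
    calc _ = ‖μ p j‖ * ‖b - 1‖ * ‖μ p s‖ := by ring
      _ < 4 * (θ * e) * ‖μ p s‖ := mul_lt_mul_of_pos_right h6 hs0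
      _ = 4 * θ * ‖μ p s‖ * e := by ring
      _ ≤ _ := mul_le_mul_of_nonneg_right (hθ p s j) he0.le
  exact absurd (lt_of_mul_lt_mul_left h7 hj0.le) (not_lt.2 hge)

/-- A constant below which the divisors count as small in `multiDeg_add_le_of_divisor_lt`. -/
theorem exists_threshold [Finite ι] (hμ : ∀ p j, μ p j ≠ 0) :
    ∃ θ : ℝ, 0 < θ ∧ θ ≤ 1 ∧ (∀ p j, 2 * θ ≤ ‖μ p j‖) ∧
      ∀ p s j, 4 * θ * ‖μ p s‖ ≤ ‖μ p j‖ := by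
  have hsmall : ∀ c a : ℝ, 0 < a → ∀ᶠ θ in 𝓝[>] (0 : ℝ), c * θ ≤ a := fun c a ha => by
    have : Tendsto (fun θ : ℝ => c * θ) (𝓝[>] 0) (𝓝 (c * 0)) :=
      ((continuous_const.mul continuous_id).tendsto 0).mono_left nhdsWithin_le_nhds
    rw [mul_zero] at this
    exact (this.eventually (gt_mem_nhds ha)).mono fun _ h => le_of_lt h
  have h0 : ∀ᶠ θ in 𝓝[>] (0 : ℝ), 0 < θ := self_mem_nhdsWithin
  have h1 := hsmall 1 1 one_pos
  have h2 : ∀ᶠ θ in 𝓝[>] (0 : ℝ), ∀ p j, 2 * θ ≤ ‖μ p j‖ :=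
    eventually_all.2 fun p => eventually_all.2 fun j => hsmall _ _ (norm_pos_iff.2 (hμ p j))
  have h3 : ∀ᶠ θ in 𝓝[>] (0 : ℝ), ∀ p s j, 4 * ‖μ p s‖ * θ ≤ ‖μ p j‖ :=
    eventually_all.2 fun p => eventually_all.2 fun s => eventually_all.2 fun j =>
      hsmall _ _ (norm_pos_iff.2 (hμ p j))
  obtain ⟨θ, h0, h1, h2, h3⟩ := (h0.and (h1.and (h2.and h3))).exists
  exact ⟨θ, h0, by linarith, h2, fun p s j => by linarith [h3 p s j]⟩

/-- Under Brjuno's condition on a lower set `E` of multi-indices free of resonances, the small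
divisors are absorbed by a weight of exponential growth. -/
theorem exists_weight [Finite ι] {E : Set (Fin n →₀ ℕ)} (hE : IsLowerSet E)
    (hμ : ∀ p j, μ p j ≠ 0) {ℓ : ℕ → ℝ} (hℓ : ∀ k, 0 ≤ ℓ k)
    (hsum : Summable fun k => ℓ k / 2 ^ k)
    (hdio : ∀ k, ∀ Q ∈ E, 2 ≤ multiDeg Q → multiDeg Q ≤ 2 ^ (k + 1) → ∀ j,
      Real.exp (-ℓ k) ≤ divisor μ Q j) :
    ∃ (W : (Fin n →₀ ℕ) → ℝ) (c : ℝ), 0 < c ∧ (∀ Q, 0 < W Q) ∧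
      (∀ l, 1 ≤ W (Finsupp.single l 1)) ∧
      (∀ Q₁ Q₂, Q₁ ≠ 0 → Q₂ ≠ 0 → W Q₁ * W Q₂ ≤ W (Q₁ + Q₂)) ∧
      (∀ Q₁ Q₂, Q₁ ≠ 0 → Q₂ ≠ 0 → Q₁ + Q₂ ∈ E → ∀ j,
        W Q₁ * W Q₂ ≤ divisor μ (Q₁ + Q₂) j * W (Q₁ + Q₂)) ∧
      ∀ Q, W Q ≤ c ^ multiDeg Q := by
  obtain ⟨θ, hθ0, hθ1, hθ2, hθ4⟩ := exists_threshold hμ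
  have he1 : ∀ k, Real.exp (-ℓ k) ≤ 1 := fun k => Real.exp_le_one_iff.2 (by linarith [hℓ k])
  have hchoice : ∀ Q, ∃ L : ℝ, 0 ≤ L ∧
      (L = 0 ∨ Q ∈ E ∧ 2 ≤ multiDeg Q ∧ ∃ j, divisor μ Q j = Real.exp (-L)) ∧
      (Q ∈ E → 2 ≤ multiDeg Q → ∀ j, Real.exp (-L) ≤ divisor μ Q j) := by
    intro Q
    by_cases hQ : Q ∈ E ∧ 2 ≤ multiDeg Q
    · obtain ⟨k, hk⟩ : ∃ k, multiDeg Q ≤ 2 ^ (k + 1) :=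
        ⟨multiDeg Q, Nat.lt_two_pow_self.le.trans (Nat.pow_le_pow_right (by norm_num) (by omega))⟩
      have hpos : ∀ j, 0 < divisor μ Q j := fun j =>
        (Real.exp_pos _).trans_le (hdio k Q hQ.1 hQ.2 hk j)
      rcases isEmpty_or_nonempty (Fin n) with hn | hn
      · exact ⟨0, le_rfl, Or.inl rfl, fun _ _ j => (hn.false j).elim⟩
      obtain ⟨j, hj⟩ := Finite.exists_min (divisor μ Q)
      by_cases h1 : divisor μ Q j ≤ 1
      · refine ⟨-Real.log (divisor μ Q j), ?_, Or.inr ⟨hQ.1, hQ.2, j, ?_⟩, fun _ _ i => ?_⟩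
        · linarith [Real.log_nonpos (hpos j).le h1]
        · rw [neg_neg, Real.exp_log (hpos j)]
        · rw [neg_neg, Real.exp_log (hpos j)]; exact hj i
      · refine ⟨0, le_rfl, Or.inl rfl, fun _ _ i => ?_⟩
        rw [neg_zero, Real.exp_zero]
        exact (not_le.1 h1).le.trans (hj i)
    · exact ⟨0, le_rfl, Or.inl rfl, fun h h' => absurd ⟨h, h'⟩ hQ⟩
  choose L hL0 hL hLE using hchoice
  obtain ⟨κ, -, hκ⟩ := exists_tree_cost_bound E (divisor μ) ℓ hℓ hsum θ hθ0 hθ1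
    (fun k j Q hQ h2 hlt => by
      by_contra hcon
      have h := hdio k Q hQ h2 (not_le.1 hcon).le j
      have : θ * Real.exp (-ℓ k) ≤ Real.exp (-ℓ k) :=
        mul_le_of_le_one_left (Real.exp_pos _).le hθ1
      linarith)
    (fun k j Q hQ Q' _ h2 hd hd' hlt =>
      multiDeg_add_le_of_divisor_lt hE (Real.exp_pos _) (he1 k) hθ2 hθ4 hμ hθ0
        (hdio k) hQ h2 hd hd' hlt) L hL
  obtain ⟨W, hW0, hW1, hWs, hWc⟩ := exists_superadditive_weight L κ hκ
  refine ⟨W, Real.exp κ, Real.exp_pos _, hW0, hW1, fun Q₁ Q₂ h₁ h₂ => ?_,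
    fun Q₁ Q₂ h₁ h₂ hE j => ?_, hWc⟩
  · refine (hWs Q₁ Q₂ h₁ h₂).trans (mul_le_of_le_one_left (hW0 _).le ?_)
    exact Real.exp_le_one_iff.2 (by linarith [hL0 (Q₁ + Q₂)])
  · refine (hWs Q₁ Q₂ h₁ h₂).trans (mul_le_mul_of_nonneg_right (hLE _ hE ?_ j) (hW0 _).le)
    rw [multiDeg_add]
    have := multiDeg_pos h₁
    have := multiDeg_pos h₂
    omega

end Divisor

/-! ### Power series whose coefficients vanish on a lower set of multi-indices -/

section Formal

open MvPowerSeries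

variable {n : ℕ}

theorem snd_le_of_mem_antidiagonal {Q : Fin n →₀ ℕ} {x : (Fin n →₀ ℕ) × (Fin n →₀ ℕ)}
    (hx : x ∈ Finset.HasAntidiagonal.antidiagonal Q) : x.2 ≤ Q :=
  Finset.HasAntidiagonal.mem_antidiagonal.1 hx ▸ le_add_self

/-- The ideal of formal power series all of whose coefficients with index in the lower set `E`
vanish. If `E` is the set of the monomials outside a monomial ideal, this is the formal completion
of that ideal. -/
def vanishIdeal (E : LowerSet (Fin n →₀ ℕ)) : Ideal (MvPowerSeries (Fin n) ℂ) where
  carrier := {p | ∀ Q ∈ E, coeff Q p = 0}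
  add_mem' := fun hp hq Q hQ => by rw [map_add, hp Q hQ, hq Q hQ, add_zero]
  zero_mem' := fun Q _ => map_zero _
  smul_mem' := fun c p hp Q hQ => by
    rw [smul_eq_mul, coeff_mul]
    refine Finset.sum_eq_zero fun x hx => ?_
    rw [hp x.2 (E.lower (snd_le_of_mem_antidiagonal hx) hQ), mul_zero]

/-- The multi-indices of degree at most `d`. -/
def degLE (n d : ℕ) : LowerSet (Fin n →₀ ℕ) where
  carrier := {Q | multiDeg Q ≤ d}
  lower' := fun _ _ h hQ => (multiDeg_mono h).trans hQ

theorem mem_degLE {d : ℕ} {Q : Fin n →₀ ℕ} : Q ∈ degLE n d ↔ multiDeg Q ≤ d := Iff.rfl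

/-- Multiplication by a series without constant term raises the degree. -/
theorem mul_mem_vanishIdeal_succ {E : LowerSet (Fin n →₀ ℕ)} {d : ℕ}
    {p q : MvPowerSeries (Fin n) ℂ} (hp : constantCoeff p = 0)
    (hq : q ∈ vanishIdeal (E ⊓ degLE n d)) : p * q ∈ vanishIdeal (E ⊓ degLE n (d + 1)) := by
  intro Q hQ
  rw [coeff_mul]
  refine Finset.sum_eq_zero fun x hx => ?_
  by_cases h0 : x.1 = 0
  · rw [h0, coeff_zero_eq_constantCoeff_apply, hp, zero_mul]
  · rw [hq x.2, mul_zero]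
    refine ⟨E.lower (snd_le_of_mem_antidiagonal hx) hQ.1, ?_⟩
    have h1 := hQ.2
    rw [SetLike.mem_coe, mem_degLE] at h1 ⊢
    have h2 := Finset.HasAntidiagonal.mem_antidiagonal.1 hx
    rw [← h2, multiDeg_add] at h1
    have := multiDeg_pos h0
    omega

theorem hasSubst_of_zero {a : Fin n → MvPowerSeries (Fin n) ℂ}
    (ha : ∀ k, constantCoeff (a k) = 0) : HasSubst a :=
  hasSubst_of_constantCoeff_zero ha

theorem subst_subst {a b : Fin n → MvPowerSeries (Fin n) ℂ} (ha : ∀ k, constantCoeff (a k) = 0)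
    (hb : ∀ k, constantCoeff (b k) = 0) (p : MvPowerSeries (Fin n) ℂ) :
    subst b (subst a p) = subst (fun k => subst b (a k)) p :=
  subst_comp_subst_apply (hasSubst_of_zero ha) (hasSubst_of_zero hb) p

theorem constantCoeff_subst_zero {a : Fin n → MvPowerSeries (Fin n) ℂ}
    (ha : ∀ k, constantCoeff (a k) = 0) {p : MvPowerSeries (Fin n) ℂ} (hp : constantCoeff p = 0) :
    constantCoeff (subst a p) = 0 :=
  constantCoeff_subst_eq_zero (hasSubst_of_zero ha) ha hp

theorem subst_mem_vanishIdeal {E : LowerSet (Fin n →₀ ℕ)} {a : Fin n → MvPowerSeries (Fin n) ℂ}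
    (ha : ∀ k, constantCoeff (a k) = 0) {p : MvPowerSeries (Fin n) ℂ}
    (h : ∀ P, coeff P p ≠ 0 → (P.prod fun s e => a s ^ e) ∈ vanishIdeal E) :
    subst a p ∈ vanishIdeal E := by
  intro Q hQ
  rw [coeff_subst (hasSubst_of_zero ha)]
  refine finsum_eq_zero_of_forall_eq_zero fun P => ?_
  by_cases hP : coeff P p = 0
  · rw [hP, zero_smul]
  · rw [h P hP Q hQ, smul_zero]

theorem subst_sub_subst_mem {E : LowerSet (Fin n →₀ ℕ)} {a b : Fin n → MvPowerSeries (Fin n) ℂ}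
    (ha : ∀ k, constantCoeff (a k) = 0) (hb : ∀ k, constantCoeff (b k) = 0)
    {p : MvPowerSeries (Fin n) ℂ}
    (h : ∀ P, coeff P p ≠ 0 →
      (P.prod fun s e => a s ^ e) - (P.prod fun s e => b s ^ e) ∈ vanishIdeal E) :
    subst a p - subst b p ∈ vanishIdeal E := by
  intro Q hQ
  rw [map_sub, coeff_subst (hasSubst_of_zero ha), coeff_subst (hasSubst_of_zero hb), sub_eq_zero]
  refine finsum_congr fun P => ?_
  by_cases hP : coeff P p = 0
  · rw [hP, zero_smul, zero_smul]
  · have := h P hP Q hQ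
    rw [map_sub, sub_eq_zero] at this
    rw [this]

theorem prod_sub_prod_mem {I : Ideal (MvPowerSeries (Fin n) ℂ)}
    {a b : Fin n → MvPowerSeries (Fin n) ℂ} (h : ∀ k, a k - b k ∈ I) (P : Fin n →₀ ℕ) :
    (P.prod fun s e => a s ^ e) - (P.prod fun s e => b s ^ e) ∈ I := by
  rw [← Ideal.Quotient.mk_eq_mk_iff_sub_mem]
  simp only [Finsupp.prod, map_prod, map_pow]
  exact Finset.prod_congr rfl fun k _ => by
    rw [(Ideal.Quotient.mk_eq_mk_iff_sub_mem _ _).2 (h k)]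

theorem subst_congr_mod {E : LowerSet (Fin n →₀ ℕ)} {a b : Fin n → MvPowerSeries (Fin n) ℂ}
    (ha : ∀ k, constantCoeff (a k) = 0) (hb : ∀ k, constantCoeff (b k) = 0)
    (h : ∀ k, a k - b k ∈ vanishIdeal E) (p : MvPowerSeries (Fin n) ℂ) :
    subst a p - subst b p ∈ vanishIdeal E :=
  subst_sub_subst_mem ha hb fun P _ => prod_sub_prod_mem h P

theorem constantCoeff_prod_pow {a : Fin n → MvPowerSeries (Fin n) ℂ}
    (ha : ∀ k, constantCoeff (a k) = 0) {P : Fin n →₀ ℕ} (hP : P ≠ 0) :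
    constantCoeff (P.prod fun s e => a s ^ e) = 0 := by
  obtain ⟨l, hl⟩ := Finsupp.ne_iff.1 hP
  rw [Finsupp.prod, map_prod]
  refine Finset.prod_eq_zero (Finsupp.mem_support_iff.2 hl) ?_
  rw [map_pow, ha l, zero_pow hl]

theorem prod_pow_add (a : Fin n → MvPowerSeries (Fin n) ℂ) (P Q : Fin n →₀ ℕ) :
    ((P + Q).prod fun s e => a s ^ e) =
      (P.prod fun s e => a s ^ e) * (Q.prod fun s e => a s ^ e) :=
  Finsupp.prod_add_index' (fun _ => pow_zero _) fun _ _ _ => pow_add _ _ _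

theorem prod_pow_single (a : Fin n → MvPowerSeries (Fin n) ℂ) (l : Fin n) :
    ((Finsupp.single l 1).prod fun s e => a s ^ e) = a l := by
  rw [Finsupp.prod_single_index (h := fun s e => a s ^ e) (pow_zero _), pow_one]

/-- A series without terms of degree less than two gains one degree of congruence. -/
theorem subst_congr_mod_succ {E : LowerSet (Fin n →₀ ℕ)} {d : ℕ}
    {a b : Fin n → MvPowerSeries (Fin n) ℂ}
    (ha : ∀ k, constantCoeff (a k) = 0) (hb : ∀ k, constantCoeff (b k) = 0)
    (h : ∀ k, a k - b k ∈ vanishIdeal (E ⊓ degLE n d)) {p : MvPowerSeries (Fin n) ℂ}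
    (hp : ∀ P, multiDeg P < 2 → coeff P p = 0) :
    subst a p - subst b p ∈ vanishIdeal (E ⊓ degLE n (d + 1)) := by
  refine subst_sub_subst_mem ha hb fun P hP => ?_
  have h2 : 2 ≤ multiDeg P := not_lt.1 fun h => hP (hp P h)
  obtain ⟨l, hl⟩ := exists_single_le (Q := P) (by rintro rfl; simp at h2)
  obtain ⟨R, rfl⟩ := exists_add_of_le hl
  have hR : R ≠ 0 := by
    rintro rfl
    rw [add_zero, multiDeg_single] at h2
    omega
  simp only [prod_pow_add]
  rw [prod_pow_single, prod_pow_single]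
  have e : ∀ x y u v : MvPowerSeries (Fin n) ℂ, x * u - y * v = x * (u - v) + v * (x - y) :=
    fun x y u v => by ring
  rw [e]
  exact Ideal.add_mem _ (mul_mem_vanishIdeal_succ (ha l) (prod_sub_prod_mem h R))
    (mul_mem_vanishIdeal_succ (constantCoeff_prod_pow hb hR) (h l))

/-- The linear form `∑ c_k x_k`. -/
def linForm (c : Fin n → ℂ) : MvPowerSeries (Fin n) ℂ := ∑ k, c k • X k

theorem coeff_linForm_single (c : Fin n → ℂ) (l : Fin n) :
    coeff (Finsupp.single l 1) (linForm c) = c l := by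
  classical
  rw [linForm, map_sum, Finset.sum_eq_single l]
  · simp [coeff_X]
  · intro k _ hk
    simp [coeff_X, Finsupp.single_left_inj, hk.symm]
  · simp

@[simp] theorem constantCoeff_linForm (c : Fin n → ℂ) : constantCoeff (linForm c) = 0 := by
  simp [linForm, map_sum, constantCoeff_smul]

theorem multiDeg_eq_one {Q : Fin n →₀ ℕ} (h : multiDeg Q = 1) : ∃ l, Q = Finsupp.single l 1 := by
  obtain ⟨l, hl⟩ := exists_single_le (Q := Q) (by rintro rfl; simp at h)
  obtain ⟨R, rfl⟩ := exists_add_of_le hl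
  rw [multiDeg_add, multiDeg_single] at h
  exact ⟨l, by rw [multiDeg_eq_zero.1 (by omega : multiDeg R = 0), add_zero]⟩

theorem multiDeg_lt_two {Q : Fin n →₀ ℕ} (h : multiDeg Q < 2) :
    Q = 0 ∨ ∃ l, Q = Finsupp.single l 1 := by
  rcases Nat.lt_or_ge (multiDeg Q) 1 with h1 | h1
  · exact Or.inl (multiDeg_eq_zero.1 (by omega))
  · exact Or.inr (multiDeg_eq_one (by omega))

/-- The nonlinear part of a series without constant term. -/
theorem coeff_sub_linForm {p : MvPowerSeries (Fin n) ℂ} (hp : constantCoeff p = 0)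
    {c : Fin n → ℂ} (hc : ∀ l, coeff (Finsupp.single l 1) p = c l) (P : Fin n →₀ ℕ)
    (hP : multiDeg P < 2) : coeff P (p - linForm c) = 0 := by
  rcases multiDeg_lt_two hP with rfl | ⟨l, rfl⟩
  · rw [coeff_zero_eq_constantCoeff_apply, map_sub, hp, constantCoeff_linForm, sub_zero]
  · rw [map_sub, hc, coeff_linForm_single, sub_self]

theorem subst_linForm {a : Fin n → MvPowerSeries (Fin n) ℂ}
    (ha : ∀ k, constantCoeff (a k) = 0) (c : Fin n → ℂ) :
    subst a (linForm c) = ∑ k, c k • a k := by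
  rw [linForm, ← substAlgHom_apply (hasSubst_of_zero ha), map_sum]
  refine Finset.sum_congr rfl fun k _ => ?_
  rw [map_smul, substAlgHom_X]

theorem coeff_subst_of_multiDeg_lt_two {a : Fin n → MvPowerSeries (Fin n) ℂ}
    (ha : ∀ k, constantCoeff (a k) = 0) {p : MvPowerSeries (Fin n) ℂ}
    (hp : ∀ P, multiDeg P < 2 → coeff P p = 0) (Q : Fin n →₀ ℕ) (hQ : multiDeg Q < 2) :
    coeff Q (subst a p) = 0 := by
  have h0 : ∀ k : Fin n, constantCoeff ((fun _ => 0 : Fin n → MvPowerSeries (Fin n) ℂ) k) = 0 :=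
    fun k => map_zero _
  have h := subst_congr_mod_succ (E := ⊤) (d := 0) ha h0 (fun k Q hQ => by
    have : Q = 0 := multiDeg_eq_zero.1 (Nat.le_zero.1 hQ.2)
    rw [this, coeff_zero_eq_constantCoeff_apply, sub_zero, ha k]) hp Q
      ⟨trivial, by rw [SetLike.mem_coe, mem_degLE]; omega⟩
  have hz : subst (fun _ => 0 : Fin n → MvPowerSeries (Fin n) ℂ) p = 0 :=
    subst_zero_of_constantCoeff_zero (by rw [← coeff_zero_eq_constantCoeff_apply]; exact hp 0 (by simp))
  rwa [hz, sub_zero] at h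

/-- Chain rule for the linear parts. -/
theorem coeff_single_subst {a : Fin n → MvPowerSeries (Fin n) ℂ}
    (ha : ∀ k, constantCoeff (a k) = 0) {p : MvPowerSeries (Fin n) ℂ} (hp : constantCoeff p = 0)
    (l : Fin n) :
    coeff (Finsupp.single l 1) (subst a p) =
      ∑ k, coeff (Finsupp.single k 1) p * coeff (Finsupp.single l 1) (a k) := by
  set c : Fin n → ℂ := fun k => coeff (Finsupp.single k 1) p with hc
  have h1 := coeff_subst_of_multiDeg_lt_two ha (coeff_sub_linForm hp (c := c) fun _ => rfl)
    (Finsupp.single l 1) (by rw [multiDeg_single]; omega)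
  rw [subst_sub (hasSubst_of_zero ha), map_sub, sub_eq_zero, subst_linForm ha] at h1
  rw [h1, map_sum]
  rfl

/-- The linear substitution `x ↦ diag(ν) x` multiplies the coefficient of `x^Q` by `ν^Q`. -/
theorem coeff_subst_diag (ν : Fin n → ℂ) (p : MvPowerSeries (Fin n) ℂ) (Q : Fin n →₀ ℕ) :
    coeff Q (subst (fun k => ν k • (X k : MvPowerSeries (Fin n) ℂ)) p) = monom Q ν * coeff Q p := by
  have h := rescale_eq_subst ν p
  have e : (ν • X : Fin n → MvPowerSeries (Fin n) ℂ) = fun k => ν k • X k := rfl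
  rw [e] at h
  rw [← h, coeff_rescale, Finsupp.prod_fintype _ _ (fun _ => pow_zero _), monom]

theorem constantCoeff_diag (ν : Fin n → ℂ) (k : Fin n) :
    constantCoeff (ν k • (X k : MvPowerSeries (Fin n) ℂ)) = 0 := by
  simp [constantCoeff_smul]

/-- A formal linearization modulo a monomial ideal, given by `Φ` and its inverse `Ψ`, yields a
normalized solution `a`, tangent to the identity and whose nonlinear part involves no monomial of
the ideal, of the conjugacy equation `T ∘ a = a ∘ diag(μ)` modulo the ideal. -/
theorem exists_normalized_conjugacy {ι : Type} {E : LowerSet (Fin n →₀ ℕ)} {μ : ι → Fin n → ℂ}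
    {Φ Ψ : Fin n → MvPowerSeries (Fin n) ℂ} {T : ι → Fin n → MvPowerSeries (Fin n) ℂ}
    (hΦ0 : ∀ k, constantCoeff (Φ k) = 0) (hΨ0 : ∀ k, constantCoeff (Ψ k) = 0)
    (hΨΦ : ∀ k, subst Ψ (Φ k) = X k) (hΦΨ : ∀ k, subst Φ (Ψ k) = X k)
    (hΦ1 : ∀ k l, coeff (Finsupp.single l 1) (Φ k) = if l = k then 1 else 0)
    (hT0 : ∀ p k, constantCoeff (T p k) = 0)
    (h : ∀ p k, subst Ψ (subst (T p) (Φ k)) - μ p k • X k ∈ vanishIdeal E) :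
    ∃ a : Fin n → MvPowerSeries (Fin n) ℂ, (∀ k, constantCoeff (a k) = 0) ∧
      (∀ k l, coeff (Finsupp.single l 1) (a k) = if l = k then 1 else 0) ∧
      (∀ k, ∀ Q, 2 ≤ multiDeg Q → Q ∉ E → coeff Q (a k) = 0) ∧
      ∀ p k, subst a (T p k) - subst (fun l => μ p l • X l) (a k) ∈ vanishIdeal E := by
  classical
  have hΨ1 : ∀ k l, coeff (Finsupp.single l 1) (Ψ k) = if l = k then 1 else 0 := by
    intro k l
    have h1 := coeff_single_subst hΨ0 (hΦ0 k) l
    rw [hΨΦ k] at h1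
    simp only [hΦ1, ite_mul, one_mul, zero_mul, Finset.sum_ite_eq', Finset.mem_univ, if_true,
      coeff_X, Finsupp.single_left_inj one_ne_zero] at h1
    exact h1.symm
  set a : Fin n → MvPowerSeries (Fin n) ℂ := fun k Q =>
    if 2 ≤ multiDeg Q ∧ Q ∉ E then 0 else coeff Q (Ψ k) with ha
  have hac : ∀ k Q, coeff Q (a k) = if 2 ≤ multiDeg Q ∧ Q ∉ E then 0 else coeff Q (Ψ k) :=
    fun _ _ => rfl
  have ha0 : ∀ k, constantCoeff (a k) = 0 := fun k => by
    rw [← coeff_zero_eq_constantCoeff_apply, hac, if_neg (by simp),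
      coeff_zero_eq_constantCoeff_apply, hΨ0]
  have haΨ : ∀ k, a k - Ψ k ∈ vanishIdeal E := fun k Q hQ => by
    rw [map_sub, hac, if_neg (fun h => h.2 hQ), sub_self]
  refine ⟨a, ha0, fun k l => ?_, fun k Q h2 hQ => by rw [hac, if_pos ⟨h2, hQ⟩], fun p k => ?_⟩
  · rw [hac, if_neg (by rw [multiDeg_single]; omega), hΨ1]
  · have hTΦ : ∀ k, constantCoeff (subst (T p) (Φ k)) = 0 := fun k =>
      constantCoeff_subst_zero (hT0 p) (hΦ0 k)
    have e1 := subst_congr_mod (fun k => constantCoeff_subst_zero hΨ0 (hTΦ k))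
      (constantCoeff_diag (μ p)) (h p) (Ψ k)
    have e2 : subst (fun k => subst Ψ (subst (T p) (Φ k))) (Ψ k) = subst Ψ (T p k) := by
      rw [← subst_subst hTΦ hΨ0, ← subst_subst hΦ0 (hT0 p), hΦΨ k,
        subst_X (hasSubst_of_zero (hT0 p))]
    rw [e2] at e1
    have e3 := subst_congr_mod ha0 hΨ0 haΨ (T p k)
    have e4 : subst (fun l => μ p l • X l) (Ψ k) - subst (fun l => μ p l • X l) (a k) ∈
        vanishIdeal E := fun Q hQ => by
      have := haΨ k Q hQ
      rw [map_sub, sub_eq_zero] at this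
      rw [map_sub, coeff_subst_diag, coeff_subst_diag, this, sub_self]
    have := Ideal.add_mem _ e3 (Ideal.add_mem _ e1 e4)
    convert this using 1
    ring

/-- The homological equation at the coefficient of `x^Q`. -/
theorem coeff_conjugacy {E : LowerSet (Fin n →₀ ℕ)} {ν : Fin n → ℂ}
    {a : Fin n → MvPowerSeries (Fin n) ℂ} (ha : ∀ k, constantCoeff (a k) = 0)
    {p : MvPowerSeries (Fin n) ℂ} {k : Fin n}
    (h : subst a p - subst (fun l => ν l • X l) (a k) ∈ vanishIdeal E) {Q : Fin n →₀ ℕ}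
    (hQ : Q ∈ E) :
    (monom Q ν - ν k) * coeff Q (a k) = coeff Q (subst a (p - linForm (Pi.single k (ν k)))) := by
  have h1 := h Q hQ
  rw [map_sub, sub_eq_zero, coeff_subst_diag] at h1
  rw [subst_sub (hasSubst_of_zero ha), map_sub, h1, subst_linForm ha, map_sum,
    Finset.sum_eq_single k]
  · simp; ring
  · intro j _ hj
    simp [hj]
  · simp

/-- Two formal maps with the same linear part which both conjugate `diag(cν_j)` to `T_j` modulo a
monomial ideal, for all `j`, coincide modulo the ideal, if no monomial `x^Q` outside it satisfies
`cν_j^Q = ν_{j,k}` for all `j`. -/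
theorem sub_mem_of_conjugacy {ι : Type} {E : LowerSet (Fin n →₀ ℕ)} {ν cν : ι → Fin n → ℂ}
    {T : ι → Fin n → MvPowerSeries (Fin n) ℂ} (hT0 : ∀ j k, constantCoeff (T j k) = 0)
    (hT1 : ∀ j k l, coeff (Finsupp.single l 1) (T j k) = (Pi.single k (ν j k) : Fin n → ℂ) l)
    (hres : ∀ Q ∈ E, 2 ≤ multiDeg Q → ∀ k, ∃ j, monom Q (cν j) ≠ ν j k)
    {A A' : Fin n → MvPowerSeries (Fin n) ℂ} (hA0 : ∀ k, constantCoeff (A k) = 0)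
    (hA0' : ∀ k, constantCoeff (A' k) = 0)
    (hlin : ∀ k l, coeff (Finsupp.single l 1) (A k) = coeff (Finsupp.single l 1) (A' k))
    (hA : ∀ j k, subst A (T j k) - subst (fun l => cν j l • X l) (A k) ∈ vanishIdeal E)
    (hA' : ∀ j k, subst A' (T j k) - subst (fun l => cν j l • X l) (A' k) ∈ vanishIdeal E)
    (k : Fin n) : A k - A' k ∈ vanishIdeal E := by
  have key : ∀ d, ∀ k, A k - A' k ∈ vanishIdeal (E ⊓ degLE n (d + 1)) := by
    intro d
    induction d with
    | zero =>
      intro k Q hQ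
      rcases multiDeg_lt_two (Nat.lt_succ_of_le hQ.2) with rfl | ⟨l, rfl⟩
      · rw [coeff_zero_eq_constantCoeff_apply, map_sub, hA0, hA0', sub_zero]
      · rw [map_sub, hlin, sub_self]
    | succ d ih =>
      intro k Q hQ
      by_cases hd : multiDeg Q ≤ d + 1
      · exact ih k Q ⟨hQ.1, hd⟩
      obtain ⟨j, hj⟩ := hres Q hQ.1 (by omega) k
      have e1 := hA j k Q hQ.1
      have e2 := hA' j k Q hQ.1
      have e3 := subst_congr_mod_succ hA0 hA0' ih
        (coeff_sub_linForm (hT0 j k) (hT1 j k)) Q hQ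
      have e4 : ∀ {a : Fin n → MvPowerSeries (Fin n) ℂ}, (∀ k, constantCoeff (a k) = 0) →
          subst a (T j k - linForm (Pi.single k (ν j k))) = subst a (T j k) - ν j k • a k := by
        intro a ha
        rw [subst_sub (hasSubst_of_zero ha), subst_linForm ha, Finset.sum_eq_single k]
        · simp
        · intro i _ hi
          simp [hi]
        · simp
      rw [e4 hA0, e4 hA0'] at e3
      simp only [map_sub, coeff_subst_diag, map_smul, smul_eq_mul] at e1 e2 e3 ⊢
      have e5 : (monom Q (cν j) - ν j k) * (coeff Q (A k) - coeff Q (A' k)) = 0 := by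
        linear_combination e3 - e1 + e2
      exact (mul_eq_zero.1 e5).resolve_left (sub_ne_zero.2 hj)
  intro Q hQ
  exact key (multiDeg Q) k Q ⟨hQ, by rw [SetLike.mem_coe, mem_degLE]; omega⟩

end Formal

/-! ### Convergent power series and germs of holomorphic functions -/

section Taylor

open MvPowerSeries
open scoped ENNReal NNReal

variable {n : ℕ}

theorem norm_monom (Q : Fin n →₀ ℕ) (z : Fin n → ℂ) : ‖monom Q z‖ = ∏ k, ‖z k‖ ^ Q k := by
  simp [monom, norm_prod, norm_pow]

theorem norm_monom_le {Q : Fin n →₀ ℕ} {z : Fin n → ℂ} {r : ℝ} (hz : ∀ k, ‖z k‖ ≤ r) :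
    ‖monom Q z‖ ≤ r ^ multiDeg Q := by
  rw [norm_monom, multiDeg, ← Finset.prod_pow_eq_pow_sum]
  exact Finset.prod_le_prod (fun k _ => by positivity)
    fun k _ => pow_le_pow_left₀ (norm_nonneg _) (hz k) _

theorem monom_const (Q : Fin n →₀ ℕ) (c : ℂ) : monom Q (fun _ => c) = c ^ multiDeg Q := by
  rw [monom, multiDeg, Finset.prod_pow_eq_pow_sum]

theorem monom_star (Q : Fin n →₀ ℕ) (z : Fin n → ℂ) : monom Q (star z) = star (monom Q z) := by
  simp [monom]

/-- The norm `∑ |p_Q| r^|Q|` of a power series, possibly infinite. -/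
def majNorm (r : ℝ≥0) (p : MvPowerSeries (Fin n) ℂ) : ℝ≥0∞ :=
  ∑' Q, ‖coeff Q p‖ₑ * (r : ℝ≥0∞) ^ multiDeg Q

theorem majNorm_mul_le (r : ℝ≥0) (p q : MvPowerSeries (Fin n) ℂ) :
    majNorm r (p * q) ≤ majNorm r p * majNorm r q := by
  have h1 : majNorm r p * majNorm r q = ∑' x : (Fin n →₀ ℕ) × (Fin n →₀ ℕ),
      (‖coeff x.1 p‖ₑ * (r : ℝ≥0∞) ^ multiDeg x.1) *
        (‖coeff x.2 q‖ₑ * (r : ℝ≥0∞) ^ multiDeg x.2) := by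
    rw [ENNReal.tsum_prod', majNorm, ← ENNReal.tsum_mul_right]
    exact tsum_congr fun a => by rw [majNorm, ← ENNReal.tsum_mul_left]
  rw [h1, ← (Finset.HasAntidiagonal.sigmaAntidiagonalEquivProd
    (A := Fin n →₀ ℕ)).tsum_eq, ENNReal.tsum_sigma']
  refine ENNReal.tsum_le_tsum fun Q => ?_
  rw [tsum_fintype, coeff_mul]
  refine (mul_le_mul_left (enorm_sum_le _ _) _).trans ?_
  rw [Finset.sum_mul, ← Finset.sum_coe_sort]
  refine Finset.sum_le_sum fun x _ => le_of_eq ?_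
  have hx := Finset.HasAntidiagonal.mem_antidiagonal.1 x.2
  simp only [Finset.HasAntidiagonal.sigmaAntidiagonalEquivProd_apply]
  rw [enorm_mul]
  have hd : multiDeg Q = multiDeg x.1.1 + multiDeg x.1.2 := by rw [← multiDeg_add, hx]
  rw [hd, pow_add]
  ring

theorem majNorm_one (r : ℝ≥0) : majNorm r (1 : MvPowerSeries (Fin n) ℂ) = 1 := by
  classical
  rw [majNorm, tsum_eq_single 0]
  · simp
  · intro Q hQ
    simp [coeff_one, hQ]

theorem majNorm_pow_le (r : ℝ≥0) (p : MvPowerSeries (Fin n) ℂ) (d : ℕ) :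
    majNorm r (p ^ d) ≤ majNorm r p ^ d := by
  induction d with
  | zero => simp [majNorm_one]
  | succ d ih =>
    rw [pow_succ, pow_succ]
    exact (majNorm_mul_le r _ _).trans (mul_le_mul_left ih _)

theorem majNorm_prod_le {r : ℝ≥0} {a : Fin n → MvPowerSeries (Fin n) ℂ} {ρ : ℝ≥0∞}
    (h : ∀ k, majNorm r (a k) ≤ ρ) (P : Fin n →₀ ℕ) :
    majNorm r (P.prod fun s e => a s ^ e) ≤ ρ ^ multiDeg P := by
  rw [Finsupp.prod_fintype _ _ fun _ => pow_zero _, multiDeg, ← Finset.prod_pow_eq_pow_sum]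
  have : ∀ S : Finset (Fin n), majNorm r (∏ k ∈ S, a k ^ P k) ≤ ∏ k ∈ S, ρ ^ P k := by
    classical
    intro S
    induction S using Finset.induction_on with
    | empty => simp [majNorm_one]
    | insert k S hk ih =>
      rw [Finset.prod_insert hk, Finset.prod_insert hk]
      exact (majNorm_mul_le r _ _).trans
        (mul_le_mul' ((majNorm_pow_le r _ _).trans (pow_le_pow_left' (h k) _)) ih)
  exact this _

theorem majNorm_mono {r r' : ℝ≥0} (h : r ≤ r') (p : MvPowerSeries (Fin n) ℂ) :
    majNorm r p ≤ majNorm r' p :=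
  ENNReal.tsum_le_tsum fun _ => by gcongr

theorem majNorm_ne_top_iff {r : ℝ≥0} {p : MvPowerSeries (Fin n) ℂ} :
    majNorm r p ≠ ∞ ↔ Summable fun Q => ‖coeff Q p‖ * (r : ℝ) ^ multiDeg Q := by
  have : ∀ Q, ‖coeff Q p‖ₑ * (r : ℝ≥0∞) ^ multiDeg Q =
      ((‖coeff Q p‖₊ * r ^ multiDeg Q : ℝ≥0) : ℝ≥0∞) := fun Q => by
    push_cast; rfl
  simp only [majNorm, this]
  rw [ENNReal.tsum_coe_ne_top_iff_summable, ← NNReal.summable_coe]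
  simp

/-- The norm of a series without constant term is small on small polydiscs. -/
theorem majNorm_mul_le_of_constantCoeff {p : MvPowerSeries (Fin n) ℂ} (hp : constantCoeff p = 0)
    {c : ℝ≥0} (hc : c ≤ 1) (r : ℝ≥0) : majNorm (c * r) p ≤ c * majNorm r p := by
  rw [majNorm, majNorm, ← ENNReal.tsum_mul_left]
  refine ENNReal.tsum_le_tsum fun Q => ?_
  by_cases hQ : Q = 0
  · simp [hQ, hp]
  · have h1 : (c : ℝ≥0∞) ^ multiDeg Q ≤ c := by
      exact pow_le_of_le_one zero_le (by exact_mod_cast hc) (multiDeg_pos hQ).ne'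
    calc ‖coeff Q p‖ₑ * ((c * r : ℝ≥0) : ℝ≥0∞) ^ multiDeg Q
        = (c : ℝ≥0∞) ^ multiDeg Q * (‖coeff Q p‖ₑ * (r : ℝ≥0∞) ^ multiDeg Q) := by
          push_cast; ring
      _ ≤ _ := mul_le_mul_left h1 _

/-- Finitely many convergent series without constant term map a small polydisc into a given one,
in the sense of the majorant norm. -/
theorem exists_majNorm_le {a : Fin n → MvPowerSeries (Fin n) ℂ}
    (ha0 : ∀ k, constantCoeff (a k) = 0) (ha : ∀ k, ∃ r : ℝ≥0, 0 < r ∧ majNorm r (a k) ≠ ∞)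
    {ρ : ℝ≥0} (hρ : 0 < ρ) {r₀ : ℝ} (hr₀ : 0 < r₀) :
    ∃ r : ℝ≥0, 0 < r ∧ (r : ℝ) < r₀ ∧ ∀ k, majNorm r (a k) ≤ ρ := by
  have h1 : ∀ k, ∀ᶠ r in 𝓝[>] (0 : ℝ≥0), majNorm r (a k) ≤ ρ := by
    intro k
    obtain ⟨r, hr, hfin⟩ := ha k
    set A : ℝ≥0 := (majNorm r (a k)).toNNReal with hA
    have hAe : majNorm r (a k) = A := (ENNReal.coe_toNNReal hfin).symm
    have hev : ∀ᶠ s in 𝓝[>] (0 : ℝ≥0), s / r ≤ 1 ∧ s / r * A ≤ ρ := by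
      have t1 : Tendsto (fun s : ℝ≥0 => s / r) (𝓝[>] 0) (𝓝 0) := by
        have : Tendsto (fun s : ℝ≥0 => s / r) (𝓝 0) (𝓝 (0 / r)) :=
          (continuous_id.div_const r).tendsto 0
        rw [zero_div] at this
        exact this.mono_left nhdsWithin_le_nhds
      have t2 : Tendsto (fun s : ℝ≥0 => s / r * A) (𝓝[>] 0) (𝓝 0) := by
        simpa using t1.mul_const A
      exact ((t1.eventually (gt_mem_nhds one_pos)).and (t2.eventually (gt_mem_nhds hρ))).mono
        fun s hs => ⟨hs.1.le, hs.2.le⟩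
    filter_upwards [hev] with s hs
    have h := majNorm_mul_le_of_constantCoeff (ha0 k) hs.1 r
    rw [div_mul_cancel₀ _ hr.ne', hAe] at h
    exact h.trans (by exact_mod_cast hs.2)
  have h2 : ∀ᶠ r : ℝ≥0 in 𝓝[>] (0 : ℝ≥0), (r : ℝ) < r₀ := by
    have : Tendsto (fun s : ℝ≥0 => (s : ℝ)) (𝓝[>] 0) (𝓝 0) :=
      (NNReal.continuous_coe.tendsto 0).mono_left nhdsWithin_le_nhds
    exact this.eventually (gt_mem_nhds hr₀)
  have h3 : ∀ᶠ r in 𝓝[>] (0 : ℝ≥0), 0 < r := self_mem_nhdsWithin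
  obtain ⟨r, h⟩ := (h3.and (h2.and (eventually_all.2 h1))).exists
  exact ⟨r, h⟩

/-- The power series `p` sums to `v` at the point `z`. -/
def SumsTo (p : MvPowerSeries (Fin n) ℂ) (z : Fin n → ℂ) (v : ℂ) : Prop :=
  HasSum (fun Q => coeff Q p * monom Q z) v

theorem norm_coeff_mul_monom_le {p : MvPowerSeries (Fin n) ℂ} {r : ℝ≥0} {z : Fin n → ℂ}
    (hz : ∀ k, ‖z k‖ ≤ r) (Q : Fin n →₀ ℕ) :
    ‖coeff Q p * monom Q z‖ ≤ ‖coeff Q p‖ * (r : ℝ) ^ multiDeg Q := by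
  rw [norm_mul]
  exact mul_le_mul_of_nonneg_left (norm_monom_le hz) (norm_nonneg _)

theorem sumsTo_tsum {p : MvPowerSeries (Fin n) ℂ} {r : ℝ≥0} (h : majNorm r p ≠ ∞)
    {z : Fin n → ℂ} (hz : ∀ k, ‖z k‖ ≤ r) : SumsTo p z (∑' Q, coeff Q p * monom Q z) :=
  (Summable.of_norm_bounded (majNorm_ne_top_iff.1 h) (norm_coeff_mul_monom_le hz)).hasSum

theorem SumsTo.norm_le {p : MvPowerSeries (Fin n) ℂ} {z : Fin n → ℂ} {v : ℂ}
    (h : SumsTo p z v) {r ρ : ℝ≥0} (hr : majNorm r p ≤ ρ) (hz : ∀ k, ‖z k‖ ≤ r) : ‖v‖ ≤ ρ := by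
  have hfin : majNorm r p ≠ ∞ := ne_top_of_le_ne_top ENNReal.coe_ne_top hr
  have hs := majNorm_ne_top_iff.1 hfin
  have h1 : ‖v‖ₑ ≤ majNorm r p := by
    rw [← h.tsum_eq]
    refine enorm_tsum_le_tsum_enorm.trans (ENNReal.tsum_le_tsum fun Q => ?_)
    have := norm_coeff_mul_monom_le (p := p) hz Q
    have e : ‖coeff Q p‖ₑ * (r : ℝ≥0∞) ^ multiDeg Q =
        ((‖coeff Q p‖₊ * r ^ multiDeg Q : ℝ≥0) : ℝ≥0∞) := by push_cast; rfl
    rw [e, enorm_eq_nnnorm, ENNReal.coe_le_coe, ← NNReal.coe_le_coe]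
    simpa using this
  have h2 := h1.trans hr
  rw [enorm_eq_nnnorm, ENNReal.coe_le_coe, ← NNReal.coe_le_coe] at h2
  exact h2

theorem hasSum_antidiagonal {A : Type*} [AddCommMonoid A] [Finset.HasAntidiagonal A]
    {f g : A → ℂ} {u v : ℂ} (hf : HasSum f u) (hg : HasSum g v) :
    HasSum (fun Q => ∑ x ∈ Finset.HasAntidiagonal.antidiagonal Q, f x.1 * g x.2) (u * v) := by
  have hfg : Summable fun x : A × A => f x.1 * g x.2 :=
    summable_mul_of_summable_norm hf.summable.norm hg.summable.norm
  have h1 := summable_sum_mul_antidiagonal_of_summable_mul hfg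
  have h2 := hf.summable.tsum_mul_tsum_eq_tsum_sum_antidiagonal hg.summable hfg
  rw [hf.tsum_eq, hg.tsum_eq] at h2
  rw [h2]
  exact h1.hasSum

theorem SumsTo.mul {p q : MvPowerSeries (Fin n) ℂ} {z : Fin n → ℂ} {u v : ℂ}
    (hp : SumsTo p z u) (hq : SumsTo q z v) : SumsTo (p * q) z (u * v) := by
  have h := hasSum_antidiagonal hp hq
  have e : (fun Q => coeff Q (p * q) * monom Q z) = fun Q =>
      ∑ x ∈ Finset.HasAntidiagonal.antidiagonal Q,
        (coeff x.1 p * monom x.1 z) * (coeff x.2 q * monom x.2 z) := by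
    funext Q
    rw [coeff_mul, Finset.sum_mul]
    refine Finset.sum_congr rfl fun x hx => ?_
    rw [← Finset.HasAntidiagonal.mem_antidiagonal.1 hx, monom_add]
    ring
  rw [SumsTo, e]
  exact h

theorem sumsTo_one (z : Fin n → ℂ) : SumsTo 1 z 1 := by
  classical
  have := hasSum_single (f := fun Q => coeff Q (1 : MvPowerSeries (Fin n) ℂ) * monom Q z) 0
    (fun Q hQ => by simp [coeff_one, hQ])
  simpa [SumsTo, monom] using this

theorem SumsTo.pow {p : MvPowerSeries (Fin n) ℂ} {z : Fin n → ℂ} {u : ℂ}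
    (hp : SumsTo p z u) (d : ℕ) : SumsTo (p ^ d) z (u ^ d) := by
  induction d with
  | zero => simpa using sumsTo_one z
  | succ d ih => rw [pow_succ, pow_succ]; exact ih.mul hp

theorem SumsTo.prod_pow {a : Fin n → MvPowerSeries (Fin n) ℂ} {z w : Fin n → ℂ}
    (h : ∀ k, SumsTo (a k) z (w k)) (P : Fin n →₀ ℕ) :
    SumsTo (P.prod fun s e => a s ^ e) z (monom P w) := by
  classical
  rw [Finsupp.prod_fintype _ _ fun _ => pow_zero _, monom]
  have : ∀ S : Finset (Fin n), SumsTo (∏ k ∈ S, a k ^ P k) z (∏ k ∈ S, w k ^ P k) := by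
    intro S
    induction S using Finset.induction_on with
    | empty => simpa using sumsTo_one z
    | insert k S hk ih =>
      rw [Finset.prod_insert hk, Finset.prod_insert hk]
      exact ((h k).pow _).mul ih
  exact this _

theorem eventually_norm_le {r : ℝ≥0} (hr : 0 < r) :
    ∀ᶠ z in 𝓝 (0 : Fin n → ℂ), ∀ k, ‖z k‖ ≤ r := by
  filter_upwards [Metric.closedBall_mem_nhds (0 : Fin n → ℂ) (show (0 : ℝ) < r by exact_mod_cast hr)]
    with z hz k
  exact (norm_le_pi_norm z k).trans (by simpa using hz)

theorem hasTaylorSeries_tsum {p : MvPowerSeries (Fin n) ℂ} {r : ℝ≥0} (hr : 0 < r)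
    (h : majNorm r p ≠ ∞) : HasTaylorSeries (fun z => ∑' Q, coeff Q p * monom Q z) p := by
  filter_upwards [eventually_norm_le hr] with z hz
  exact sumsTo_tsum h hz

/-- Convergence near the origin is absolute convergence on a closed polydisc. -/
theorem HasTaylorSeries.exists_majNorm {f : (Fin n → ℂ) → ℂ} {p : MvPowerSeries (Fin n) ℂ}
    (h : HasTaylorSeries f p) : ∃ r : ℝ≥0, 0 < r ∧ majNorm r p ≠ ∞ ∧
      ∀ z : Fin n → ℂ, (∀ k, ‖z k‖ ≤ r) → SumsTo p z (f z) := by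
  obtain ⟨ε, hε, hball⟩ := Metric.eventually_nhds_iff.1 h
  set r : ℝ≥0 := ⟨ε / 2, by positivity⟩ with hrdef
  have hr : (r : ℝ) = ε / 2 := rfl
  have hmem : ∀ z : Fin n → ℂ, (∀ k, ‖z k‖ ≤ r) → SumsTo p z (f z) := fun z hz => by
    refine hball ?_
    rw [dist_zero_right]
    have : ‖z‖ ≤ ε / 2 := (pi_norm_le_iff_of_nonneg (by positivity)).2 hz
    linarith
  refine ⟨r, by rw [← NNReal.coe_pos, hr]; positivity, ?_, hmem⟩
  rw [majNorm_ne_top_iff]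
  have := (hmem (fun _ => (r : ℂ)) (fun k => by simp)).summable.norm
  refine this.congr fun Q => ?_
  rw [norm_mul, monom_const, norm_pow]
  simp

theorem HasTaylorSeries.congr {f g : (Fin n → ℂ) → ℂ} {p : MvPowerSeries (Fin n) ℂ}
    (h : HasTaylorSeries f p) (hfg : f =ᶠ[𝓝 0] g) : HasTaylorSeries g p := by
  filter_upwards [h, hfg] with z hz he
  rwa [← he]

theorem HasTaylorSeries.mul {f g : (Fin n → ℂ) → ℂ} {p q : MvPowerSeries (Fin n) ℂ}
    (hf : HasTaylorSeries f p) (hg : HasTaylorSeries g q) :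
    HasTaylorSeries (fun z => f z * g z) (p * q) := by
  filter_upwards [hf, hg] with z h₁ h₂
  exact SumsTo.mul h₁ h₂

theorem HasTaylorSeries.add {f g : (Fin n → ℂ) → ℂ} {p q : MvPowerSeries (Fin n) ℂ}
    (hf : HasTaylorSeries f p) (hg : HasTaylorSeries g q) :
    HasTaylorSeries (fun z => f z + g z) (p + q) := by
  filter_upwards [hf, hg] with z h₁ h₂
  simpa [add_mul] using! h₁.add h₂

theorem HasTaylorSeries.sub {f g : (Fin n → ℂ) → ℂ} {p q : MvPowerSeries (Fin n) ℂ}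
    (hf : HasTaylorSeries f p) (hg : HasTaylorSeries g q) :
    HasTaylorSeries (fun z => f z - g z) (p - q) := by
  filter_upwards [hf, hg] with z h₁ h₂
  simpa [sub_mul] using! h₁.sub h₂

theorem tendsto_star_zero : Tendsto (fun z : Fin n → ℂ => star z) (𝓝 0) (𝓝 0) := by
  have := (continuous_star (R := Fin n → ℂ)).tendsto 0
  rwa [star_zero] at this

/-- The Taylor series of the conjugate function `z ↦ conj (f (conj z))`. -/
theorem HasTaylorSeries.conj {f : (Fin n → ℂ) → ℂ} {p : MvPowerSeries (Fin n) ℂ}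
    (h : HasTaylorSeries f p) :
    HasTaylorSeries (fun z => star (f (star z))) (map (starRingEnd ℂ) p) := by
  filter_upwards [tendsto_star_zero.eventually h] with z hz
  have e : (fun Q => coeff Q (map (starRingEnd ℂ) p) * monom Q z) =
      fun Q => star (coeff Q p * monom Q (star z)) := by
    funext Q
    rw [coeff_map, monom_star, star_mul', star_star]
    rfl
  rw [e]
  exact hz.star

theorem hasTaylorSeries_monom (Q : Fin n →₀ ℕ) : HasTaylorSeries (monom Q) (monomial Q 1) := by
  classical
  refine Eventually.of_forall fun z => ?_
  have := hasSum_single (f := fun P => coeff P (monomial Q (1 : ℂ)) * monom P z) Q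
    (fun P hP => by simp [coeff_monomial, hP])
  simpa using! this

theorem hasTaylorSeries_linForm (c : Fin n → ℂ) :
    HasTaylorSeries (fun z => ∑ k, c k * z k) (linForm c) := by
  refine Eventually.of_forall fun z => ?_
  have h : ∀ k, HasSum (fun Q => coeff Q (c k • X k : MvPowerSeries (Fin n) ℂ) * monom Q z)
      (c k * z k) := fun k => by
    classical
    have := hasSum_single (f := fun P => coeff P (c k • X k : MvPowerSeries (Fin n) ℂ) * monom P z)
      (Finsupp.single k 1) (fun P hP => by simp [coeff_X, hP])
    simpa [monom_single] using this
  have := hasSum_sum (s := Finset.univ) fun k _ => h k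
  simpa only [linForm, map_sum, Finset.sum_mul] using this

/-- Substitution of power series is composition of functions. -/
theorem HasTaylorSeries.comp {f : (Fin n → ℂ) → ℂ} {p : MvPowerSeries (Fin n) ℂ}
    (hf : HasTaylorSeries f p) {g : (Fin n → ℂ) → Fin n → ℂ}
    {a : Fin n → MvPowerSeries (Fin n) ℂ} (hg : ∀ k, HasTaylorSeries (fun z => g z k) (a k))
    (ha : ∀ k, constantCoeff (a k) = 0) : HasTaylorSeries (fun z => f (g z)) (subst a p) := by
  obtain ⟨ρ, hρ, hfin, hsum⟩ := hf.exists_majNorm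
  obtain ⟨r, hr, -, har⟩ := exists_majNorm_le ha
    (fun k => let ⟨r, h1, h2, _⟩ := (hg k).exists_majNorm; ⟨r, h1, h2⟩) hρ one_pos
  filter_upwards [eventually_norm_le hr, eventually_all.2 hg] with z hz hgz
  have hgρ : ∀ k, ‖g z k‖ ≤ ρ := fun k => SumsTo.norm_le (hgz k) (har k) hz
  have h1 := hsum (g z) hgρ
  set A : (Fin n →₀ ℕ) → MvPowerSeries (Fin n) ℂ := fun P => P.prod fun s e => a s ^ e with hA
  have h2 : ∀ P, HasSum (fun Q => coeff P p * (coeff Q (A P) * monom Q z))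
      (coeff P p * monom P (g z)) := fun P => (SumsTo.prod_pow hgz P).mul_left _
  -- Absolute convergence of the double series.
  have h3 : Summable fun x : (Fin n →₀ ℕ) × (Fin n →₀ ℕ) =>
      coeff x.1 p * (coeff x.2 (A x.1) * monom x.2 z) := by
    have : ∑' x : (Fin n →₀ ℕ) × (Fin n →₀ ℕ),
        ‖coeff x.1 p * (coeff x.2 (A x.1) * monom x.2 z)‖ₑ ≠ ∞ := by
      refine ne_top_of_le_ne_top hfin ?_
      rw [ENNReal.tsum_prod']
      refine ENNReal.tsum_le_tsum fun P => ?_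
      simp only [enorm_mul]
      rw [ENNReal.tsum_mul_left]
      refine mul_le_mul_right (le_trans ?_ (majNorm_prod_le har P)) _
      refine ENNReal.tsum_le_tsum fun Q => mul_le_mul_right ?_ _
      have := norm_monom_le (Q := Q) hz
      rw [enorm_eq_nnnorm, ← ENNReal.coe_pow, ENNReal.coe_le_coe, ← NNReal.coe_le_coe]
      simpa using this
    exact Summable.of_enorm this
  have h4 : HasSum (fun x : (Fin n →₀ ℕ) × (Fin n →₀ ℕ) =>
      coeff x.1 p * (coeff x.2 (A x.1) * monom x.2 z)) (f (g z)) := by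
    have := h3.hasSum
    rwa [(this.prod_fiberwise h2).unique h1] at this
  have h5 := ((Equiv.prodComm _ _).hasSum_iff.2 h4)
  refine HasSum.prod_fiberwise h5 fun Q => ?_
  simp only [Function.comp_def, Equiv.prodComm_apply, Prod.fst_swap, Prod.snd_swap]
  have h6 := coeff_subst_finite (hasSubst_of_zero ha) p Q
  rw [coeff_subst (hasSubst_of_zero ha), finsum_eq_sum _ h6, Finset.sum_mul]
  have h7 := hasSum_sum_of_ne_finset_zero (L := SummationFilter.unconditional _)
    (f := fun P => coeff P p * (coeff Q (A P) * monom Q z)) (s := h6.toFinset) fun P hP => by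
      have : coeff P p • coeff Q (A P) = 0 := by
        by_contra hne
        exact hP (h6.mem_toFinset.2 hne)
      rw [← mul_assoc, ← smul_eq_mul (coeff P p), this, zero_mul]
  convert h7 using 1
  exact Finset.sum_congr rfl fun P _ => by rw [smul_eq_mul, mul_assoc]

end Taylor

/-! ### Taylor series and analyticity -/

section Analytic

open MvPowerSeries
open scoped ENNReal NNReal

variable {n : ℕ}

theorem exists_prod_eq_monom (m : ℕ) (Q : Fin n →₀ ℕ) (hQ : multiDeg Q = m) :
    ∃ s : Fin m → Fin n, ∀ z : Fin n → ℂ, ∏ i, z (s i) = monom Q z := by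
  induction m generalizing Q with
  | zero =>
    rw [multiDeg_eq_zero] at hQ
    exact ⟨Fin.elim0, fun z => by simp [hQ, monom]⟩
  | succ m ih =>
    obtain ⟨l, hl⟩ := exists_single_le (Q := Q) (by rintro rfl; simp at hQ)
    obtain ⟨R, rfl⟩ := exists_add_of_le hl
    rw [multiDeg_add, multiDeg_single] at hQ
    obtain ⟨s, hs⟩ := ih R (by omega)
    exact ⟨Fin.cons l s, fun z => by
      simp [Fin.prod_univ_succ, hs, monom_add, monom_single]⟩

/-- A monomial of degree `m` is the restriction to the diagonal of a multilinear form of norm at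
most one. -/
theorem exists_multilinear_monom (m : ℕ) (Q : Fin n →₀ ℕ) :
    ∃ M : (Fin n → ℂ) [×m]→L[ℂ] ℂ, ‖M‖ ≤ 1 ∧
      (multiDeg Q = m → ∀ z : Fin n → ℂ, (M fun _ => z) = monom Q z) := by
  by_cases hQ : multiDeg Q = m
  · obtain ⟨s, hs⟩ := exists_prod_eq_monom m Q hQ
    refine ⟨(ContinuousMultilinearMap.mkPiAlgebra ℂ (Fin m) ℂ).compContinuousLinearMap
      fun i => ContinuousLinearMap.proj (s i), ?_, fun _ z => by simpa using hs z⟩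
    refine ContinuousMultilinearMap.opNorm_le_bound zero_le_one fun v => ?_
    simp only [ContinuousMultilinearMap.compContinuousLinearMap_apply,
      ContinuousMultilinearMap.mkPiAlgebra_apply, ContinuousLinearMap.proj_apply, norm_prod,
      one_mul]
    exact Finset.prod_le_prod (fun _ _ => norm_nonneg _) fun i _ => norm_le_pi_norm _ _
  · exact ⟨0, by simp, fun h => absurd h hQ⟩

/-- The multi-indices of degree `m`. -/
def degEq (n m : ℕ) : Finset (Fin n →₀ ℕ) :=
  ((finite_multiDeg_le m).subset fun _ h => le_of_eq h :
    {Q : Fin n →₀ ℕ | multiDeg Q = m}.Finite).toFinset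

theorem mem_degEq {m : ℕ} {Q : Fin n →₀ ℕ} : Q ∈ degEq n m ↔ multiDeg Q = m := by
  simp [degEq]

theorem HasSum.sum_degEq {α : Type*} [NormedAddCommGroup α] [CompleteSpace α]
    {f : (Fin n →₀ ℕ) → α} {v : α} (h : HasSum f v) :
    HasSum (fun m => ∑ Q ∈ degEq n m, f Q) v := by
  convert h.tsum_fiberwise (multiDeg (n := n)) using 2 with m
  have e : multiDeg (n := n) ⁻¹' {m} = ((degEq n m : Finset _) : Set (Fin n →₀ ℕ)) := by
    ext Q; simp [mem_degEq]
  rw [e]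
  exact (Finset.tsum_subtype' _ _).symm

/-- The sum of a multivariate power series is analytic; the homogeneous parts of the series give its
expansion in multilinear forms. -/
theorem HasTaylorSeries.exists_hasFPowerSeriesAt {f : (Fin n → ℂ) → ℂ}
    {p : MvPowerSeries (Fin n) ℂ} (h : HasTaylorSeries f p) :
    ∃ P : FormalMultilinearSeries ℂ (Fin n → ℂ) ℂ, HasFPowerSeriesAt f P 0 ∧
      ∀ m z, (P m fun _ => z) = ∑ Q ∈ degEq n m, coeff Q p * monom Q z := by
  choose M hM1 hM using fun (m : ℕ) (Q : Fin n →₀ ℕ) => exists_multilinear_monom m Q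
  obtain ⟨r, hr, hfin, hsum⟩ := h.exists_majNorm
  set P : FormalMultilinearSeries ℂ (Fin n → ℂ) ℂ := fun m =>
    ∑ Q ∈ degEq n m, coeff Q p • M m Q with hP
  have hPz : ∀ m z, (P m fun _ => z) = ∑ Q ∈ degEq n m, coeff Q p * monom Q z := by
    intro m z
    simp only [hP, _root_.sum_apply, _root_.smul_apply,
      smul_eq_mul]
    exact Finset.sum_congr rfl fun Q hQ => by rw [hM m Q (mem_degEq.1 hQ)]
  refine ⟨P, ⟨r, ?_, by exact_mod_cast hr, fun {y} hy => ?_⟩, hPz⟩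
  · have hs := (majNorm_ne_top_iff.1 hfin).hasSum.sum_degEq.summable
    refine P.le_radius_of_summable (Summable.of_nonneg_of_le (fun m => by positivity)
      (fun m => ?_) hs)
    have h1 : ‖P m‖ ≤ ∑ Q ∈ degEq n m, ‖coeff Q p‖ := by
      refine (norm_sum_le _ _).trans (Finset.sum_le_sum fun Q _ => ?_)
      rw [norm_smul]
      exact mul_le_of_le_one_right (norm_nonneg _) (hM1 m Q)
    calc ‖P m‖ * (r : ℝ) ^ m ≤ (∑ Q ∈ degEq n m, ‖coeff Q p‖) * (r : ℝ) ^ m := by gcongr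
      _ = _ := by
        rw [Finset.sum_mul]
        exact Finset.sum_congr rfl fun Q hQ => by rw [mem_degEq.1 hQ]
  · have hy' : ‖y‖ < r := by
      rw [Metric.eball_coe] at hy
      simpa using hy
    rw [zero_add]
    simp only [hPz]
    exact HasSum.sum_degEq (hsum y fun k => (norm_le_pi_norm y k).trans hy'.le)

theorem HasTaylorSeries.analyticAt {f : (Fin n → ℂ) → ℂ} {p : MvPowerSeries (Fin n) ℂ}
    (h : HasTaylorSeries f p) : AnalyticAt ℂ f 0 :=
  let ⟨P, hP, _⟩ := h.exists_hasFPowerSeriesAt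
  ⟨P, hP⟩

theorem HasTaylorSeries.eq_zero {p : MvPowerSeries (Fin n) ℂ}
    (h : HasTaylorSeries (fun _ => 0) p) : p = 0 := by
  classical
  obtain ⟨P, hP, hPz⟩ := h.exists_hasFPowerSeriesAt
  ext Q
  set F : MvPolynomial (Fin n) ℂ :=
    ∑ R ∈ degEq n (multiDeg Q), MvPolynomial.monomial R (coeff R p) with hF
  have hF0 : F = 0 := by
    refine MvPolynomial.funext fun z => ?_
    have h1 := HasFPowerSeriesAt.apply_eq_zero hP (multiDeg Q) z
    rw [hPz] at h1
    rw [map_zero, hF, map_sum, ← h1]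
    refine Finset.sum_congr rfl fun R _ => ?_
    rw [MvPolynomial.eval_monomial, Finsupp.prod_fintype _ _ fun _ => pow_zero _, monom]
  have h2 : MvPolynomial.coeff Q F = coeff Q p := by
    rw [hF, MvPolynomial.coeff_sum, Finset.sum_eq_single Q]
    · simp
    · intro R _ hR
      simp [MvPolynomial.coeff_monomial, hR]
    · intro hQ
      exact absurd (mem_degEq.2 rfl) hQ
  rw [← h2, hF0]
  simp

theorem HasTaylorSeries.unique {f : (Fin n → ℂ) → ℂ} {p q : MvPowerSeries (Fin n) ℂ}
    (hp : HasTaylorSeries f p) (hq : HasTaylorSeries f q) : p = q :=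
  sub_eq_zero.1 (HasTaylorSeries.eq_zero (by simpa using hp.sub hq))

theorem HasTaylorSeries.apply_zero {f : (Fin n → ℂ) → ℂ} {p : MvPowerSeries (Fin n) ℂ}
    (h : HasTaylorSeries f p) : f 0 = constantCoeff p := by
  have h0 : HasSum (fun Q => coeff Q p * monom Q (0 : Fin n → ℂ)) (f 0) := h.self_of_nhds
  have := hasSum_single (f := fun Q => coeff Q p * monom Q (0 : Fin n → ℂ)) 0 fun Q hQ => by
    obtain ⟨l, hl⟩ := Finsupp.ne_iff.1 hQ
    rw [monom, Finset.prod_eq_zero (Finset.mem_univ l), mul_zero]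
    simpa using hl
  rw [h0.unique this]
  simp [monom]

theorem HasTaylorSeries.fderiv_apply {f : (Fin n → ℂ) → ℂ} {p : MvPowerSeries (Fin n) ℂ}
    (h : HasTaylorSeries f p) (l : Fin n) :
    fderiv ℂ f 0 (Pi.single l 1) = coeff (Finsupp.single l 1) p := by
  classical
  obtain ⟨P, hP, hPz⟩ := h.exists_hasFPowerSeriesAt
  have e : (Fin.snoc 0 (Pi.single l 1) : Fin 1 → Fin n → ℂ) = fun _ => Pi.single l 1 := by
    funext i
    have hi : i = Fin.last 0 := Fin.ext (by have := i.isLt; rw [Fin.val_last]; omega)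
    rw [hi, Fin.snoc_last]
  rw [hP.fderiv_eq, continuousMultilinearCurryFin1_apply, e, hPz,
    Finset.sum_eq_single (Finsupp.single l 1)]
  · simp [monom_single]
  · intro Q hQ hne
    obtain ⟨k, rfl⟩ := multiDeg_eq_one (mem_degEq.1 hQ)
    have : k ≠ l := fun h => hne (by rw [h])
    simp [monom_single, this]
  · intro h
    exact absurd (mem_degEq.2 (multiDeg_single l 1)) h

/-- Germs of holomorphic functions have a Taylor series. -/
theorem AnalyticAt.exists_hasTaylorSeries {f : (Fin n → ℂ) → ℂ} (hf : AnalyticAt ℂ f 0) :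
    ∃ p, HasTaylorSeries f p := by
  classical
  obtain ⟨P, r, hP⟩ := hf
  set c : (Σ m : ℕ, Fin m → Fin n) → ℂ := fun x => P x.1 fun i => Pi.single (x.2 i) 1 with hc
  set idx : (Σ m : ℕ, Fin m → Fin n) → (Fin n →₀ ℕ) := fun x =>
    ∑ i, Finsupp.single (x.2 i) 1 with hidx
  have hmon : ∀ x z, monom (idx x) z = ∏ i, z (x.2 i) := by
    intro x z
    have : ∀ S : Finset (Fin x.1), monom (∑ i ∈ S, Finsupp.single (x.2 i) 1) z =
        ∏ i ∈ S, z (x.2 i) := by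
      intro S
      induction S using Finset.induction_on with
      | empty => simp [monom]
      | insert i S hi ih =>
        rw [Finset.sum_insert hi, Finset.prod_insert hi, monom_add, ih, monom_single]
    exact this _
  -- Expansion of the homogeneous terms.
  have hexp : ∀ m (z : Fin n → ℂ), (P m fun _ => z) =
      ∑ s : Fin m → Fin n, monom (idx ⟨m, s⟩) z * c ⟨m, s⟩ := by
    intro m z
    have hz : z = ∑ k, z k • (Pi.single k 1 : Fin n → ℂ) := by
      funext i; simp [Finset.sum_apply, Pi.single_apply]
    have h1 := (P m).toMultilinearMap.map_sum
      (fun (_ : Fin m) (k : Fin n) => z k • (Pi.single k 1 : Fin n → ℂ))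
    simp only [← hz] at h1
    refine h1.trans (Finset.sum_congr rfl fun s _ => ?_)
    rw [MultilinearMap.map_smul_univ, hmon, smul_eq_mul]
    rfl
  have hcle : ∀ x, ‖c x‖ ≤ ‖P x.1‖ := by
    intro x
    refine ((P x.1).le_opNorm _).trans (mul_le_of_le_one_right (norm_nonneg _) ?_)
    refine Finset.prod_le_one (fun _ _ => norm_nonneg _) fun i _ => ?_
    rw [Pi.norm_single, norm_one]
  obtain ⟨r', hr'0, hr'⟩ := ENNReal.lt_iff_exists_nnreal_btwn.1 hP.r_pos
  have hr'0 : 0 < r' := by exact_mod_cast hr'0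
  have hsumP := P.summable_norm_mul_pow (hr'.trans_le hP.r_le)
  set ρ : ℝ≥0 := r' / (n + 1) with hρ
  have hρ0 : 0 < ρ := by positivity
  set p : MvPowerSeries (Fin n) ℂ := fun Q => ∑' x : idx ⁻¹' {Q}, c x with hp
  refine ⟨p, ?_⟩
  filter_upwards [eventually_norm_le hρ0] with z hz
  have hsummable : Summable fun x : (Σ m : ℕ, Fin m → Fin n) => monom (idx x) z * c x := by
    refine Summable.of_norm ?_
    rw [summable_sigma_of_nonneg fun _ => norm_nonneg _]
    refine ⟨fun m => (hasSum_fintype _).summable, ?_⟩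
    refine Summable.of_nonneg_of_le (fun m => tsum_nonneg fun _ => norm_nonneg _) (fun m => ?_)
      hsumP
    rw [tsum_fintype]
    have h1 : ∀ s : Fin m → Fin n, ‖monom (idx ⟨m, s⟩) z * c ⟨m, s⟩‖ ≤ (ρ : ℝ) ^ m * ‖P m‖ := by
      intro s
      rw [norm_mul]
      refine mul_le_mul ?_ (hcle ⟨m, s⟩) (norm_nonneg _) (by positivity)
      rw [hmon, norm_prod]
      calc _ ≤ ∏ _i : Fin m, (ρ : ℝ) :=
            Finset.prod_le_prod (fun _ _ => norm_nonneg _) fun i _ => hz _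
        _ = _ := by simp
    refine (Finset.sum_le_sum fun s _ => h1 s).trans ?_
    rw [Finset.sum_const, Finset.card_univ, Fintype.card_fun, Fintype.card_fin, Fintype.card_fin,
      nsmul_eq_mul]
    have h2 : (n : ℝ) * ρ ≤ r' := by
      rw [hρ]
      push_cast
      rw [mul_div_assoc', div_le_iff₀ (by positivity)]
      nlinarith [r'.coe_nonneg]
    calc ((n ^ m : ℕ) : ℝ) * ((ρ : ℝ) ^ m * ‖P m‖) = ‖P m‖ * ((n : ℝ) * ρ) ^ m := by
          push_cast; rw [mul_pow]; ring
      _ ≤ _ := by gcongr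
  have hzr : z ∈ Metric.eball (0 : Fin n → ℂ) r := by
    have h1 : ‖z‖ ≤ ρ := (pi_norm_le_iff_of_nonneg ρ.coe_nonneg).2 hz
    have h2 : ρ ≤ r' := by
      rw [hρ]
      exact div_le_self r'.coe_nonneg (by simp)
    rw [Metric.mem_eball, edist_zero_right]
    refine lt_of_le_of_lt ?_ hr'
    rw [enorm_eq_nnnorm, ENNReal.coe_le_coe, ← NNReal.coe_le_coe]
    exact h1.trans (by exact_mod_cast h2)
  have h1 := hP.hasSum hzr
  rw [zero_add] at h1
  have h2 : HasSum (fun x : (Σ m : ℕ, Fin m → Fin n) => monom (idx x) z * c x) (f z) := by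
    refine h1.sigma_of_hasSum (fun m => ?_) hsummable
    rw [hexp]
    exact hasSum_fintype _
  have e : (fun Q => coeff Q p * monom Q z) =
      fun Q => ∑' x : idx ⁻¹' {Q}, monom (idx x) z * c x := by
    funext Q
    have : ∀ x : idx ⁻¹' {Q}, monom (idx x) z * c x = monom Q z * c x := fun x => by
      rw [show idx x = Q from x.2]
    rw [tsum_congr this, tsum_mul_left, mul_comm]
    rfl
  rw [e]
  exact h2.tsum_fiberwise idx

end Analytic

/-! ### Convergence of the normalized conjugacy -/

section Majorant

open MvPowerSeries
open scoped ENNReal NNReal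

variable {n : ℕ}

/-- The real power series `v` majorizes `p` coefficientwise. -/
def MajorizedBy (p : MvPowerSeries (Fin n) ℂ) (v : MvPowerSeries (Fin n) ℝ) : Prop :=
  ∀ Q, ‖coeff Q p‖ ≤ coeff Q v

theorem MajorizedBy.mul {p q : MvPowerSeries (Fin n) ℂ} {u v : MvPowerSeries (Fin n) ℝ}
    (hp : MajorizedBy p u) (hq : MajorizedBy q v) : MajorizedBy (p * q) (u * v) := fun Q => by
  rw [coeff_mul, coeff_mul]
  refine (norm_sum_le _ _).trans (Finset.sum_le_sum fun x _ => ?_)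
  rw [norm_mul]
  exact mul_le_mul (hp _) (hq _) (norm_nonneg _) ((norm_nonneg _).trans (hp _))

theorem majorizedBy_one : MajorizedBy (1 : MvPowerSeries (Fin n) ℂ) 1 := fun Q => by
  classical
  rw [coeff_one, coeff_one]
  split_ifs <;> simp

theorem MajorizedBy.pow {p : MvPowerSeries (Fin n) ℂ} {u : MvPowerSeries (Fin n) ℝ}
    (hp : MajorizedBy p u) (d : ℕ) : MajorizedBy (p ^ d) (u ^ d) := by
  induction d with
  | zero => simpa using majorizedBy_one
  | succ d ih => rw [pow_succ, pow_succ]; exact ih.mul hp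

theorem MajorizedBy.prod_pow {a : Fin n → MvPowerSeries (Fin n) ℂ} {v : MvPowerSeries (Fin n) ℝ}
    (h : ∀ k, MajorizedBy (a k) v) (P : Fin n →₀ ℕ) :
    MajorizedBy (P.prod fun s e => a s ^ e) (v ^ multiDeg P) := by
  classical
  rw [Finsupp.prod_fintype _ _ fun _ => pow_zero _, multiDeg, ← Finset.prod_pow_eq_pow_sum]
  have : ∀ S : Finset (Fin n), MajorizedBy (∏ k ∈ S, a k ^ P k) (∏ k ∈ S, v ^ P k) := by
    intro S
    induction S using Finset.induction_on with
    | empty => simpa using majorizedBy_one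
    | insert k S hk ih =>
      rw [Finset.prod_insert hk, Finset.prod_insert hk]
      exact ((h k).pow _).mul ih
  exact this _

theorem coeff_pow_nonneg {v : MvPowerSeries (Fin n) ℝ} (hv : ∀ Q, 0 ≤ coeff Q v) (d : ℕ)
    (Q : Fin n →₀ ℕ) : 0 ≤ coeff Q (v ^ d) := by
  classical
  induction d generalizing Q with
  | zero =>
    rw [pow_zero, coeff_one]
    split_ifs <;> simp
  | succ d ih =>
    rw [pow_succ, coeff_mul]
    exact Finset.sum_nonneg fun x _ => mul_nonneg (ih _) (hv _)

theorem coeff_pow_eq_zero {v : MvPowerSeries (Fin n) ℝ} (hv : coeff 0 v = 0) {d : ℕ}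
    {Q : Fin n →₀ ℕ} (hQ : multiDeg Q < d) : coeff Q (v ^ d) = 0 := by
  induction d generalizing Q with
  | zero => omega
  | succ d ih =>
    rw [pow_succ', coeff_mul]
    refine Finset.sum_eq_zero fun x hx => ?_
    by_cases h0 : x.1 = 0
    · rw [h0, hv, zero_mul]
    · have h1 := Finset.HasAntidiagonal.mem_antidiagonal.1 hx
      have h2 := multiDeg_pos h0
      rw [← h1, multiDeg_add] at hQ
      rw [ih (by omega), mul_zero]

/-- The multi-indices of degree at most `N`, as a finite set. -/
def degLEFinset (n N : ℕ) : Finset (Fin n →₀ ℕ) := (finite_multiDeg_le N).toFinset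

theorem mem_degLEFinset {N : ℕ} {Q : Fin n →₀ ℕ} : Q ∈ degLEFinset n N ↔ multiDeg Q ≤ N := by
  simp [degLEFinset]

/-- The value at `(t, …, t)` of the truncation of `v` at degree `N`. -/
def truncEval (t : ℝ) (N : ℕ) (v : MvPowerSeries (Fin n) ℝ) : ℝ :=
  ∑ Q ∈ degLEFinset n N, coeff Q v * t ^ multiDeg Q

theorem truncEval_nonneg {t : ℝ} (ht : 0 ≤ t) {v : MvPowerSeries (Fin n) ℝ}
    (hv : ∀ Q, 0 ≤ coeff Q v) (N : ℕ) : 0 ≤ truncEval t N v :=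
  Finset.sum_nonneg fun Q _ => mul_nonneg (hv Q) (pow_nonneg ht _)

/-- Truncation at degree `M` of a product, when only terms of degree at most `N` of the factors
contribute. -/
theorem truncEval_mul_le {t : ℝ} (ht : 0 ≤ t) {u v : MvPowerSeries (Fin n) ℝ}
    (hu : ∀ Q, 0 ≤ coeff Q u) (hv : ∀ Q, 0 ≤ coeff Q v) {N M : ℕ}
    (h : ∀ P Q, multiDeg (P + Q) ≤ M → coeff P u ≠ 0 → coeff Q v ≠ 0 →
      multiDeg P ≤ N ∧ multiDeg Q ≤ N) :
    truncEval t M (u * v) ≤ truncEval t N u * truncEval t N v := by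
  classical
  set T := degLEFinset n N ×ˢ degLEFinset n N with hT
  set F : (Fin n →₀ ℕ) × (Fin n →₀ ℕ) → ℝ := fun x =>
    (coeff x.1 u * t ^ multiDeg x.1) * (coeff x.2 v * t ^ multiDeg x.2) with hF
  have hF0 : ∀ x, 0 ≤ F x := fun x =>
    mul_nonneg (mul_nonneg (hu _) (pow_nonneg ht _)) (mul_nonneg (hv _) (pow_nonneg ht _))
  have h1 : ∀ Q ∈ degLEFinset n M, coeff Q (u * v) * t ^ multiDeg Q ≤
      ∑ x ∈ T, if x.1 + x.2 = Q then F x else 0 := by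
    intro Q hQ
    have e : coeff Q (u * v) * t ^ multiDeg Q =
        ∑ x ∈ Finset.HasAntidiagonal.antidiagonal Q, F x := by
      rw [coeff_mul, Finset.sum_mul]
      refine Finset.sum_congr rfl fun x hx => ?_
      rw [← Finset.HasAntidiagonal.mem_antidiagonal.1 hx, multiDeg_add, pow_add]
      simp only [hF]
      ring
    rw [e, ← Finset.sum_filter_ne_zero, ← Finset.sum_filter]
    refine Finset.sum_le_sum_of_subset_of_nonneg (fun x hx => ?_) fun x _ _ => hF0 x
    obtain ⟨hx1, hx2⟩ := Finset.mem_filter.1 hx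
    rw [Finset.HasAntidiagonal.mem_antidiagonal] at hx1
    have h3 := h x.1 x.2 (by rw [hx1]; exact mem_degLEFinset.1 hQ)
      (fun h0 => hx2 (by simp [hF, h0])) (fun h0 => hx2 (by simp [hF, h0]))
    exact Finset.mem_filter.2
      ⟨Finset.mem_product.2 ⟨mem_degLEFinset.2 h3.1, mem_degLEFinset.2 h3.2⟩, hx1⟩
  calc truncEval t M (u * v)
      ≤ ∑ Q ∈ degLEFinset n M, ∑ x ∈ T, if x.1 + x.2 = Q then F x else 0 :=
        Finset.sum_le_sum h1
    _ = ∑ x ∈ T, ∑ Q ∈ degLEFinset n M, if x.1 + x.2 = Q then F x else 0 := Finset.sum_comm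
    _ ≤ ∑ x ∈ T, F x := by
        refine Finset.sum_le_sum fun x _ => ?_
        rw [Finset.sum_ite_eq]
        split_ifs
        · exact le_rfl
        · exact hF0 x
    _ = truncEval t N u * truncEval t N v := by
        rw [hT, Finset.sum_product, truncEval, truncEval, Finset.sum_mul_sum]

theorem truncEval_pow_le {t : ℝ} (ht : 0 ≤ t) {v : MvPowerSeries (Fin n) ℝ}
    (hv : ∀ Q, 0 ≤ coeff Q v) (N d : ℕ) : truncEval t N (v ^ d) ≤ truncEval t N v ^ d := by
  classical
  induction d with
  | zero =>
    rw [pow_zero, pow_zero, truncEval, Finset.sum_eq_single 0]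
    · simp
    · intro Q _ hQ
      simp [coeff_one, hQ]
    · intro h
      exact absurd (mem_degLEFinset.2 (by simp)) h
  | succ d ih =>
    rw [pow_succ, pow_succ]
    refine (truncEval_mul_le ht (coeff_pow_nonneg hv d) hv fun P Q h _ _ => ?_).trans
      (mul_le_mul_of_nonneg_right ih (truncEval_nonneg ht hv N))
    rw [multiDeg_add] at h
    omega

/-- The terms of degree at most `N + 1` of `v^d`, `d ≥ 2`, only involve those of degree at most `N`
of a series `v` without constant term. -/
theorem truncEval_succ_pow_le {t : ℝ} (ht : 0 ≤ t) {v : MvPowerSeries (Fin n) ℝ}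
    (hv : ∀ Q, 0 ≤ coeff Q v) (hv0 : coeff 0 v = 0) (N : ℕ) {d : ℕ} (hd : 2 ≤ d) :
    truncEval t (N + 1) (v ^ d) ≤ truncEval t N v ^ d := by
  obtain ⟨e, rfl⟩ : ∃ e, d = e + 1 := ⟨d - 1, by omega⟩
  rw [pow_succ, pow_succ]
  refine (truncEval_mul_le (N := N) ht (coeff_pow_nonneg hv e) hv fun P Q h hP hQ => ?_).trans
    (mul_le_mul_of_nonneg_right (truncEval_pow_le ht hv N e) (truncEval_nonneg ht hv N))
  have h1 : P ≠ 0 := by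
    rintro rfl
    exact hP (coeff_pow_eq_zero hv0 (by simp; omega))
  have h2 : Q ≠ 0 := by
    rintro rfl
    exact hQ hv0
  have := multiDeg_pos h1
  have := multiDeg_pos h2
  rw [multiDeg_add] at h
  omega

/-- Multiplying the coefficients of `u` by a superadditive weight `W` multiplies those of its powers
by at most `W`. -/
theorem coeff_pow_le_weight {u v : MvPowerSeries (Fin n) ℝ} {W : (Fin n →₀ ℕ) → ℝ}
    (hW0 : ∀ Q, 0 < W Q) (hu : ∀ Q, 0 ≤ coeff Q u) (hu0 : coeff 0 u = 0)
    (huv : ∀ Q, coeff Q v = W Q * coeff Q u)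
    (hW : ∀ Q₁ Q₂, Q₁ ≠ 0 → Q₂ ≠ 0 → W Q₁ * W Q₂ ≤ W (Q₁ + Q₂)) {d : ℕ} (hd : 1 ≤ d)
    (Q : Fin n →₀ ℕ) :
    coeff Q (v ^ d) ≤ W Q * coeff Q (u ^ d) ∧
      ∀ δ, (∀ Q₁ Q₂, Q₁ ≠ 0 → Q₂ ≠ 0 → Q₁ + Q₂ = Q → W Q₁ * W Q₂ ≤ δ * W Q) →
        coeff Q (v ^ (d + 1)) ≤ δ * W Q * coeff Q (u ^ (d + 1)) := by
  have hv0 : coeff 0 v = 0 := by rw [huv, hu0, mul_zero]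
  induction d, hd using Nat.le_induction generalizing Q with
  | base =>
    have h1 : ∀ Q, coeff Q (v ^ 1) ≤ W Q * coeff Q (u ^ 1) := fun Q => by
      rw [pow_one, pow_one, huv]
    refine ⟨h1 Q, fun δ hδ => ?_⟩
    rw [pow_succ v, pow_succ u, coeff_mul, coeff_mul, Finset.mul_sum]
    refine Finset.sum_le_sum fun x hx => ?_
    have hx := Finset.HasAntidiagonal.mem_antidiagonal.1 hx
    rw [pow_one, pow_one]
    by_cases hx1 : x.1 = 0
    · simp [hx1, hu0, hv0]
    by_cases hx2 : x.2 = 0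
    · simp [hx2, hu0, hv0]
    rw [huv, huv]
    calc _ = (W x.1 * W x.2) * (coeff x.1 u * coeff x.2 u) := by ring
      _ ≤ _ := mul_le_mul_of_nonneg_right (hδ _ _ hx1 hx2 hx) (mul_nonneg (hu _) (hu _))
  | succ d hd ih =>
    have h1 : ∀ Q, coeff Q (v ^ (d + 1)) ≤ W Q * coeff Q (u ^ (d + 1)) := fun Q => by
      have := (ih Q).2 1 fun Q₁ Q₂ h₁ h₂ h => by rw [one_mul, ← h]; exact hW _ _ h₁ h₂
      rwa [one_mul] at this
    refine ⟨h1 Q, fun δ hδ => ?_⟩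
    rw [pow_succ v, pow_succ u, coeff_mul, coeff_mul, Finset.mul_sum]
    refine Finset.sum_le_sum fun x hx => ?_
    have hx := Finset.HasAntidiagonal.mem_antidiagonal.1 hx
    by_cases hx1 : x.1 = 0
    · rw [hx1, coeff_pow_eq_zero hu0 (by simp), coeff_pow_eq_zero hv0 (by simp)]
      simp
    by_cases hx2 : x.2 = 0
    · simp [hx2, hu0, hv0]
    have hun := coeff_pow_nonneg hu (d + 1) x.1
    rw [huv x.2]
    calc coeff x.1 (v ^ (d + 1)) * (W x.2 * coeff x.2 u)
        ≤ (W x.1 * coeff x.1 (u ^ (d + 1))) * (W x.2 * coeff x.2 u) :=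
          mul_le_mul_of_nonneg_right (h1 _) (mul_nonneg (hW0 _).le (hu _))
      _ = (W x.1 * W x.2) * (coeff x.1 (u ^ (d + 1)) * coeff x.2 u) := by ring
      _ ≤ _ := mul_le_mul_of_nonneg_right (hδ _ _ hx1 hx2 hx) (mul_nonneg hun (hu _))

/-- If `v` majorizes the components of `a`, then `f ∘ a` is majorized by `∑ |f_P| v^|P|`; only terms
with `|P| ≤ |Q|` contribute to the coefficient of `x^Q`. -/
theorem norm_coeff_subst_le {a : Fin n → MvPowerSeries (Fin n) ℂ}
    (ha : ∀ k, constantCoeff (a k) = 0) {v : MvPowerSeries (Fin n) ℝ} (hv0 : coeff 0 v = 0)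
    (hav : ∀ k, MajorizedBy (a k) v) {f : MvPowerSeries (Fin n) ℂ} {N : ℕ} {Q : Fin n →₀ ℕ}
    (hQ : multiDeg Q ≤ N) :
    ‖coeff Q (subst a f)‖ ≤
      ∑ P ∈ degLEFinset n N, ‖coeff P f‖ * coeff Q (v ^ multiDeg P) := by
  rw [coeff_subst (hasSubst_of_zero ha),
    finsum_eq_sum_of_support_subset (s := degLEFinset n N)]
  · refine (norm_sum_le _ _).trans (Finset.sum_le_sum fun P _ => ?_)
    rw [norm_smul]
    exact mul_le_mul_of_nonneg_left (MajorizedBy.prod_pow hav P Q) (norm_nonneg _)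
  · intro P hP
    rw [Finset.mem_coe, mem_degLEFinset]
    by_contra hcon
    have h1 := MajorizedBy.prod_pow hav P Q
    rw [coeff_pow_eq_zero hv0 (by omega), norm_le_zero_iff] at h1
    exact hP (by simp only [h1, smul_zero])

/-- The majorant method: a power series `u` without constant term satisfying the implicit recursive
inequality `u ≤ x_1 + ⋯ + x_n + n ∑_{|P| ≥ 2} F_P u^|P|` coefficientwise converges. -/
theorem summable_of_recursive_bound {u : MvPowerSeries (Fin n) ℝ} (hu : ∀ Q, 0 ≤ coeff Q u)
    (hu0 : coeff 0 u = 0) {F : (Fin n →₀ ℕ) → ℝ} (hF0 : ∀ P, 0 ≤ F P)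
    (hF2 : ∀ P, multiDeg P < 2 → F P = 0) {ρ : ℝ} (hρ : 0 < ρ)
    (hF : Summable fun P => F P * ρ ^ multiDeg P)
    (hrec : ∀ N Q, multiDeg Q ≤ N → coeff Q u ≤
      (∑ l : Fin n, if Q = Finsupp.single l 1 then 1 else 0) +
        n * ∑ P ∈ degLEFinset n N, F P * coeff Q (u ^ multiDeg P)) :
    ∃ t : ℝ, 0 < t ∧ Summable fun Q => coeff Q u * t ^ multiDeg Q := by
  set K := ∑' P, F P * ρ ^ multiDeg P with hK
  have hK0 : 0 ≤ K := tsum_nonneg fun P => mul_nonneg (hF0 P) (by positivity)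
  -- With `s = 2 n t`, the set `[0, s]` is stable under `x ↦ n t + n K (x / ρ)²` for small `t`.
  obtain ⟨t, ht0, hts, htK⟩ : ∃ t : ℝ, 0 < t ∧ 2 * n * t ≤ ρ ∧
      n * (K * (2 * n * t / ρ) ^ 2) ≤ n * t := by
    have h1 : Tendsto (fun t : ℝ => 2 * n * t) (𝓝[>] 0) (𝓝 0) := by
      have : Tendsto (fun t : ℝ => 2 * n * t) (𝓝 0) (𝓝 (2 * n * 0)) :=
        (continuous_const.mul continuous_id).tendsto 0
      rw [mul_zero] at this
      exact this.mono_left nhdsWithin_le_nhds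
    have h2 : Tendsto (fun t : ℝ => K * (4 * n ^ 2 * t) / ρ ^ 2) (𝓝[>] 0) (𝓝 0) := by
      have : Tendsto (fun t : ℝ => K * (4 * n ^ 2 * t) / ρ ^ 2) (𝓝 0)
          (𝓝 (K * (4 * n ^ 2 * 0) / ρ ^ 2)) :=
        ((continuous_const.mul (continuous_const.mul continuous_id)).div_const _).tendsto 0
      rw [mul_zero, mul_zero, zero_div] at this
      exact this.mono_left nhdsWithin_le_nhds
    have h3 : ∀ᶠ t in 𝓝[>] (0 : ℝ), 0 < t := self_mem_nhdsWithin
    obtain ⟨t, h3, h1, h2⟩ := (h3.and ((h1.eventually (gt_mem_nhds hρ)).and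
      (h2.eventually (gt_mem_nhds one_pos)))).exists
    refine ⟨t, h3, le_of_lt h1, mul_le_mul_of_nonneg_left ?_ (by positivity)⟩
    calc K * (2 * n * t / ρ) ^ 2 = K * (4 * n ^ 2 * t) / ρ ^ 2 * t := by
          field_simp; ring
      _ ≤ 1 * t := mul_le_mul_of_nonneg_right (le_of_lt h2) h3.le
      _ = t := one_mul t
  set s : ℝ := 2 * n * t with hs
  have hs0 : 0 ≤ s := by positivity
  have hbound : ∀ N, truncEval t N u ≤ s := by
    intro N
    induction N with
    | zero =>
      rw [truncEval, Finset.sum_eq_zero]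
      · exact hs0
      · intro Q hQ
        have : Q = 0 := multiDeg_eq_zero.1 (Nat.le_zero.1 (mem_degLEFinset.1 hQ))
        rw [this, hu0, zero_mul]
    | succ N ih =>
      have hlin : ∑ Q ∈ degLEFinset n (N + 1),
          (∑ l : Fin n, if Q = Finsupp.single l 1 then (1 : ℝ) else 0) * t ^ multiDeg Q ≤ n * t := by
        simp only [Finset.sum_mul, ite_mul, one_mul, zero_mul]
        rw [Finset.sum_comm]
        calc _ ≤ ∑ _l : Fin n, t := by
              refine Finset.sum_le_sum fun l _ => ?_
              rw [Finset.sum_ite_eq']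
              split_ifs
              · rw [multiDeg_single, pow_one]
              · exact ht0.le
          _ = n * t := by simp
      have hpow : ∀ P ∈ degLEFinset n (N + 1),
          F P * truncEval t (N + 1) (u ^ multiDeg P) ≤ F P * ρ ^ multiDeg P * (s / ρ) ^ 2 := by
        intro P _
        by_cases hP : multiDeg P < 2
        · simp [hF2 P hP]
        · rw [mul_assoc]
          refine mul_le_mul_of_nonneg_left ?_ (hF0 P)
          obtain ⟨e, he⟩ : ∃ e, multiDeg P = e + 2 := ⟨multiDeg P - 2, by omega⟩
          calc _ ≤ truncEval t N u ^ multiDeg P :=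
                truncEval_succ_pow_le ht0.le hu hu0 N (by omega)
            _ ≤ s ^ multiDeg P := pow_le_pow_left₀ (truncEval_nonneg ht0.le hu N) ih _
            _ = s ^ e * s ^ 2 := by rw [he, pow_add]
            _ ≤ ρ ^ e * s ^ 2 := by gcongr
            _ = ρ ^ multiDeg P * (s / ρ) ^ 2 := by
              rw [he, pow_add]; field_simp
      calc truncEval t (N + 1) u
          ≤ ∑ Q ∈ degLEFinset n (N + 1),
            ((∑ l : Fin n, if Q = Finsupp.single l 1 then (1 : ℝ) else 0) +
              n * ∑ P ∈ degLEFinset n (N + 1), F P * coeff Q (u ^ multiDeg P)) *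
                t ^ multiDeg Q :=
            Finset.sum_le_sum fun Q hQ => mul_le_mul_of_nonneg_right
              (hrec (N + 1) Q (mem_degLEFinset.1 hQ)) (by positivity)
        _ = (∑ Q ∈ degLEFinset n (N + 1),
              (∑ l : Fin n, if Q = Finsupp.single l 1 then (1 : ℝ) else 0) * t ^ multiDeg Q) +
            n * ∑ P ∈ degLEFinset n (N + 1), F P * truncEval t (N + 1) (u ^ multiDeg P) := by
            simp only [add_mul, Finset.sum_add_distrib]
            congr 1
            simp only [truncEval, Finset.mul_sum, Finset.sum_mul]
            rw [Finset.sum_comm]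
            exact Finset.sum_congr rfl fun P _ => Finset.sum_congr rfl fun Q _ => by ring
        _ ≤ n * t + n * (K * (s / ρ) ^ 2) := by
            refine add_le_add hlin (mul_le_mul_of_nonneg_left ?_ (by positivity))
            refine (Finset.sum_le_sum hpow).trans ?_
            rw [← Finset.sum_mul]
            exact mul_le_mul_of_nonneg_right
              (hF.sum_le_tsum _ fun P _ => mul_nonneg (hF0 P) (by positivity)) (by positivity)
        _ ≤ s := by rw [hs] at htK ⊢; linarith
  refine ⟨t, ht0, summable_of_sum_le (c := s) (fun Q => mul_nonneg (hu Q) (by positivity))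
    fun S => ?_⟩
  refine le_trans ?_ (hbound (S.sup multiDeg))
  exact Finset.sum_le_sum_of_subset_of_nonneg
    (fun Q hQ => mem_degLEFinset.2 (Finset.le_sup hQ))
    fun Q _ _ => mul_nonneg (hu Q) (by positivity)

/-- A normalized formal solution of the homological equations converges, if the small divisors are
absorbed by a weight of exponential growth. -/
theorem majNorm_ne_top_of_homological {ι : Type} [Finite ι] {E : LowerSet (Fin n →₀ ℕ)}
    {μ : ι → Fin n → ℂ} {f : ι → Fin n → MvPowerSeries (Fin n) ℂ}
    (hfconv : ∀ p k, ∃ r : ℝ≥0, 0 < r ∧ majNorm r (f p k) ≠ ∞)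
    (hf2 : ∀ p k P, multiDeg P < 2 → coeff P (f p k) = 0)
    {a : Fin n → MvPowerSeries (Fin n) ℂ} (ha0 : ∀ k, constantCoeff (a k) = 0)
    (ha1 : ∀ k l, coeff (Finsupp.single l 1) (a k) = if l = k then 1 else 0)
    (haE : ∀ k Q, 2 ≤ multiDeg Q → Q ∉ E → coeff Q (a k) = 0)
    (hhom : ∀ p k, ∀ Q ∈ E, (monom Q (μ p) - μ p k) * coeff Q (a k) = coeff Q (subst a (f p k)))
    (hpos : ∀ Q ∈ E, 2 ≤ multiDeg Q → ∀ j, 0 < divisor μ Q j)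
    {W : (Fin n →₀ ℕ) → ℝ} {c : ℝ} (hc : 0 < c) (hW0 : ∀ Q, 0 < W Q)
    (hW1 : ∀ l, 1 ≤ W (Finsupp.single l 1))
    (hW : ∀ Q₁ Q₂, Q₁ ≠ 0 → Q₂ ≠ 0 → W Q₁ * W Q₂ ≤ W (Q₁ + Q₂))
    (hWE : ∀ Q₁ Q₂, Q₁ ≠ 0 → Q₂ ≠ 0 → Q₁ + Q₂ ∈ E → ∀ j,
        W Q₁ * W Q₂ ≤ divisor μ (Q₁ + Q₂) j * W (Q₁ + Q₂))
    (hWc : ∀ Q, W Q ≤ c ^ multiDeg Q) (k : Fin n) :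
    ∃ r : ℝ≥0, 0 < r ∧ majNorm r (a k) ≠ ∞ := by
  classical
  have := Fintype.ofFinite ι
  -- The weight turns the majorant `v` of the `a k` into a series `u` whose recursion no longer
  -- involves the divisors.
  set v : MvPowerSeries (Fin n) ℝ := fun Q => ∑ k, ‖coeff Q (a k)‖ with hv
  set u : MvPowerSeries (Fin n) ℝ := fun Q => (∑ k, ‖coeff Q (a k)‖) / W Q with hu
  have hvc : ∀ Q, coeff Q v = ∑ k, ‖coeff Q (a k)‖ := fun _ => rfl
  have huc : ∀ Q, coeff Q u = (∑ k, ‖coeff Q (a k)‖) / W Q := fun _ => rfl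
  have hun : ∀ Q, 0 ≤ coeff Q u := fun Q => by
    rw [huc]; exact div_nonneg (Finset.sum_nonneg fun _ _ => norm_nonneg _) (hW0 Q).le
  have hu0 : coeff 0 u = 0 := by
    rw [huc]; simp [ha0]
  have hv0 : coeff 0 v = 0 := by
    rw [hvc]; simp [ha0]
  have huv : ∀ Q, coeff Q v = W Q * coeff Q u := fun Q => by
    rw [hvc, huc, mul_div_cancel₀ _ (hW0 Q).ne']
  have hav : ∀ k, MajorizedBy (a k) v := fun k Q => by
    rw [hvc]
    exact Finset.single_le_sum (f := fun k => ‖coeff Q (a k)‖) (fun _ _ => norm_nonneg _)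
      (Finset.mem_univ k)
  set F : (Fin n →₀ ℕ) → ℝ := fun P => ∑ p, ∑ k, ‖coeff P (f p k)‖ with hF
  have hF0 : ∀ P, 0 ≤ F P := fun P =>
    Finset.sum_nonneg fun _ _ => Finset.sum_nonneg fun _ _ => norm_nonneg _
  have hFle : ∀ p k P, ‖coeff P (f p k)‖ ≤ F P := fun p k P =>
    (Finset.single_le_sum (f := fun k => ‖coeff P (f p k)‖) (fun _ _ => norm_nonneg _)
      (Finset.mem_univ k)).trans (Finset.single_le_sum
        (f := fun p => ∑ k, ‖coeff P (f p k)‖)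
        (fun _ _ => Finset.sum_nonneg fun _ _ => norm_nonneg _) (Finset.mem_univ p))
  have hF2 : ∀ P, multiDeg P < 2 → F P = 0 := fun P hP =>
    Finset.sum_eq_zero fun p _ => Finset.sum_eq_zero fun k _ => by rw [hf2 p k P hP, norm_zero]
  obtain ⟨ρ, hρ, hFsum⟩ : ∃ ρ : ℝ≥0, 0 < ρ ∧ Summable fun P => F P * (ρ : ℝ) ^ multiDeg P := by
    have h1 : ∀ᶠ ρ in 𝓝[>] (0 : ℝ≥0), ∀ p k, majNorm ρ (f p k) ≠ ∞ := by
      refine eventually_all.2 fun p => eventually_all.2 fun k => ?_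
      obtain ⟨r, hr, hfin⟩ := hfconv p k
      filter_upwards [nhdsWithin_le_nhds (gt_mem_nhds hr)] with s hs
      exact ne_top_of_le_ne_top hfin (majNorm_mono hs.le _)
    have h2 : ∀ᶠ ρ in 𝓝[>] (0 : ℝ≥0), 0 < ρ := self_mem_nhdsWithin
    obtain ⟨ρ, h2, h1⟩ := (h2.and h1).exists
    refine ⟨ρ, h2, ?_⟩
    simp only [hF, Finset.sum_mul]
    exact summable_sum fun p _ => summable_sum fun k _ => majNorm_ne_top_iff.1 (h1 p k)
  have hrec : ∀ N Q, multiDeg Q ≤ N → coeff Q u ≤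
      (∑ l : Fin n, if Q = Finsupp.single l 1 then 1 else 0) +
        n * ∑ P ∈ degLEFinset n N, F P * coeff Q (u ^ multiDeg P) := by
    intro N Q hQN
    have hnn : 0 ≤ (n : ℝ) * ∑ P ∈ degLEFinset n N, F P * coeff Q (u ^ multiDeg P) :=
      mul_nonneg (Nat.cast_nonneg n) (Finset.sum_nonneg fun P _ =>
        mul_nonneg (hF0 P) (coeff_pow_nonneg hun _ _))
    have hnn' : (0 : ℝ) ≤ ∑ l : Fin n, if Q = Finsupp.single l 1 then 1 else 0 :=
      Finset.sum_nonneg fun _ _ => by split_ifs <;> simp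
    rcases Nat.lt_or_ge (multiDeg Q) 2 with h2 | h2
    · rcases multiDeg_lt_two h2 with rfl | ⟨l, rfl⟩
      · rw [hu0]; exact add_nonneg hnn' hnn
      · refine le_add_of_le_of_nonneg ?_ hnn
        have e1 : coeff (Finsupp.single l 1) u = 1 / W (Finsupp.single l 1) := by
          rw [huc, Finset.sum_eq_single l]
          · rw [ha1, if_pos rfl, norm_one]
          · intro k _ hk
            rw [ha1, if_neg hk.symm, norm_zero]
          · simp
        rw [e1]
        have e2 : 1 / W (Finsupp.single l 1) ≤ 1 := by
          rw [div_le_one (hW0 _)]; exact hW1 l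
        refine e2.trans ?_
        have := Finset.single_le_sum
          (f := fun l' : Fin n => if Finsupp.single l 1 = Finsupp.single l' 1 then (1 : ℝ) else 0)
          (fun _ _ => by split_ifs <;> simp) (Finset.mem_univ l)
        simpa using this
    · by_cases hQE : Q ∈ E
      · refine le_add_of_nonneg_of_le hnn' ?_
        set G := ∑ P ∈ degLEFinset n N, F P * coeff Q (u ^ multiDeg P) with hG
        have hk : ∀ k, ‖coeff Q (a k)‖ ≤ W Q * G := by
          intro k
          have hD := hpos Q hQE h2 k
          -- Among the homological equations at `Q`, use the one with the largest divisor.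
          obtain ⟨p, hp⟩ := exists_divisor_eq hD
          have h3 : divisor μ Q k * ‖coeff Q (a k)‖ ≤ divisor μ Q k * (W Q * G) := by
            calc divisor μ Q k * ‖coeff Q (a k)‖ = ‖coeff Q (subst a (f p k))‖ := by
                  rw [hp, ← norm_mul, hhom p k Q hQE]
              _ ≤ ∑ P ∈ degLEFinset n N, ‖coeff P (f p k)‖ * coeff Q (v ^ multiDeg P) :=
                  norm_coeff_subst_le ha0 hv0 hav hQN
              _ ≤ ∑ P ∈ degLEFinset n N,
                    F P * (divisor μ Q k * W Q * coeff Q (u ^ multiDeg P)) := by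
                  refine Finset.sum_le_sum fun P _ => ?_
                  by_cases hP : multiDeg P < 2
                  · rw [hf2 p k P hP, hF2 P hP, norm_zero, zero_mul, zero_mul]
                  · obtain ⟨d, hd⟩ : ∃ d, multiDeg P = d + 1 := ⟨multiDeg P - 1, by omega⟩
                    have h4 := (coeff_pow_le_weight hW0 hun hu0 huv hW
                      (by omega : 1 ≤ d) Q).2 (divisor μ Q k) fun Q₁ Q₂ h₁ h₂ h => by
                        have := hWE Q₁ Q₂ h₁ h₂ (h ▸ hQE) k
                        rwa [h] at this
                    rw [← hd] at h4
                    have h5 : 0 ≤ divisor μ Q k * W Q * coeff Q (u ^ multiDeg P) :=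
                      mul_nonneg (mul_nonneg hD.le (hW0 Q).le) (coeff_pow_nonneg hun _ _)
                    exact (mul_le_mul_of_nonneg_left h4 (norm_nonneg _)).trans
                      (mul_le_mul_of_nonneg_right (hFle p k P) h5)
              _ = divisor μ Q k * (W Q * G) := by
                  rw [hG, Finset.mul_sum, Finset.mul_sum]
                  exact Finset.sum_congr rfl fun P _ => by ring
          exact le_of_mul_le_mul_left h3 hD
        rw [huc, div_le_iff₀ (hW0 Q)]
        calc ∑ k, ‖coeff Q (a k)‖ ≤ ∑ _k : Fin n, W Q * G := Finset.sum_le_sum fun k _ => hk k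
          _ = n * G * W Q := by simp; ring
      · have : coeff Q u = 0 := by
          rw [huc, Finset.sum_eq_zero fun k _ => by rw [haE k Q h2 hQE, norm_zero], zero_div]
        rw [this]; exact add_nonneg hnn' hnn
  obtain ⟨t, ht, hsum⟩ := summable_of_recursive_bound hun hu0 hF0 hF2
    (by exact_mod_cast hρ : (0 : ℝ) < ρ) hFsum hrec
  obtain ⟨τ, hτ⟩ : ∃ τ : ℝ≥0, (τ : ℝ) = t / c :=
    ⟨Real.toNNReal (t / c), Real.coe_toNNReal _ (div_pos ht hc).le⟩
  refine ⟨τ, by rw [← NNReal.coe_pos, hτ]; exact div_pos ht hc, majNorm_ne_top_iff.2 ?_⟩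
  rw [hτ]
  refine Summable.of_nonneg_of_le (fun Q => by positivity) (fun Q => ?_) hsum
  calc ‖coeff Q (a k)‖ * (t / c) ^ multiDeg Q ≤ coeff Q v * (t / c) ^ multiDeg Q := by
        gcongr; exact hav k Q
    _ = coeff Q u * (W Q * (t / c) ^ multiDeg Q) := by rw [huv]; ring
    _ ≤ coeff Q u * (c ^ multiDeg Q * (t / c) ^ multiDeg Q) := by
        refine mul_le_mul_of_nonneg_left ?_ (hun Q)
        gcongr; exact hWc Q
    _ = coeff Q u * t ^ multiDeg Q := by
        rw [← mul_pow, mul_div_cancel₀ _ hc.ne']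

end Majorant

/-! ### Monomial ideals of germs -/

section Ideals

open MvPowerSeries

variable {n : ℕ}

theorem monomGerm_add (P Q : Fin n →₀ ℕ) : monomGerm (P + Q) = monomGerm P * monomGerm Q := by
  apply Subtype.ext
  change Germ.ofFun (monom (P + Q)) = Germ.ofFun (monom P) * Germ.ofFun (monom Q)
  have : monom (P + Q) = monom P * monom Q := funext fun z => monom_add P Q z
  rw [this]
  rfl

/-- The multi-indices of the monomials which do not belong to `I`. -/
def outside (I : Ideal (HolGerm n)) : LowerSet (Fin n →₀ ℕ) where
  carrier := {Q | monomGerm Q ∉ I}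
  lower' := fun P Q h hP hQ => hP (by
    obtain ⟨R, rfl⟩ := exists_add_of_le h
    rw [monomGerm_add]
    exact I.mul_mem_right _ hQ)

theorem formalIdeal_le (I : Ideal (HolGerm n)) : formalIdeal I ≤ vanishIdeal (outside I) := by
  classical
  refine Ideal.span_le.2 ?_
  rintro _ ⟨Q, hQ, rfl⟩ P hP
  rw [coeff_monomial, if_neg]
  rintro rfl
  exact hP hQ

theorem IsProperlyEmbedded.isMonomialIdeal {I : Ideal (HolGerm n)} (h : IsProperlyEmbedded I) :
    IsMonomialIdeal I :=
  let ⟨R, hR, _⟩ := h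
  ⟨R, hR⟩

theorem monomial_mem_vanishIdeal {I : Ideal (HolGerm n)} {Q : Fin n →₀ ℕ} (hQ : monomGerm Q ∈ I) :
    (monomial Q 1 : MvPowerSeries (Fin n) ℂ) ∈ vanishIdeal (outside I) :=
  formalIdeal_le I (Ideal.subset_span ⟨Q, hQ, rfl⟩)

/-- The Taylor series of an element of a monomial ideal only involves monomials of the ideal. -/
theorem GermMem.mem_vanishIdeal {I : Ideal (HolGerm n)} (hI : IsMonomialIdeal I)
    {f : (Fin n → ℂ) → ℂ} (hf : GermMem I f) {p : MvPowerSeries (Fin n) ℂ}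
    (hp : HasTaylorSeries f p) : p ∈ vanishIdeal (outside I) := by
  obtain ⟨R, hR⟩ := hI
  obtain ⟨g, hg, hgf⟩ := hf
  have hg' : g ∈ Ideal.span (monomGerm '' R) := hR ▸ hg
  have hex : ∀ g : HolGerm n, ∃ f q, (g : Germ (𝓝 (0 : Fin n → ℂ)) ℂ) = Germ.ofFun f ∧
      HasTaylorSeries f q := by
    rintro ⟨_, f, hf, rfl⟩
    obtain ⟨q, hq⟩ := AnalyticAt.exists_hasTaylorSeries hf
    exact ⟨f, q, rfl, hq⟩
  have heq : ∀ {f₁ f₂ : (Fin n → ℂ) → ℂ} {q₁ q₂ : MvPowerSeries (Fin n) ℂ},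
      (Germ.ofFun f₁ : Germ (𝓝 (0 : Fin n → ℂ)) ℂ) = Germ.ofFun f₂ → HasTaylorSeries f₁ q₁ →
      HasTaylorSeries f₂ q₂ → q₁ = q₂ := fun h h₁ h₂ =>
    (h₁.congr (Germ.coe_eq.1 h)).unique h₂
  have key : ∀ g ∈ Ideal.span (monomGerm '' R), ∀ f p,
      (g : Germ (𝓝 (0 : Fin n → ℂ)) ℂ) = Germ.ofFun f → HasTaylorSeries f p →
      p ∈ vanishIdeal (outside I) := by
    intro g hg'
    induction hg' using Submodule.span_induction with
    | mem x hx =>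
      obtain ⟨Q, hQ, rfl⟩ := hx
      intro f p hf hp
      rw [← heq (f₁ := monom Q) hf (hasTaylorSeries_monom Q) hp]
      exact monomial_mem_vanishIdeal (hR ▸ Ideal.subset_span ⟨Q, hQ, rfl⟩)
    | zero =>
      intro f p hf hp
      rw [← heq (f₁ := fun _ => 0) hf (Eventually.of_forall fun z => by
        simp : HasTaylorSeries (fun _ => 0) 0) hp]
      exact Ideal.zero_mem _
    | add x y hx hy ihx ihy =>
      intro f p hf hp
      obtain ⟨f₁, q₁, e₁, h₁⟩ := hex x
      obtain ⟨f₂, q₂, e₂, h₂⟩ := hex y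
      have e : (Germ.ofFun (fun z => f₁ z + f₂ z) : Germ (𝓝 (0 : Fin n → ℂ)) ℂ) = Germ.ofFun f := by
        rw [← hf]
        change Germ.ofFun f₁ + Germ.ofFun f₂ =
          (x : Germ (𝓝 (0 : Fin n → ℂ)) ℂ) + (y : Germ (𝓝 (0 : Fin n → ℂ)) ℂ)
        rw [e₁, e₂]
      rw [← heq e (h₁.add h₂) hp]
      exact Ideal.add_mem _ (ihx _ _ e₁ h₁) (ihy _ _ e₂ h₂)
    | smul c x hx ih =>
      intro f p hf hp
      obtain ⟨f₁, q₁, e₁, h₁⟩ := hex c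
      obtain ⟨f₂, q₂, e₂, h₂⟩ := hex x
      have e : (Germ.ofFun (fun z => f₁ z * f₂ z) : Germ (𝓝 (0 : Fin n → ℂ)) ℂ) = Germ.ofFun f := by
        rw [← hf]
        change Germ.ofFun f₁ * Germ.ofFun f₂ =
          (c : Germ (𝓝 (0 : Fin n → ℂ)) ℂ) * (x : Germ (𝓝 (0 : Fin n → ℂ)) ℂ)
        rw [e₁, e₂]
      rw [← heq e (h₁.mul h₂) hp]
      exact Ideal.mul_mem_left _ _ (ih _ _ e₂ h₂)
  exact key g hg' f p hgf hp

theorem germMem_monom {I : Ideal (HolGerm n)} {Q : Fin n →₀ ℕ} :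
    GermMem I (monom Q) ↔ monomGerm Q ∈ I :=
  ⟨fun ⟨g, hg, e⟩ => by
    have : g = monomGerm Q := Subtype.ext e
    rwa [← this], fun h => ⟨_, h, rfl⟩⟩

theorem GermMem.congr {I : Ideal (HolGerm n)} {f g : (Fin n → ℂ) → ℂ} (h : GermMem I f)
    (hfg : f =ᶠ[𝓝 0] g) : GermMem I g := by
  obtain ⟨x, hx, e⟩ := h
  exact ⟨x, hx, e.trans (Germ.coe_eq.2 hfg)⟩

theorem germMem_sum {I : Ideal (HolGerm n)} (S : Finset (Fin n →₀ ℕ)) (c : (Fin n →₀ ℕ) → ℂ)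
    (h : ∀ Q ∈ S, c Q ≠ 0 → monomGerm Q ∈ I) : GermMem I fun z => ∑ Q ∈ S, c Q * monom Q z := by
  classical
  induction S using Finset.induction_on with
  | empty => exact ⟨0, I.zero_mem, by simp; rfl⟩
  | insert Q S hQ ih =>
    obtain ⟨g, hg, e⟩ := ih fun P hP => h P (Finset.mem_insert_of_mem hP)
    have hc : (⟨Germ.ofFun fun _ => c Q, fun _ => c Q, analyticAt_const, rfl⟩ : HolGerm n) *
        monomGerm Q ∈ I := by
      by_cases h0 : c Q = 0
      · have : (⟨Germ.ofFun fun _ => c Q, fun _ => c Q, analyticAt_const, rfl⟩ : HolGerm n) = 0 :=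
          Subtype.ext (by simp only [h0]; rfl)
        rw [this, zero_mul]
        exact I.zero_mem
      · exact I.mul_mem_left _ (h Q (Finset.mem_insert_self _ _) h0)
    refine ⟨_, I.add_mem hc hg, ?_⟩
    simp only [Finset.sum_insert hQ]
    change Germ.ofFun (fun _ => c Q) * Germ.ofFun (monom Q) + (g : Germ (𝓝 (0 : Fin n → ℂ)) ℂ) = _
    rw [e]
    rfl

/-! ### Linear changes of variables -/

theorem hasTaylorSeries_monom_linear (B : Matrix (Fin n) (Fin n) ℂ) (Q : Fin n →₀ ℕ) :
    HasTaylorSeries (fun z => monom Q (B *ᵥ z)) (Q.prod fun s e => linForm (B s) ^ e) := by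
  filter_upwards [eventually_all.2 fun k => hasTaylorSeries_linForm (B k)] with z hz
  exact SumsTo.prod_pow hz Q

theorem map_mem_vanishIdeal {E : LowerSet (Fin n →₀ ℕ)} {p : MvPowerSeries (Fin n) ℂ}
    (hp : p ∈ vanishIdeal E) : map (starRingEnd ℂ) p ∈ vanishIdeal E := fun Q hQ => by
  rw [coeff_map, hp Q hQ, map_zero]

theorem map_map_conj (p : MvPowerSeries (Fin n) ℂ) :
    map (starRingEnd ℂ) (map (starRingEnd ℂ) p) = p := by
  ext Q
  simp

/-- The invariance of the ideal passes to its completion: substituting `B x` maps the completion to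
itself. -/
theorem subst_linear_mem_vanishIdeal {I : Ideal (HolGerm n)} (hI : IsMonomialIdeal I)
    {B : Matrix (Fin n) (Fin n) ℂ} (hinv : InvariantUnderAntilinear I B)
    {p : MvPowerSeries (Fin n) ℂ} (hp : p ∈ vanishIdeal (outside I)) :
    subst (fun k => linForm (B k)) p ∈ vanishIdeal (outside I) := by
  refine subst_mem_vanishIdeal (fun k => constantCoeff_linForm _) fun P hP => ?_
  have hPI : monomGerm P ∈ I := not_not.1 fun h => hP (hp P h)
  have h1 := (hinv _ (germMem_monom.2 hPI)).mem_vanishIdeal hI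
    (hasTaylorSeries_monom_linear B P).conj
  have h2 := map_mem_vanishIdeal h1
  rwa [map_map_conj] at h2

theorem subst_diag_linForm (ν c : Fin n → ℂ) :
    subst (fun k => ν k • (X k : MvPowerSeries (Fin n) ℂ)) (linForm c) =
      linForm fun k => c k * ν k := by
  rw [subst_linForm (constantCoeff_diag ν), linForm]
  exact Finset.sum_congr rfl fun k _ => by rw [smul_smul]

theorem linForm_smul (t : ℂ) (c : Fin n → ℂ) : linForm (fun k => t * c k) = t • linForm c := by
  simp only [linForm, Finset.smul_sum, smul_smul]

/-- If the matrix `C` intertwines `diag ν` and `diag η`, every monomial `x^P` of `(C x)^Q` satisfies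
`ν^P = η^Q`. -/
theorem monom_eq_of_coeff_ne_zero {C : Matrix (Fin n) (Fin n) ℂ} {ν η : Fin n → ℂ}
    (h : ∀ s l, C s l * ν l = η s * C s l) {P Q : Fin n →₀ ℕ}
    (hP : coeff P (Q.prod fun s e => linForm (C s) ^ e) ≠ 0) : monom P ν = monom Q η := by
  have h1 := coeff_subst_diag ν (Q.prod fun s e => linForm (C s) ^ e) P
  have h2 : subst (fun k => ν k • (X k : MvPowerSeries (Fin n) ℂ))
      (Q.prod fun s e => linForm (C s) ^ e) =
      monom Q η • Q.prod fun s e => linForm (C s) ^ e := by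
    have e : ∀ s, subst (fun k => ν k • (X k : MvPowerSeries (Fin n) ℂ)) (linForm (C s)) =
        η s • linForm (C s) := fun s => by
      rw [subst_diag_linForm, ← linForm_smul]
      exact congrArg linForm (funext fun l => h s l)
    rw [← substAlgHom_apply (hasSubst_of_zero (constantCoeff_diag ν)),
      Finsupp.prod_fintype _ _ fun _ => pow_zero _, map_prod, monom, ← Finset.prod_smul]
    refine Finset.prod_congr rfl fun s _ => ?_
    rw [map_pow, substAlgHom_apply, e, smul_pow]
  rw [h2, map_smul, smul_eq_mul] at h1
  exact (mul_right_cancel₀ hP h1).symm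

/-- Every monomial outside an ideal invariant under `z ↦ B z̄`, where `B B̄ = 1`, has in its image
under this map a monomial outside the ideal. -/
theorem exists_coeff_ne_zero_of_invariant {I : Ideal (HolGerm n)} {B : Matrix (Fin n) (Fin n) ℂ}
    (hinv : InvariantUnderAntilinear I B) (hB : B * B.map star = 1) {Q : Fin n →₀ ℕ}
    (hQ : Q ∈ outside I) :
    ∃ P ∈ outside I, multiDeg P = multiDeg Q ∧
      coeff P (Q.prod fun s e => linForm (B.map star s) ^ e) ≠ 0 := by
  by_contra! hcon
  set G := Q.prod fun s e => linForm (B.map star s) ^ e with hG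
  -- The dilation `x ↦ 2 x` commutes with linear maps, and detects the degree of a monomial.
  have hdeg : ∀ P, coeff P G ≠ 0 → multiDeg P = multiDeg Q := fun P hP => by
    have := monom_eq_of_coeff_ne_zero (ν := fun _ => 2) (η := fun _ => 2)
      (fun s l => mul_comm _ _) hP
    rw [monom_const, monom_const] at this
    exact Nat.pow_right_injective le_rfl (by exact_mod_cast this)
  have hstar : ∀ z : Fin n → ℂ, star (B *ᵥ star z) = B.map star *ᵥ z := fun z => by
    funext k
    simp [Matrix.mulVec, dotProduct]
  have hgerm : GermMem I (fun z => star (monom Q (B *ᵥ star z))) := by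
    refine (germMem_sum (degEq n (multiDeg Q)) (fun P => coeff P G) fun P hP hne => ?_).congr ?_
    · by_contra hPI
      exact hne (hcon P hPI (mem_degEq.1 hP))
    · filter_upwards [hasTaylorSeries_monom_linear (B.map star) Q] with z hz
      rw [← monom_star, hstar]
      refine HasSum.unique (hasSum_sum_of_ne_finset_zero
        (f := fun P => coeff P G * monom P z) fun P hP => ?_) hz
      have : coeff P G = 0 := by
        by_contra hne
        exact hP (mem_degEq.2 (hdeg P hne))
      simp only [this, zero_mul]
  have h2 := hinv _ hgerm
  have h3 : (fun z => star (star (monom Q (B *ᵥ star (B *ᵥ star z))))) = monom Q := by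
    funext z
    rw [star_star, hstar, Matrix.mulVec_mulVec, hB, Matrix.one_mulVec]
  rw [h3, germMem_monom] at h2
  exact hQ h2

end Ideals

/-! ### Antiholomorphic involutions as power series -/

section Involutions

open MvPowerSeries
open scoped ENNReal NNReal

variable {n : ℕ}

/-- The series with conjugate coefficients. -/
abbrev conjSeries (p : MvPowerSeries (Fin n) ℂ) : MvPowerSeries (Fin n) ℂ :=
  map (starRingEnd ℂ) p

theorem constantCoeff_conjSeries {p : MvPowerSeries (Fin n) ℂ} (hp : constantCoeff p = 0) :
    constantCoeff (conjSeries p) = 0 := by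
  rw [constantCoeff_map, hp, map_zero]

theorem conjSeries_subst {a : Fin n → MvPowerSeries (Fin n) ℂ}
    (ha : ∀ k, constantCoeff (a k) = 0) (p : MvPowerSeries (Fin n) ℂ) :
    conjSeries (subst a p) = subst (fun k => conjSeries (a k)) (conjSeries p) :=
  map_subst (hasSubst_of_zero ha) p

theorem hasTaylorSeries_X (k : Fin n) : HasTaylorSeries (fun z => z k) (X k) := by
  have := hasTaylorSeries_monom (Finsupp.single k 1)
  rw [← X] at this
  exact this.congr (Eventually.of_forall fun z => monom_single k z)

theorem analyticAt_apply {f : (Fin n → ℂ) → Fin n → ℂ} (hf : AnalyticAt ℂ f 0) (k : Fin n) :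
    AnalyticAt ℂ (fun z => f z k) 0 :=
  ((ContinuousLinearMap.proj (R := ℂ) (φ := fun _ : Fin n => ℂ) k).analyticAt _).comp hf

theorem fderiv_apply_eq {f : (Fin n → ℂ) → Fin n → ℂ} (hf : AnalyticAt ℂ f 0) (k : Fin n)
    (v : Fin n → ℂ) : fderiv ℂ f 0 v k = fderiv ℂ (fun z => f z k) 0 v := by
  have h := (hasFDerivAt_pi'.1 hf.differentiableAt.hasFDerivAt k).fderiv
  rw [h]
  rfl

namespace IsAntiholomorphicInvolution

variable {ρ : (Fin n → ℂ) → (Fin n → ℂ)}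

theorem tendsto (h : IsAntiholomorphicInvolution ρ) : Tendsto ρ (𝓝 0) (𝓝 0) := by
  have h1 := h.antiholomorphic.continuousAt.tendsto.comp (tendsto_star_zero (n := n))
  simpa [Function.comp_def, h.map_zero] using h1

/-- The power series of `w ↦ ρ (w̄)`. -/
theorem exists_series (h : IsAntiholomorphicInvolution ρ) :
    ∃ g : Fin n → MvPowerSeries (Fin n) ℂ,
      (∀ k, HasTaylorSeries (fun w => ρ (star w) k) (g k)) ∧ (∀ k, constantCoeff (g k) = 0) ∧
      (∀ k l, coeff (Finsupp.single l 1) (g k) = antilinearPart ρ k l) ∧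
      ∀ k, subst (fun s => conjSeries (g s)) (g k) = X k := by
  choose g hg using fun k =>
    AnalyticAt.exists_hasTaylorSeries (analyticAt_apply h.antiholomorphic k)
  have hg0 : ∀ k, constantCoeff (g k) = 0 := fun k => by
    rw [← (hg k).apply_zero, star_zero, h.map_zero, Pi.zero_apply]
  refine ⟨g, hg, hg0, fun k l => ?_, fun k => ?_⟩
  · rw [antilinearPart, LinearMap.toMatrix'_apply, ← (hg k).fderiv_apply l]
    have e : (fun j => if j = l then (1 : ℂ) else 0) = Pi.single l 1 := by
      funext j; simp [Pi.single_apply]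
    rw [← fderiv_apply_eq h.antiholomorphic k]
    simp
  · have h1 := (hg k).comp (g := fun z => star (ρ z)) (a := fun s => conjSeries (g s))
      (fun s => (hg s).conj.congr (Eventually.of_forall fun z => by simp))
      fun s => constantCoeff_conjSeries (hg0 s)
    refine h1.unique ((hasTaylorSeries_X k).congr ?_)
    filter_upwards [h.involutive] with z hz
    simp [hz]

end IsAntiholomorphicInvolution

theorem linear_eq_one_of_subst_eq_X {g h : Fin n → MvPowerSeries (Fin n) ℂ}
    {B C : Matrix (Fin n) (Fin n) ℂ} (hg0 : ∀ k, constantCoeff (g k) = 0)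
    (hh0 : ∀ k, constantCoeff (h k) = 0)
    (hg : ∀ k l, coeff (Finsupp.single l 1) (g k) = B k l)
    (hh : ∀ k l, coeff (Finsupp.single l 1) (h k) = C k l)
    (he : ∀ k, subst h (g k) = X k) : B * C = 1 := by
  classical
  ext k l
  have h1 := coeff_single_subst hh0 (hg0 k) l
  rw [he k, coeff_X] at h1
  simp only [hg, hh] at h1
  rw [Matrix.mul_apply, ← h1, Matrix.one_apply]
  simp [Finsupp.single_left_inj, eq_comm]

end Involutions

/-! ### Linearization of the compositions -/

section Linearization

open MvPowerSeries
open scoped ENNReal NNReal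

variable {n m : ℕ} {ρ : Fin m → (Fin n → ℂ) → (Fin n → ℂ)}

theorem antilinearPart_mul_conj {ρ : (Fin n → ℂ) → (Fin n → ℂ)}
    (h : IsAntiholomorphicInvolution ρ) :
    antilinearPart ρ * (antilinearPart ρ).map star = 1 := by
  obtain ⟨g, -, hg0, hg1, hgX⟩ := h.exists_series
  refine linear_eq_one_of_subst_eq_X hg0 (fun k => constantCoeff_conjSeries (hg0 k)) hg1
    (fun k l => ?_) hgX
  rw [coeff_map, hg1]
  rfl

theorem map_star_mul (A B : Matrix (Fin n) (Fin n) ℂ) :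
    (A * B).map star = A.map star * B.map star :=
  Matrix.map_mul (f := starRingEnd ℂ)

theorem map_star_map_star (A : Matrix (Fin n) (Fin n) ℂ) : (A.map star).map star = A := by
  ext; simp

theorem conj_mul_antilinearPart {ρ : (Fin n → ℂ) → (Fin n → ℂ)}
    (h : IsAntiholomorphicInvolution ρ) :
    (antilinearPart ρ).map star * antilinearPart ρ = 1 :=
  mul_eq_one_comm.1 (antilinearPart_mul_conj h)

theorem compLinearPart_eq_diagonal (hdiag : ∀ i j, (compLinearPart (ρ i) (ρ j)).IsDiag)
    (i j : Fin m) : compLinearPart (ρ i) (ρ j) = Matrix.diagonal (mu ρ i j) :=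
  ((hdiag i j).diagonal_diag).symm

theorem mu_mul_mu (hρ : ∀ i, IsAntiholomorphicInvolution (ρ i))
    (hdiag : ∀ i j, (compLinearPart (ρ i) (ρ j)).IsDiag) (i j : Fin m) (k : Fin n) :
    mu ρ i j k * mu ρ j i k = 1 := by
  have h : compLinearPart (ρ i) (ρ j) * compLinearPart (ρ j) (ρ i) = 1 := by
    rw [compLinearPart, compLinearPart, Matrix.mul_assoc,
      ← Matrix.mul_assoc ((antilinearPart (ρ j)).map star),
      conj_mul_antilinearPart (hρ j), Matrix.one_mul, antilinearPart_mul_conj (hρ i)]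
  rw [compLinearPart_eq_diagonal hdiag, compLinearPart_eq_diagonal hdiag,
    Matrix.diagonal_mul_diagonal] at h
  have := congrFun (congrFun h k) k
  simpa using this

/-- `B_i` intertwines the conjugate of `D_{ij}` and `D_{ji}`. -/
theorem antilinearPart_intertwines (hρ : ∀ i, IsAntiholomorphicInvolution (ρ i))
    (hdiag : ∀ i j, (compLinearPart (ρ i) (ρ j)).IsDiag) (i j : Fin m) (s l : Fin n) :
    antilinearPart (ρ i) s l * star (mu ρ i j l) = mu ρ j i s * antilinearPart (ρ i) s l := by
  have h : antilinearPart (ρ i) * (compLinearPart (ρ i) (ρ j)).map star =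
      compLinearPart (ρ j) (ρ i) * antilinearPart (ρ i) := by
    rw [compLinearPart, compLinearPart, map_star_mul, map_star_map_star, ← Matrix.mul_assoc,
      antilinearPart_mul_conj (hρ i), Matrix.one_mul, Matrix.mul_assoc,
      conj_mul_antilinearPart (hρ i), Matrix.mul_one]
  rw [compLinearPart_eq_diagonal hdiag, compLinearPart_eq_diagonal hdiag,
    Matrix.diagonal_map (star_zero _)] at h
  have := congrFun (congrFun h s) l
  rwa [Matrix.mul_diagonal, Matrix.diagonal_mul] at this

/-- Non-resonance of the involutions excludes resonances of the compositions. -/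
theorem exists_monom_mu_ne [Nonempty (Fin m)] (hρ : ∀ i, IsAntiholomorphicInvolution (ρ i))
    (hdiag : ∀ i j, (compLinearPart (ρ i) (ρ j)).IsDiag) {I : Ideal (HolGerm n)}
    (hinv : ∀ i, InvariantUnderAntilinear I (antilinearPart (ρ i)))
    (hnonres : IsNonResonantOn ρ I) {Q : Fin n →₀ ℕ} (hQ : Q ∈ outside I)
    (h2 : 2 ≤ multiDeg Q) (k : Fin n) :
    ∃ p : Fin m × Fin m, monom Q (mu ρ p.1 p.2) ≠ mu ρ p.1 p.2 k := by
  by_contra! hcon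
  obtain ⟨i⟩ := ‹Nonempty (Fin m)›
  obtain ⟨P, hP, hdeg, hc⟩ :=
    exists_coeff_ne_zero_of_invariant (hinv i) (antilinearPart_mul_conj (hρ i)) hQ
  obtain ⟨j, hj⟩ := hnonres P (hdeg ▸ h2) hP i k
  have h3 : monom P (mu ρ i j) = monom Q (star (mu ρ j i)) :=
    monom_eq_of_coeff_ne_zero (fun s l => by
      have := congrArg star (antilinearPart_intertwines hρ hdiag i j s l)
      simpa [mul_comm] using this) hc
  rw [monom_star, h3, monom_star, star_star, hcon (j, i)] at hj
  exact hj (eq_inv_of_mul_eq_one_left (mu_mul_mu hρ hdiag j i k))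

/-- Brjuno's theorem modulo a monomial ideal: the compositions are conjugate to their linear parts
modulo the ideal, by a convergent series `a` tangent to the identity. -/
theorem exists_convergent_conjugacy (hρ : ∀ i, IsAntiholomorphicInvolution (ρ i))
    (hdiag : ∀ i j, (compLinearPart (ρ i) (ρ j)).IsDiag) {I : Ideal (HolGerm n)}
    (hinv : ∀ i, InvariantUnderAntilinear I (antilinearPart (ρ i)))
    {A : Set (Fin n →₀ ℕ)} (hA : (outside I : Set (Fin n →₀ ℕ)) ⊆ A)
    (hdioph : IsDiophantineOn (fun p : Fin m × Fin m => mu ρ p.1 p.2) A)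
    (hnonres : IsNonResonantOn ρ I)
    (hformal : IsFormallyLinearizableOn (fun p : Fin m × Fin m => ρ p.1 ∘ ρ p.2)
      (fun p => mu ρ p.1 p.2) I)
    {T : Fin m → Fin m → Fin n → MvPowerSeries (Fin n) ℂ}
    (hT : ∀ i j k, HasTaylorSeries (fun z => ρ i (ρ j z) k) (T i j k))
    (hT1 : ∀ i j k l, coeff (Finsupp.single l 1) (T i j k) =
      (Pi.single k (mu ρ i j k) : Fin n → ℂ) l) :
    ∃ a : Fin n → MvPowerSeries (Fin n) ℂ, (∀ k, constantCoeff (a k) = 0) ∧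
      (∀ k l, coeff (Finsupp.single l 1) (a k) = if l = k then 1 else 0) ∧
      (∀ k, ∃ r : ℝ≥0, 0 < r ∧ majNorm r (a k) ≠ ∞) ∧
      ∀ i j k, subst a (T i j k) - subst (fun l => mu ρ i j l • X l) (a k) ∈
        vanishIdeal (outside I) := by
  have hT0 : ∀ i j k, constantCoeff (T i j k) = 0 := fun i j k => by
    rw [← (hT i j k).apply_zero, (hρ j).map_zero, (hρ i).map_zero, Pi.zero_apply]
  rcases isEmpty_or_nonempty (Fin m) with hm | hm
  · refine ⟨X, fun k => constantCoeff_X k, fun k l => ?_, fun k => ?_, fun i => hm.elim i⟩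
    · simp [coeff_X, Finsupp.single_left_inj]
    · obtain ⟨r, hr, hfin, -⟩ := (hasTaylorSeries_X k).exists_majNorm
      exact ⟨r, hr, hfin⟩
  obtain ⟨Φ, Ψ, hΦ0, hΨ0, hΨΦ, hΦΨ, hΦ1, -, hlin⟩ := hformal
  obtain ⟨a, ha0, ha1, haE, ha⟩ := exists_normalized_conjugacy (E := outside I)
    (μ := fun p : Fin m × Fin m => mu ρ p.1 p.2) (T := fun p => T p.1 p.2) hΦ0 hΨ0 hΨΦ hΦΨ hΦ1
    (fun p k => hT0 p.1 p.2 k) (fun p k => by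
      obtain ⟨T', hT', hmem⟩ := hlin p
      have e : T' = T p.1 p.2 := funext fun k => (hT' k).unique (hT p.1 p.2 k)
      have := formalIdeal_le I (hmem k)
      rw [e] at this
      convert this using 2
      rw [X, ← map_smul, smul_eq_mul, mul_one])
  refine ⟨a, ha0, ha1, fun k => ?_, fun i j => ha (i, j)⟩
  have hμ : ∀ (p : Fin m × Fin m) k, mu ρ p.1 p.2 k ≠ 0 := fun p k =>
    left_ne_zero_of_mul_eq_one (mu_mul_mu hρ hdiag p.1 p.2 k)
  have hpos : ∀ Q ∈ outside I, 2 ≤ multiDeg Q → ∀ j,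
      0 < divisor (fun p : Fin m × Fin m => mu ρ p.1 p.2) Q j := fun Q hQ h2 j => by
    obtain ⟨p, hp⟩ := exists_monom_mu_ne hρ hdiag hinv hnonres hQ h2 j
    exact (norm_pos_iff.2 (sub_ne_zero.2 hp)).trans_le
      (le_divisor (μ := fun p : Fin m × Fin m => mu ρ p.1 p.2) Q j p)
  obtain ⟨ℓ, hℓ0, hℓ, hdio⟩ := hdioph.exists_exp_le
  obtain ⟨W, c, hc, hW0, hW1, hW, hWE, hWc⟩ := exists_weight (E := (outside I : Set _))
    (outside I).lower hμ hℓ0 hℓ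
    fun k Q hQ h2 hk j => hdio k Q (hA hQ) h2 hk j (hpos Q hQ h2 j).ne'
  refine majNorm_ne_top_of_homological (E := outside I)
    (μ := fun p : Fin m × Fin m => mu ρ p.1 p.2)
    (f := fun p k => T p.1 p.2 k - linForm (Pi.single k (mu ρ p.1 p.2 k)))
    (fun p k => ?_) (fun p k => coeff_sub_linForm (hT0 p.1 p.2 k) (hT1 p.1 p.2 k)) ha0 ha1 haE
    (fun p k Q hQ => coeff_conjugacy ha0 (ha p k) hQ) hpos hc hW0 hW1 hW hWE hWc k
  obtain ⟨r, hr, hfin, -⟩ :=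
    ((hT p.1 p.2 k).sub (hasTaylorSeries_linForm (Pi.single k (mu ρ p.1 p.2 k)))).exists_majNorm
  exact ⟨r, hr, hfin⟩

/-- In the linearizing coordinates, the involution `ρ i` coincides modulo the ideal with its
antilinear part. -/
theorem subst_sub_subst_linear_mem (hρ : ∀ i, IsAntiholomorphicInvolution (ρ i))
    (hdiag : ∀ i j, (compLinearPart (ρ i) (ρ j)).IsDiag) {I : Ideal (HolGerm n)}
    (hI : IsMonomialIdeal I) (hinv : ∀ i, InvariantUnderAntilinear I (antilinearPart (ρ i)))
    (hnonres : IsNonResonantOn ρ I) {g : Fin m → Fin n → MvPowerSeries (Fin n) ℂ}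
    (hg0 : ∀ i k, constantCoeff (g i k) = 0)
    (hg1 : ∀ i k l, coeff (Finsupp.single l 1) (g i k) = antilinearPart (ρ i) k l)
    (hgX : ∀ i k, subst (fun s => conjSeries (g i s)) (g i k) = X k)
    {T : Fin m → Fin m → Fin n → MvPowerSeries (Fin n) ℂ}
    (hTg : ∀ i j k, T i j k = subst (fun s => conjSeries (g j s)) (g i k))
    (hT1 : ∀ i j k l, coeff (Finsupp.single l 1) (T i j k) =
      (Pi.single k (mu ρ i j k) : Fin n → ℂ) l)
    {a : Fin n → MvPowerSeries (Fin n) ℂ} (ha0 : ∀ k, constantCoeff (a k) = 0)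
    (ha1 : ∀ k l, coeff (Finsupp.single l 1) (a k) = if l = k then 1 else 0)
    (ha : ∀ i j k, subst a (T i j k) - subst (fun l => mu ρ i j l • X l) (a k) ∈
        vanishIdeal (outside I)) (i : Fin m) (k : Fin n) :
    subst (fun s => conjSeries (a s)) (g i k) -
      subst (fun s => linForm (antilinearPart (ρ i) s)) (a k) ∈ vanishIdeal (outside I) := by
  have hcg0 : ∀ i k, constantCoeff (conjSeries (g i k)) = 0 := fun i k =>
    constantCoeff_conjSeries (hg0 i k)
  have hca0 : ∀ k, constantCoeff (conjSeries (a k)) = 0 := fun k =>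
    constantCoeff_conjSeries (ha0 k)
  have hT0 : ∀ i j k, constantCoeff (T i j k) = 0 := fun i j k => by
    rw [hTg]; exact constantCoeff_subst_zero (hcg0 j) (hg0 i k)
  have hcT0 : ∀ i j k, constantCoeff (conjSeries (T i j k)) = 0 := fun i j k =>
    constantCoeff_conjSeries (hT0 i j k)
  have hB0 : ∀ s, constantCoeff (linForm (antilinearPart (ρ i) s)) = 0 := fun s =>
    constantCoeff_linForm _
  have hgX' : ∀ i k, subst (g i) (conjSeries (g i k)) = X k := fun i k => by
    have := congrArg conjSeries (hgX i k)
    rw [conjSeries_subst (hcg0 i)] at this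
    simpa only [conjSeries, map_map_conj, map_X] using this
  -- The relations `ρ i ∘ F_{ij} = ρ j = F_{ji} ∘ ρ i`.
  have r1 : ∀ j k, subst (fun l => conjSeries (T i j l)) (g i k) = g j k := fun j k => by
    have e : (fun l => conjSeries (T i j l)) =
        fun l => subst (g j) (conjSeries (g i l)) := funext fun l => by
      rw [hTg, conjSeries_subst (hcg0 j)]
      simp only [conjSeries, map_map_conj]
    rw [e, ← subst_subst (hcg0 i) (hg0 j), hgX, subst_X (hasSubst_of_zero (hg0 j))]
  have r2 : ∀ j k, subst (g i) (T j i k) = g j k := fun j k => by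
    rw [hTg, subst_subst (hcg0 i) (hg0 i)]
    simp only [hgX']
    exact congrFun subst_self _
  refine sub_mem_of_conjugacy (ν := fun j => mu ρ j i) (cν := fun j => star (mu ρ i j))
    (T := fun j => T j i) (fun j => hT0 j i) (fun j => hT1 j i) (fun Q hQ h2 k => ?_)
    (fun k => constantCoeff_subst_zero hca0 (hg0 i k))
    (fun k => constantCoeff_subst_zero hB0 (ha0 k)) (fun k l => ?_) (fun j k => ?_)
    (fun j k => ?_) k
  · obtain ⟨j, hj⟩ := hnonres Q h2 hQ i k
    exact ⟨j, by rwa [← eq_inv_of_mul_eq_one_right (mu_mul_mu hρ hdiag i j k)] at hj⟩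
  · rw [coeff_single_subst hca0 (hg0 i k), coeff_single_subst hB0 (ha0 k)]
    simp only [hg1, coeff_map, ha1, coeff_linForm_single]
    rw [Finset.sum_eq_single l, Finset.sum_eq_single k]
    · simp
    · intro s _ hs; simp [hs]
    · simp
    · intro s _ hs; simp [hs.symm]
    · simp
  · have h1 : ∀ l, subst (fun s => conjSeries (a s)) (conjSeries (T i j l)) -
        subst (fun l => star (mu ρ i j) l • X l) (conjSeries (a l)) ∈ vanishIdeal (outside I) := by
      intro l
      have := map_mem_vanishIdeal (ha i j l)
      rw [map_sub] at this
      change conjSeries _ - conjSeries _ ∈ _ at this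
      rw [conjSeries_subst ha0, conjSeries_subst (constantCoeff_diag _)] at this
      convert this using 3
      funext l
      simp only [conjSeries]
      rw [smul_eq_C_mul, smul_eq_C_mul, map_mul, map_C, map_X]
      rfl
    have h2 := subst_congr_mod (fun l => constantCoeff_subst_zero hca0 (hcT0 i j l))
      (fun l => constantCoeff_subst_zero (constantCoeff_diag _) (hca0 l)) h1 (g i k)
    rw [← subst_subst (hcT0 i j) hca0, r1, ← subst_subst hca0 (constantCoeff_diag _)] at h2
    rw [← subst_subst (hg0 i) hca0, r2]
    exact h2
  · have h1 := subst_linear_mem_vanishIdeal hI (hinv i) (ha j i k)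
    rw [subst_sub (hasSubst_of_zero hB0), subst_subst ha0 hB0,
      subst_subst (constantCoeff_diag _) hB0] at h1
    rw [subst_subst hB0 (constantCoeff_diag _)]
    convert h1 using 3
    funext l
    rw [subst_diag_linForm, subst_smul (hasSubst_of_zero hB0), subst_X (hasSubst_of_zero hB0),
      ← linForm_smul]
    exact congrArg linForm (funext fun s => antilinearPart_intertwines hρ hdiag i j l s)

end Linearization

/-! ### Simultaneous linearization on the zero locus -/

section ZeroLocus

open MvPowerSeries
open scoped ENNReal NNReal

variable {n m : ℕ}

theorem monom_eq_zero_iff {Q : Fin n →₀ ℕ} {z : Fin n → ℂ} :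
    monom Q z = 0 ↔ ∃ a ∈ Q.support, z a = 0 := by
  simp [monom, Finset.prod_eq_zero_iff, and_comm]

theorem zero_mem_zeroLocus {I : Ideal (HolGerm n)} (hI : I ≠ ⊤) :
    (0 : Fin n → ℂ) ∈ zeroLocus I := by
  intro Q hQ
  have h0 : Q ≠ 0 := by
    rintro rfl
    refine hI ((Ideal.eq_top_iff_one I).2 ?_)
    have : monomGerm (0 : Fin n →₀ ℕ) = 1 := by
      apply Subtype.ext
      have e : monom (0 : Fin n →₀ ℕ) = 1 := funext fun z => by simp [monom]
      change Germ.ofFun (monom 0) = 1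
      rw [e]
      rfl
    rwa [← this]
  obtain ⟨l, hl⟩ := Finsupp.ne_iff.1 h0
  exact monom_eq_zero_iff.2 ⟨l, Finsupp.mem_support_iff.2 hl, rfl⟩

theorem star_mem_zeroLocus {I : Ideal (HolGerm n)} {z : Fin n → ℂ} (hz : z ∈ zeroLocus I) :
    star z ∈ zeroLocus I := fun Q hQ => by
  rw [monom_star, hz Q hQ, star_zero]

/-- The zero locus of a monomial ideal is a finite intersection of finite unions of coordinate
hyperplanes: there are only finitely many supports of monomials. -/
theorem exists_zeroLocus_eq (I : Ideal (HolGerm n)) : ∃ J : Finset (Finset (Fin n)),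
    zeroLocus I = {w | ∀ A ∈ J, ∃ a ∈ A, w a = 0} := by
  classical
  refine ⟨Finset.univ.filter fun A => ∃ Q, monomGerm Q ∈ I ∧ Q.support = A, ?_⟩
  ext w
  constructor
  · intro hw A hA
    obtain ⟨-, Q, hQ, rfl⟩ := Finset.mem_filter.1 hA
    exact monom_eq_zero_iff.1 (hw Q hQ)
  · intro hw Q hQ
    exact monom_eq_zero_iff.2 (hw _ (Finset.mem_filter.2 ⟨Finset.mem_univ _, Q, hQ, rfl⟩))

/-- Functions whose Taylor series agree modulo the ideal agree on its zero locus. -/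
theorem HasTaylorSeries.eventually_eq_on_zeroLocus {I : Ideal (HolGerm n)}
    {f g : (Fin n → ℂ) → ℂ} {p q : MvPowerSeries (Fin n) ℂ} (hf : HasTaylorSeries f p)
    (hg : HasTaylorSeries g q) (h : p - q ∈ vanishIdeal (outside I)) :
    ∀ᶠ z in 𝓝 (0 : Fin n → ℂ), z ∈ zeroLocus I → f z = g z := by
  filter_upwards [hf.sub hg] with z hz hI
  have h0 : HasSum (fun Q => coeff Q (p - q) * monom Q z) 0 := by
    have e : (fun Q => coeff Q (p - q) * monom Q z) = fun _ => 0 := funext fun Q => by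
      by_cases hQ : Q ∈ outside I
      · rw [h Q hQ, zero_mul]
      · rw [hI Q (not_not.1 hQ), mul_zero]
    rw [e]
    exact hasSum_zero
  exact sub_eq_zero.1 (hz.unique h0)

/-- A convergent series tangent to the identity defines a holomorphic change of coordinates. -/
theorem isHolomorphicCoordinateChange_of_series {Φ : (Fin n → ℂ) → Fin n → ℂ}
    {a : Fin n → MvPowerSeries (Fin n) ℂ} (hΦ : ∀ k, HasTaylorSeries (fun z => Φ z k) (a k))
    (ha0 : ∀ k, constantCoeff (a k) = 0)
    (ha1 : ∀ k l, coeff (Finsupp.single l 1) (a k) = if l = k then 1 else 0) :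
    IsHolomorphicCoordinateChange Φ := by
  have han : AnalyticAt ℂ Φ 0 := AnalyticAt.pi fun k => (hΦ k).analyticAt
  refine ⟨han, funext fun k => by rw [(hΦ k).apply_zero, ha0, Pi.zero_apply], ?_⟩
  refine ContinuousLinearMap.coe_injective (LinearMap.pi_ext' fun l => LinearMap.ext_ring ?_)
  funext k
  have := fderiv_apply_eq han k (Pi.single l 1)
  rw [(hΦ k).fderiv_apply, ha1] at this
  simpa [Pi.single_apply, eq_comm] using this

/-- A holomorphic change of coordinates has a holomorphic local inverse. -/
theorem IsHolomorphicCoordinateChange.exists_inverse {Φ : (Fin n → ℂ) → Fin n → ℂ}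
    (h : IsHolomorphicCoordinateChange Φ) :
    ∃ Ψ : (Fin n → ℂ) → Fin n → ℂ, AnalyticAt ℂ Ψ 0 ∧ ∀ᶠ w in 𝓝 0, Ψ (Φ w) = w := by
  have hs : HasStrictFDerivAt Φ
      ((ContinuousLinearEquiv.refl ℂ (Fin n → ℂ) : (Fin n → ℂ) →L[ℂ] (Fin n → ℂ))) 0 := by
    have := h.analyticAt.hasStrictFDerivAt
    rw [h.fderiv_eq] at this
    exact this
  set e := hs.toOpenPartialHomeomorph Φ with he
  have h0 : (0 : Fin n → ℂ) ∈ e.source := hs.mem_toOpenPartialHomeomorph_source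
  have han := e.analyticAt_symm' (i := ContinuousLinearEquiv.refl ℂ (Fin n → ℂ)) h0
    (by rw [he, hs.toOpenPartialHomeomorph_coe]; exact h.analyticAt)
    (by rw [he, hs.toOpenPartialHomeomorph_coe]; exact h.fderiv_eq)
  refine ⟨e.symm, ?_, ?_⟩
  · rwa [he, hs.toOpenPartialHomeomorph_coe, h.map_zero, ← he] at han
  · filter_upwards [e.open_source.mem_nhds h0] with w hw
    exact e.left_inv hw

theorem tendsto_mulVec_star (B : Matrix (Fin n) (Fin n) ℂ) :
    Tendsto (fun w : Fin n → ℂ => B *ᵥ star w) (𝓝 0) (𝓝 0) := by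
  have : Continuous fun w : Fin n → ℂ => B *ᵥ star w :=
    Continuous.matrix_mulVec continuous_const continuous_star
  simpa using this.tendsto 0

end ZeroLocus

end

theorem mainTheorem6 {n m : ℕ}
    (M : Fin m → Set (Fin n → ℂ)) (ρ : Fin m → (Fin n → ℂ) → (Fin n → ℂ))
    (hM : ∀ i, IsTotallyRealGerm (M i))
    (hρ : ∀ i, IsAntiholomorphicInvolution (ρ i))
    (hfix : ∀ i, ∀ᶠ z in 𝓝 (0 : Fin n → ℂ), z ∈ M i ↔ ρ i z = z)
    (hdist : ∀ i j, i ≠ j →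
      {z : Fin n → ℂ | antilinearPart (ρ i) *ᵥ star z = z} ≠
        {z : Fin n → ℂ | antilinearPart (ρ j) *ᵥ star z = z})
    (hcomm : IsCommutativeFamily ρ)
    (hdiag : ∀ i j, (compLinearPart (ρ i) (ρ j)).IsDiag)
    (I : Ideal (HolGerm n)) (hI : I ≠ ⊤)
    (hinv : ∀ i, InvariantUnderAntilinear I (antilinearPart (ρ i)))
    (hdioph :
      (IsMonomialIdeal I ∧
        IsDiophantineOn (fun p : Fin m × Fin m => mu ρ p.1 p.2) Set.univ) ∨
      (IsProperlyEmbedded I ∧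
        IsDiophantineOn (fun p : Fin m × Fin m => mu ρ p.1 p.2) {Q | monomGerm Q ∉ I}))
    (hnonres : IsNonResonantOn ρ I)
    (hformal : IsFormallyLinearizableOn (fun p : Fin m × Fin m => ρ p.1 ∘ ρ p.2)
      (fun p => mu ρ p.1 p.2) I) :
    ∃ (S : Set (Fin n → ℂ)) (Φ : (Fin n → ℂ) → (Fin n → ℂ)) (J : Finset (Finset (Fin n))),
      IsComplexAnalyticGerm S ∧ 0 ∈ S ∧ (∀ k, 0 ∈ M k ∩ S) ∧
      IsHolomorphicCoordinateChange Φ ∧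
      zeroLocus I = {w | ∀ A ∈ J, ∃ a ∈ A, w a = 0} ∧
      (∀ᶠ w in 𝓝 (0 : Fin n → ℂ), Φ w ∈ S ↔ w ∈ zeroLocus I) ∧
      ∀ k, ∀ᶠ w in 𝓝 (0 : Fin n → ℂ),
        Φ w ∈ M k ∩ S ↔ (w ∈ zeroLocus I ∧ antilinearPart (ρ k) *ᵥ star w = w) := by
  classical
  obtain ⟨A, hmono, hA, hdio⟩ : ∃ A : Set (Fin n →₀ ℕ), IsMonomialIdeal I ∧
      (outside I : Set (Fin n →₀ ℕ)) ⊆ A ∧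
      IsDiophantineOn (fun p : Fin m × Fin m => mu ρ p.1 p.2) A := by
    rcases hdioph with ⟨h1, h2⟩ | ⟨h1, h2⟩
    · exact ⟨_, h1, Set.subset_univ _, h2⟩
    · exact ⟨_, h1.isMonomialIdeal, fun _ h => h, h2⟩
  choose g hg hg0 hg1 hgX using fun i => (hρ i).exists_series
  have hcg0 : ∀ i k, MvPowerSeries.constantCoeff (conjSeries (g i k)) = 0 := fun i k =>
    constantCoeff_conjSeries (hg0 i k)
  set T : Fin m → Fin m → Fin n → MvPowerSeries (Fin n) ℂ := fun i j k =>
    MvPowerSeries.subst (fun s => conjSeries (g j s)) (g i k) with hTdef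
  have hT : ∀ i j k, HasTaylorSeries (fun z => ρ i (ρ j z) k) (T i j k) := fun i j k => by
    have := (hg i k).comp (g := fun z => star (ρ j z)) (a := fun s => conjSeries (g j s))
      (fun s => (hg j s).conj.congr (Eventually.of_forall fun z => by simp)) (hcg0 j)
    simpa only [star_star] using this
  have hT1 : ∀ i j k l, MvPowerSeries.coeff (Finsupp.single l 1) (T i j k) =
      (Pi.single k (mu ρ i j k) : Fin n → ℂ) l := fun i j k l => by
    rw [hTdef, coeff_single_subst (hcg0 j) (hg0 i k)]
    have e : ∑ s, MvPowerSeries.coeff (Finsupp.single s 1) (g i k) *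
        MvPowerSeries.coeff (Finsupp.single l 1) (conjSeries (g j s)) =
        compLinearPart (ρ i) (ρ j) k l := by
      rw [compLinearPart, Matrix.mul_apply]
      refine Finset.sum_congr rfl fun s _ => ?_
      rw [hg1, MvPowerSeries.coeff_map, hg1]
      rfl
    rw [e, compLinearPart_eq_diagonal hdiag, Matrix.diagonal_apply, Pi.single_apply]
    simp only [eq_comm]
  obtain ⟨a, ha0, ha1, hconv, ha⟩ :=
    exists_convergent_conjugacy hρ hdiag hinv hA hdio hnonres hformal hT hT1
  set Φ : (Fin n → ℂ) → Fin n → ℂ := fun z k => ∑' Q, MvPowerSeries.coeff Q (a k) * monom Q z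
    with hΦdef
  have hΦ : ∀ k, HasTaylorSeries (fun z => Φ z k) (a k) := fun k => by
    obtain ⟨r, hr, hfin⟩ := hconv k
    exact hasTaylorSeries_tsum hr hfin
  have hcoord := isHolomorphicCoordinateChange_of_series hΦ ha0 ha1
  have hΦt : Tendsto Φ (𝓝 0) (𝓝 0) := by
    simpa [hcoord.map_zero] using hcoord.analyticAt.continuousAt.tendsto
  obtain ⟨Ψ, hΨ, hΨΦ⟩ := hcoord.exists_inverse
  have hΨ0 : Ψ 0 = 0 := by
    have := hΨΦ.self_of_nhds
    rwa [hcoord.map_zero] at this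
  -- The involution is antilinear on the zero locus.
  have hkey : ∀ k, ∀ᶠ w in 𝓝 (0 : Fin n → ℂ), w ∈ zeroLocus I →
      ρ k (Φ w) = Φ (antilinearPart (ρ k) *ᵥ star w) := by
    intro k
    have h1 : ∀ l, ∀ᶠ u in 𝓝 (0 : Fin n → ℂ), u ∈ zeroLocus I →
        ρ k (Φ (star u)) l = Φ (antilinearPart (ρ k) *ᵥ u) l := fun l => by
      have t1 := (hg k l).comp (g := fun u => star (Φ (star u))) (a := fun s => conjSeries (a s))
        (fun s => (hΦ s).conj) fun s => constantCoeff_conjSeries (ha0 s)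
      have t2 := (hΦ l).comp (g := fun u => antilinearPart (ρ k) *ᵥ u)
        (a := fun s => linForm (antilinearPart (ρ k) s))
        (fun s => hasTaylorSeries_linForm _) fun s => constantCoeff_linForm _
      have t3 := t1.eventually_eq_on_zeroLocus t2
        (subst_sub_subst_linear_mem hρ hdiag hmono hinv hnonres hg0 hg1 hgX (fun _ _ _ => rfl)
          hT1 ha0 ha1 ha k l)
      simpa only [star_star] using t3
    filter_upwards [tendsto_star_zero.eventually (eventually_all.2 h1)] with w hw hI
    funext l
    have := hw l (star_mem_zeroLocus hI)
    rwa [star_star] at this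
  obtain ⟨J, hJ⟩ := exists_zeroLocus_eq I
  set S : Set (Fin n → ℂ) := {z | Ψ z ∈ zeroLocus I} with hS
  have hSΦ : ∀ᶠ w in 𝓝 (0 : Fin n → ℂ), Φ w ∈ S ↔ w ∈ zeroLocus I := by
    filter_upwards [hΨΦ] with w hw
    change Ψ (Φ w) ∈ zeroLocus I ↔ _
    rw [hw]
  have h0S : (0 : Fin n → ℂ) ∈ S := by
    change Ψ 0 ∈ zeroLocus I
    rw [hΨ0]
    exact zero_mem_zeroLocus hI
  refine ⟨S, Φ, J, ?_, h0S, fun k => ⟨(hfix k).self_of_nhds.2 (hρ k).map_zero, h0S⟩, hcoord, hJ,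
    hSΦ, fun k => ?_⟩
  · refine ⟨J.card, fun i z => ∏ b ∈ (J.equivFin.symm i : Finset (Fin n)), Ψ z b, fun i => ?_, ?_⟩
    · exact Finset.analyticAt_fun_prod _ fun b _ => analyticAt_apply hΨ b
    · refine Eventually.of_forall fun z => ?_
      change Ψ z ∈ zeroLocus I ↔ _
      rw [hJ]
      simp only [Finset.prod_eq_zero_iff]
      constructor
      · intro h i
        exact h _ (J.equivFin.symm i).2
      · intro h A hA
        simpa using h (J.equivFin ⟨A, hA⟩)
  · filter_upwards [hSΦ, hkey k, hΦt.eventually (hfix k), hΨΦ,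
      (tendsto_mulVec_star (antilinearPart (ρ k))).eventually hΨΦ] with w h1 h2 h3 h4 h5
    rw [Set.mem_inter_iff, h1, h3, and_comm]
    refine and_congr_right fun hw => ?_
    rw [h2 hw]
    exact ⟨fun h => by rw [← h5, h, h4], fun h => by rw [h]⟩
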